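/- Let $V$ be a finite set and let $H=(V,E)$ be a $k$-uniform hypergraph with a probability distribution $\Pi_k$ on $E$, $\Pi_k(e)>0$ for all $e\in E$ (uniform if $H$ is unweighted). For $v\in V$ let $\deg(v)=\sum_{e\ni v}\Pi_k(e)$, for $S\subseteq V$ let $\mathrm{vol}_H(S)=\sum_{v\in S}\deg(v)$, let $\partial_H(S)$ be the set of hyperedges meeting both $S$ and $V\setminus S$, and put $$\phi_H(S)=\frac{\Pi_k(\partial_H(S))}{\mathrm{vol}_H(S)},\qquad \phi_H=\min\Big\{\phi_H(S): S\subseteq V,\ 0<\mathrm{vol}_H(S)\le\tfrac12\mathrm{vol}_H(V)\Big\}.$$ Let $X$ be the induced simplicial complex, with levels $X(i)=\{s\subseteq V: |s|=i,\ s\subseteq e\text{ for some }e\in E\}$ and $\Pi_i(s)=\binom{k}{i}^{-1}\sum_{e\in E,\,e\supseteq s}\Pi_k(e)$. Define $\mathsf U_i:\mathbb R^{X(i)}\to\mathbb R^{X(i+1)}$ and $\mathsf D_{i+1}:\mathbb R^{X(i+1)}\to\mathbb R^{X(i)}$ by $$[\mathsf U_if](s)=\frac1{i+1}\sum_{t\in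 X(i),\,t\subseteq s}f(t),\qquad [\mathsf D_{i+1}g](s)=\frac1{i+1}\sum_{t\in X(i+1),\,t\supseteq s}g(t)\,\frac{\Pi_{i+1}(t)}{\Pi_i(s)},$$ and let $\mathsf D_{1,l}=\mathsf D_2\cdots\mathsf D_l$, $\mathsf U_{l,1}=\mathsf U_{l-1}\cdots\mathsf U_1$, $\mathsf N^{(2)}_{1,l}=\mathsf D_{1,l}\mathsf U_{l,1}$ and $\mathsf N_{1,l}=\begin{bmatrix}0&\mathsf D_{1,l}\\ \mathsf U_{l,1}&0\end{bmatrix}$. Write $\lambda_2$ for the second largest eigenvalue, counted with multiplicity. **Theorem.** Suppose that $\lambda_2(\mathsf N^{(2)}_{1,l})=1-\varepsilon$ or $\lambda_2(\mathsf N_{1,l})=1-\varepsilon$ for some $\varepsilon>0$ and some $l\in\{2,\dots,k\}$. Then $$\frac{\varepsilon}{k}\le\phi_H\le4\sqrt\varepsilon.$$ Furthermore, there are one algorithm (a program for a random access machine with integer registers and arrays, with logarithmic cost) and one polynomial $p$, both independent of $H,k,l,\varepsilon$, such that the following holds for every such $H$ whose distribution is given by positive integer weights $a_e$, i.e. $\Pi_k(e)=a_e/\sum_{e'\in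 E}a_{e'}$. On input $H$ (the numbers $|V|$ and $|E|$, the weights, and the incidence matrix), the algorithm halts in time at most $p\big(|V|+|E|+\sum_{e\in E}\lfloor\log_2a_e\rfloor\big)$, which is $p(|V|+|E|)$ if $H$ is unweighted (all $a_e=1$), and outputs a set $S\subseteq V$ with $0<\mathrm{vol}_H(S)\le\frac12\mathrm{vol}_H(V)$ and $\phi_H(S)\le4\sqrt\varepsilon$. -/

import Mathlib

namespace HypergraphWalk

/-! ### Weighted uniform hypergraphs and their expansion -/

/-- A `k`-uniform hypergraph on the vertex set `V` with a probability distribution `Π_k` on its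
hyperedges, every hyperedge having positive probability. -/
structure WeightedHypergraph (V : Type*) (k : ℕ) where
  /-- the set of hyperedges -/
  edges : Finset (Finset V)
  /-- the distribution `Π_k` (only its values on `edges` matter) -/
  prob : Finset V → ℝ
  card_edge : ∀ e ∈ edges, e.card = k
  prob_pos : ∀ e ∈ edges, 0 < prob e
  sum_prob : ∑ e ∈ edges, prob e = 1

variable {V : Type*} [Fintype V] [DecidableEq V] {k : ℕ}

namespace WeightedHypergraph

/-- The weighted degree of a vertex. -/
def deg (H : WeightedHypergraph V k) (v : V) : ℝ :=
  ∑ e ∈ H.edges with v ∈ e, H.prob e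

/-- The volume of a vertex set: the sum of the degrees of its vertices. -/
def vol (H : WeightedHypergraph V k) (S : Finset V) : ℝ :=
  ∑ v ∈ S, H.deg v

/-- The hyperedges that cross the boundary of `S`: those meeting both `S` and its complement. -/
def boundary (H : WeightedHypergraph V k) (S : Finset V) : Finset (Finset V) :=
  {e ∈ H.edges | (e ∩ S).Nonempty ∧ (e \ S).Nonempty}

/-- The expansion `φ_H(S) = Π_k(∂_H(S)) / vol_H(S)` of a vertex set (of positive volume). -/
noncomputable def expansion (H : WeightedHypergraph V k) (S : Finset V) : ℝ :=
  (∑ e ∈ H.boundary S, H.prob e) / H.vol S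

/-- The sets over which the expansion is minimised. Positivity of the volume says that the
quotient `φ_H(S)` makes sense; if every vertex lies in a hyperedge it means `S ≠ ∅`. -/
def IsAdmissible (H : WeightedHypergraph V k) (S : Finset V) : Prop :=
  0 < H.vol S ∧ H.vol S ≤ H.vol Finset.univ / 2

/-- The conductance `φ_H`: the minimum of `φ_H(S)` over all admissible `S`. This is the infimum
of a finite set of reals, which is non-empty as soon as `2 ≤ k`. -/
noncomputable def conductance (H : WeightedHypergraph V k) : ℝ :=
  sInf {x : ℝ | ∃ S : Finset V, H.IsAdmissible S ∧ x = H.expansion S}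

/-! ### The induced simplicial complex and its walks -/

/-- The level `X(l)` of the induced simplicial complex: the `l`-element subsets of hyperedges. -/
abbrev Level (H : WeightedHypergraph V k) (l : ℕ) : Type _ :=
  {s : Finset V // s.card = l ∧ ∃ e ∈ H.edges, s ⊆ e}

/-- The induced distribution `Π_l` on `X(l)`. -/
noncomputable def levelProb (H : WeightedHypergraph V k) (l : ℕ) (s : Finset V) : ℝ :=
  (1 / (k.choose l : ℝ)) * ∑ e ∈ H.edges with s ⊆ e, H.prob e

/-- The up operator `U_i : ℝ^{X(i)} → ℝ^{X(i+1)}`, averaging over the `i + 1` facets of `s`. -/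
noncomputable def up (H : WeightedHypergraph V k) (i : ℕ) :
    (H.Level i → ℝ) →ₗ[ℝ] (H.Level (i + 1) → ℝ) where
  toFun f s := (1 / ((i : ℝ) + 1)) * ∑ t : H.Level i with t.1 ⊆ s.1, f t
  map_add' f g := by
    funext s
    simp [Finset.sum_add_distrib, mul_add]
  map_smul' c f := by
    funext s
    simp only [Pi.smul_apply, smul_eq_mul, RingHom.id_apply, ← Finset.mul_sum]
    ring

/-- The down operator `D_{i+1} : ℝ^{X(i+1)} → ℝ^{X(i)}`, averaging over the `t ⊇ s` in `X(i+1)`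
with probabilities `Π_{i+1}(t) / ((i + 1) Π_i(s))`. -/
noncomputable def down (H : WeightedHypergraph V k) (i : ℕ) :
    (H.Level (i + 1) → ℝ) →ₗ[ℝ] (H.Level i → ℝ) where
  toFun g s := (1 / ((i : ℝ) + 1)) *
    ∑ t : H.Level (i + 1) with s.1 ⊆ t.1,
      g t * (H.levelProb (i + 1) t.1 / H.levelProb i s.1)
  map_add' f g := by
    funext s
    simp [Finset.sum_add_distrib, mul_add, add_mul]
  map_smul' c f := by
    funext s
    simp only [Pi.smul_apply, smul_eq_mul, RingHom.id_apply, mul_assoc, ← Finset.mul_sum]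
    ring

/-- `U_{l,m} = U_{l-1} ⋯ U_{m+1} U_m` for `l = m + j`. -/
noncomputable def upTo (H : WeightedHypergraph V k) (m : ℕ) :
    (j : ℕ) → ((H.Level m → ℝ) →ₗ[ℝ] (H.Level (m + j) → ℝ))
  | 0 => LinearMap.id
  | j + 1 => (H.up (m + j)).comp (H.upTo m j)

/-- `D_{m,l} = D_{m+1} D_{m+2} ⋯ D_l` for `l = m + j`. -/
noncomputable def downTo (H : WeightedHypergraph V k) (m : ℕ) :
    (j : ℕ) → ((H.Level (m + j) → ℝ) →ₗ[ℝ] (H.Level m → ℝ))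
  | 0 => LinearMap.id
  | j + 1 => (H.downTo m j).comp (H.down (m + j))

/-- The up-down walk `N^{(2)}_{m,l} = D_{m,l} U_{l,m}` on `X(m)` through `X(l)`, `l = m + j`. -/
noncomputable def upDownWalk (H : WeightedHypergraph V k) (m j : ℕ) :
    (H.Level m → ℝ) →ₗ[ℝ] (H.Level m → ℝ) :=
  (H.downTo m j).comp (H.upTo m j)

/-- The walk `N_{m,l}` between `X(m)` and `X(l)`, `l = m + j`, with block matrix
`[0, D_{m,l}; U_{l,m}, 0]`. -/
noncomputable def bipartiteWalk (H : WeightedHypergraph V k) (m j : ℕ) :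
    ((H.Level m → ℝ) × (H.Level (m + j) → ℝ)) →ₗ[ℝ]
      ((H.Level m → ℝ) × (H.Level (m + j) → ℝ)) :=
  ((H.downTo m j).comp (LinearMap.snd ℝ _ _)).prod ((H.upTo m j).comp (LinearMap.fst ℝ _ _))

end WeightedHypergraph

/-- `λ₂`: the second largest entry of the list of real eigenvalues with multiplicity (the walks
above are self-adjoint for the inner products weighted by `Π`, so all eigenvalues are real). -/
noncomputable def secondEigenvalue {M : Type*} [AddCommGroup M] [Module ℝ M]
    [Module.Finite ℝ M] [Module.Free ℝ M] (A : M →ₗ[ℝ] M) : ℝ :=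
  (A.charpoly.roots.sort (· ≥ ·)).getD 1 0

/-! ### Algorithms: random access machine programs with logarithmic cost

A program works on finitely many integer registers and finitely many integer arrays, whose names
are fixed in the program. Every elementary operation is charged for the bit lengths of the
integers and addresses involved. -/

/-- The contents of the registers and of the arrays. -/
structure State where
  /-- the registers -/
  reg : ℕ → ℤ
  /-- the arrays: `mem A i` is cell `i` of array `A` -/
  mem : ℕ → ℕ → ℤ

/-- Elementary instructions. -/
inductive Instr where
  /-- `d := c` -/
  | const (d : ℕ) (c : ℤ)
  /-- `d := a + b` -/
  | add (d a b : ℕ)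
  /-- `d := a - b` -/
  | sub (d a b : ℕ)
  /-- `d := a * b` -/
  | mul (d a b : ℕ)
  /-- `d := a / b`, integer division, with value `0` if `b` is `0` -/
  | div (d a b : ℕ)
  /-- `d := A[a]` -/
  | load (d A a : ℕ)
  /-- `A[a] := b` -/
  | store (A a b : ℕ)

/-- The bit length of an integer. -/
def bitLength (z : ℤ) : ℕ := z.natAbs.size

/-- The effect of an instruction. Negative addresses are read as `0`. -/
def Instr.eval : Instr → State → State
  | const d c, s => { s with reg := Function.update s.reg d c }
  | add d a b, s => { s with reg := Function.update s.reg d (s.reg a + s.reg b) }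
  | sub d a b, s => { s with reg := Function.update s.reg d (s.reg a - s.reg b) }
  | mul d a b, s => { s with reg := Function.update s.reg d (s.reg a * s.reg b) }
  | div d a b, s => { s with reg := Function.update s.reg d (s.reg a / s.reg b) }
  | load d A a, s => { s with reg := Function.update s.reg d (s.mem A (s.reg a).toNat) }
  | store A a b, s =>
    let row := Function.update (s.mem A) (s.reg a).toNat (s.reg b)
    { s with mem := Function.update s.mem A row }

/-- The cost of an instruction in a state. -/
def Instr.cost : Instr → State → ℕ
  | const _ c, _ => 1 + bitLength c
  | add _ a b, s => 1 + bitLength (s.reg a) + bitLength (s.reg b)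
  | sub _ a b, s => 1 + bitLength (s.reg a) + bitLength (s.reg b)
  | mul _ a b, s => (1 + bitLength (s.reg a)) * (1 + bitLength (s.reg b))
  | div _ a b, s => (1 + bitLength (s.reg a)) * (1 + bitLength (s.reg b))
  | load _ A a, s => 1 + bitLength (s.reg a) + bitLength (s.mem A (s.reg a).toNat)
  | store _ a b, s => 1 + bitLength (s.reg a) + bitLength (s.reg b)

/-- Programs. -/
inductive Prog where
  /-- a single instruction -/
  | instr (i : Instr)
  /-- first `p`, then `q` -/
  | seq (p q : Prog)
  /-- if register `a` is positive then `p`, else `q` -/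
  | ifPos (a : ℕ) (p q : Prog)
  /-- while register `a` is positive, do `p` -/
  | whilePos (a : ℕ) (p : Prog)

/-- `Exec p s s' t`: the program `p`, started in state `s`, halts in state `s'` after time
(total cost of all instructions executed and tests made) exactly `t`. -/
inductive Exec : Prog → State → State → ℕ → Prop where
  | instr (i : Instr) (s : State) : Exec (.instr i) s (i.eval s) (i.cost s)
  | seq {p q : Prog} {s s₁ s₂ : State} {t₁ t₂ : ℕ} :
      Exec p s s₁ t₁ → Exec q s₁ s₂ t₂ → Exec (.seq p q) s s₂ (t₁ + t₂)
  | ifTrue {a : ℕ} {p q : Prog} {s s₁ : State} {t : ℕ} :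
      0 < s.reg a → Exec p s s₁ t →
        Exec (.ifPos a p q) s s₁ (1 + bitLength (s.reg a) + t)
  | ifFalse {a : ℕ} {p q : Prog} {s s₁ : State} {t : ℕ} :
      ¬ 0 < s.reg a → Exec q s s₁ t →
        Exec (.ifPos a p q) s s₁ (1 + bitLength (s.reg a) + t)
  | whileTrue {a : ℕ} {p : Prog} {s s₁ s₂ : State} {t₁ t₂ : ℕ} :
      0 < s.reg a → Exec p s s₁ t₁ → Exec (.whilePos a p) s₁ s₂ t₂ →
        Exec (.whilePos a p) s s₂ (1 + bitLength (s.reg a) + t₁ + t₂)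
  | whileFalse {a : ℕ} {p : Prog} {s : State} :
      ¬ 0 < s.reg a → Exec (.whilePos a p) s s (1 + bitLength (s.reg a))

/-- The initial state for the hypergraph with vertices `0, …, n - 1` and hyperedges
`edge 0, …, edge (m - 1)` of weights `weight 0, …, weight (m - 1)`: register `0` holds `n`,
register `1` holds `m`, array `0` holds the weights, array `1` holds the rows of the incidence
matrix one after the other, and everything else is `0`. -/
def inputState {n m : ℕ} (edge : Fin m → Finset (Fin n)) (weight : Fin m → ℕ) : State where
  reg r := if r = 0 then (n : ℤ) else if r = 1 then (m : ℤ) else 0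
  mem A i :=
    if A = 0 then (if h : i < m then (weight ⟨i, h⟩ : ℤ) else 0)
    else if A = 1 then
      (if ∃ (j : Fin m) (v : Fin n), i = j.1 * n + v.1 ∧ v ∈ edge j then 1 else 0)
    else 0

/-- The vertex set that a halted machine outputs: its indicator function is in array `2`. -/
def outputSet (n : ℕ) (s : State) : Finset (Fin n) :=
  {v | s.mem 2 v.1 = 1}

end HypergraphWalk

set_option linter.unusedSectionVars false

/-! Everything reduces to one walk `W` on the vertices (`walk`): from a vertex move to a hyperedge
through it, chosen with probability proportional to its weight, then to a uniform vertex of that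
hyperedge. `W` is self-adjoint and positive semidefinite for the degree-weighted inner product.
Since `Π_l` is the law of a uniform `l`-subset of a random hyperedge, only the chances that one or
two given vertices of the hyperedge fall into the subset matter, and on the first level `1 -
N^{(2)}_{1,l} = k(l-1)/(l(k-1)) · (1 - W)` (`levelIp_upTo_lift`). The factor lies between 1/2 and 1.
For the bipartite walk the eigenvalue is a square root of one of `N^{(2)}`, which costs a further
factor 2. So, unless `1 ≤ ε`, the spectral gap `γ` of `W` satisfies `ε ≤ γ` and `kγ ≤ 4ε(k-1)`
(`energy_of_secondEigenvalue`).

The lower bound tests the Rayleigh quotient with a centred indicator function (`le_expansion`). The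
upper bound is Cheeger's argument: split an eigenfunction at its median, apply the co-area
inequality to the square of one part, and use that a crossing hyperedge separates at least `2(k-1)`
ordered pairs of vertices. A mean-zero function with Rayleigh quotient `R` thus has a sweep cut with
`(k-1)φ² ≤ 2kR` (`sweep`).

For the algorithm, `W` is iterated `T = n⁵m²` times on the indicator of every vertex. Log-convexity
of the moments of `W` shows that some start reaches Rayleigh quotient at most `2γ` as soon as `n ≤
2Tγ` (`power_iteration`), and then `φ² ≤ 4kγ/(k-1) ≤ 16ε`. Weights in binary can make `γ`
exponentially small, so that no polynomial `T` suffices. For `γ ≤ 1/(m²n⁴)` a second family takes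
over: the connected components of the hyperedges heavier than a given one. One of them is within a
factor `mn` of the optimal expansion (`exists_component_expansion_le`), and the optimum is at most
`nkγ/(k-1)` by a Cheeger inequality that is linear in `γ` and loses `n` (`linear_cheeger`). For so
small a `γ` the loss is affordable. The output is the best admissible candidate of both families
(`expansion_le_of_candidates`).

The program computes with integers only. Each step of the iteration is scaled by the product of the
non-zero degrees, which makes all divisions exact and leaves the sweep cuts unchanged; the entries
keep polynomially many bits. It is written in a small language of bounded loops, whose compiler is
verified once for effect and cost (`Cmd.exec_code`); correctness is then proved with loop
invariants. -/

namespace HypergraphWalk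

/-! ### The second eigenvalue of a self-adjoint operator with a fixed vector -/

section Spectral

variable {M : Type*} [AddCommGroup M] [Module ℝ M] [Module.Finite ℝ M] [Module.Free ℝ M]

/-- Variational description of the second eigenvalue of a self-adjoint operator with a fixed
vector `u`, when it is less than one. -/
theorem secondEigenvalue_of_core (c : InnerProductSpace.Core ℝ M) (T : M →ₗ[ℝ] M)
    (hsymm : ∀ x y, c.inner (T x) y = c.inner x (T y)) (u : M) (hu : u ≠ 0) (hTu : T u = u)
    (hdim : 2 ≤ Module.finrank ℝ M)
    (hlt : secondEigenvalue T < 1) :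
    (∀ x, c.inner x u = 0 → c.inner (T x) x ≤ secondEigenvalue T * c.inner x x) ∧
      ∃ x, x ≠ 0 ∧ c.inner x u = 0 ∧ T x = secondEigenvalue T • x := by
  let : NormedAddCommGroup M := c.toNormedAddCommGroup
  let : InnerProductSpace ℝ M := InnerProductSpace.ofCore c.toCore
  have hin : ∀ x y, c.inner x y = inner ℝ x y := fun _ _ => rfl
  simp only [hin] at *
  have hT : T.IsSymmetric := hsymm
  obtain ⟨n, hn⟩ : ∃ n, Module.finrank ℝ M = n + 2 := ⟨_, (Nat.sub_add_cancel hdim).symm⟩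
  have hsort := hT.sort_roots_charpoly_eq_eigenvalues hn
  set μ := hT.eigenvalues hn with hμ
  set b := hT.eigenvectorBasis hn with hb
  have hTb : ∀ i, T (b i) = μ i • b i := fun i => hT.apply_eigenvectorBasis hn i
  have hanti : Antitone μ := hT.eigenvalues_antitone hn
  have hsec : secondEigenvalue T = μ 1 := by
    unfold secondEigenvalue
    have h2 : T.charpoly.roots.sort (· ≥ ·) = List.ofFn μ := by simpa using hsort
    rw [h2]
    simp [List.getD, List.ofFn_succ]
  rw [hsec] at hlt ⊢
  -- All eigenvalues except possibly the first are below 1, so self-adjointness makes every `b i`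
  -- with `i ≠ 0` orthogonal to `u`. Hence `u` is a multiple of `b 0`, and orthogonality to `u`
  -- removes exactly that component.
  have horth : ∀ i, μ i ≠ 1 → inner ℝ (b i) u = 0 := by
    intro i hi
    have h1 := hsymm (b i) u
    rw [hTb, hTu, inner_smul_left] at h1
    have h2 : (μ i - 1) * inner ℝ (b i) u = 0 := by
      simp only [conj_trivial] at h1
      linarith
    exact (mul_eq_zero.1 h2).resolve_left (sub_ne_zero.2 hi)
  have hsmall : ∀ i, i ≠ 0 → μ i ≤ μ 1 := by
    intro i hi
    apply hanti
    rw [Fin.le_iff_val_le_val]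
    have : i.1 ≠ 0 := fun h => hi (Fin.ext h)
    simp
    omega
  have hub : ∀ i, i ≠ 0 → inner ℝ (b i) u = 0 := fun i hi =>
    horth i ((hsmall i hi).trans_lt hlt).ne
  have hu0 : inner ℝ (b 0) u ≠ 0 := by
    intro h0
    apply hu
    rw [← b.sum_repr' u]
    apply Finset.sum_eq_zero
    intro i _
    by_cases hi : i = 0
    · rw [hi, h0, zero_smul]
    · rw [hub i hi, zero_smul]
  refine ⟨?_, b 1, b.orthonormal.ne_zero 1, hub 1 (by simp), hTb 1⟩
  intro x hx
  have hx0 : inner ℝ (b 0) x = 0 := by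
    have h1 := b.sum_inner_mul_inner x u
    rw [hx, Finset.sum_eq_single 0] at h1
    · rw [real_inner_comm]
      exact (mul_eq_zero.1 h1).resolve_right hu0
    · intro i _ hi
      rw [hub i hi, mul_zero]
    · simp
  rw [← b.sum_inner_mul_inner (T x) x, ← b.sum_inner_mul_inner x x, Finset.mul_sum]
  apply Finset.sum_le_sum
  intro i _
  have h1 : inner ℝ (T x) (b i) = μ i * inner ℝ x (b i) := by
    rw [hsymm, hTb, inner_smul_right]
  rw [h1, real_inner_comm x (b i)]
  by_cases hi : i = 0
  · have h0 : inner ℝ x (b 0) = 0 := by rw [← real_inner_comm]; exact hx0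
    rw [hi, h0]
    simp
  · nlinarith [hsmall i hi, mul_self_nonneg (inner ℝ (b i) x), real_inner_comm x (b i)]

end Spectral

/-! ### Double counting over the subsets of a hyperedge -/

theorem sum_powersetCard_sum {α : Type*} [DecidableEq α] (e : Finset α) (l : ℕ) (f : α → ℝ) :
    ∑ s ∈ e.powersetCard (l + 1), ∑ v ∈ s, f v = ((e.card - 1).choose l : ℝ) * ∑ v ∈ e, f v := by
  have h1 : ∑ s ∈ e.powersetCard (l + 1), ∑ v ∈ s, f v =
      ∑ v ∈ e, ∑ s ∈ e.powersetCard (l + 1) with {v} ⊆ s, f v := by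
    apply Finset.sum_comm'
    intro s v
    simp only [Finset.mem_powersetCard, Finset.mem_filter, Finset.singleton_subset_iff]
    constructor
    · rintro ⟨⟨h1, h2⟩, h3⟩
      exact ⟨⟨⟨h1, h2⟩, h3⟩, h1 h3⟩
    · rintro ⟨⟨h1, h3⟩, _⟩
      exact ⟨h1, h3⟩
  rw [h1, Finset.mul_sum]
  apply Finset.sum_congr rfl
  intro v hv
  rw [Finset.sum_const, Finset.card_filter_powersetCard_subset _ _ _ (by simpa using hv) (by simp)]
  simp

/-- Expand the product into pairs of vertices: a diagonal pair lies in as many subsets as a single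
vertex does, an off-diagonal one in as many as contain two given vertices. -/
theorem sum_powersetCard_sum_mul_sum {α : Type*} [DecidableEq α] (e : Finset α) (l : ℕ)
    (f g : α → ℝ) :
    ∑ s ∈ e.powersetCard (l + 2), (∑ v ∈ s, f v) * ∑ v ∈ s, g v =
      ((e.card - 1).choose (l + 1) : ℝ) * ∑ v ∈ e, f v * g v +
      ((e.card - 2).choose l : ℝ) * ((∑ v ∈ e, f v) * (∑ v ∈ e, g v) - ∑ v ∈ e, f v * g v) := by
  have h1 : ∑ s ∈ e.powersetCard (l + 2), (∑ v ∈ s, f v) * ∑ v ∈ s, g v =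
      ∑ s ∈ e.powersetCard (l + 2), ∑ u ∈ s, f u * g u +
      ∑ s ∈ e.powersetCard (l + 2), ∑ p ∈ s.offDiag, f p.1 * g p.2 := by
    rw [← Finset.sum_add_distrib]
    apply Finset.sum_congr rfl
    intro s _
    rw [Finset.sum_mul_sum, ← Finset.sum_product', ← Finset.diag_union_offDiag,
      Finset.sum_union (Finset.disjoint_diag_offDiag s), Finset.sum_diag]
  have h3 : (∑ v ∈ e, f v) * (∑ v ∈ e, g v) - ∑ v ∈ e, f v * g v =
      ∑ p ∈ e.offDiag, f p.1 * g p.2 := by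
    rw [Finset.sum_mul_sum, ← Finset.sum_product', ← Finset.diag_union_offDiag,
      Finset.sum_union (Finset.disjoint_diag_offDiag e), Finset.sum_diag]
    ring
  have h2 : ∑ s ∈ e.powersetCard (l + 2), ∑ p ∈ s.offDiag, f p.1 * g p.2 =
      ∑ p ∈ e.offDiag, ∑ s ∈ e.powersetCard (l + 2) with {p.1, p.2} ⊆ s, f p.1 * g p.2 := by
    apply Finset.sum_comm'
    intro s p
    simp only [Finset.mem_powersetCard, Finset.mem_filter, Finset.insert_subset_iff,
      Finset.singleton_subset_iff, Finset.mem_offDiag]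
    constructor
    · rintro ⟨⟨h1, h2⟩, h3, h4, h5⟩
      exact ⟨⟨⟨h1, h2⟩, h3, h4⟩, h1 h3, h1 h4, h5⟩
    · rintro ⟨⟨h1, h3, h4⟩, _, _, h5⟩
      exact ⟨h1, h3, h4, h5⟩
  rw [h1, h3, h2, sum_powersetCard_sum, Finset.mul_sum (s := e.offDiag)]
  congr 1
  apply Finset.sum_congr rfl
  intro p hp
  rw [Finset.mem_offDiag] at hp
  have hc : ({p.1, p.2} : Finset α).card = 2 := Finset.card_pair hp.2.2
  rw [Finset.sum_const, Finset.card_filter_powersetCard_subset _ _ _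
    (by simp [Finset.insert_subset_iff, hp]) (by rw [hc]; omega), hc]
  simp

/-! ### Dirichlet forms of the walks on the levels -/

namespace WeightedHypergraph

variable {V : Type*} [Fintype V] [DecidableEq V] {k : ℕ}

/-- The inner product of functions on the vertices, weighted by the degrees. -/
noncomputable def ip (H : WeightedHypergraph V k) (f g : V → ℝ) : ℝ :=
  ∑ v, H.deg v * (f v * g v)

/-- The Dirichlet form of the walk through the hyperedges. -/
noncomputable def energy (H : WeightedHypergraph V k) (f g : V → ℝ) : ℝ :=
  H.ip f g - (1 / k) * ∑ e ∈ H.edges, H.prob e * ((∑ v ∈ e, f v) * ∑ v ∈ e, g v)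

theorem sum_deg_mul (H : WeightedHypergraph V k) (f : V → ℝ) :
    ∑ v, H.deg v * f v = ∑ e ∈ H.edges, H.prob e * ∑ v ∈ e, f v := by
  simp only [deg, Finset.sum_mul, Finset.mul_sum]
  apply Finset.sum_comm'
  intro v e
  simp [and_comm]

theorem ip_eq_sum_edges (H : WeightedHypergraph V k) (f g : V → ℝ) :
    H.ip f g = ∑ e ∈ H.edges, H.prob e * ∑ v ∈ e, f v * g v :=
  H.sum_deg_mul _

/-- `Π_l` is the law of a uniform `l`-subset of a random hyperedge; this turns sums over a level
into sums over hyperedges. -/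
theorem sum_level (H : WeightedHypergraph V k) (l : ℕ) (G : Finset V → ℝ) :
    ∑ s : H.Level l, H.levelProb l s.1 * G s.1 =
      (1 / (k.choose l : ℝ)) * ∑ e ∈ H.edges, H.prob e * ∑ s ∈ e.powersetCard l, G s := by
  have h0 : ∑ s : H.Level l, H.levelProb l s.1 * G s.1 =
      ∑ s ∈ Finset.univ.filter (fun s : Finset V => s.card = l ∧ ∃ e ∈ H.edges, s ⊆ e),
        H.levelProb l s * G s := by
    symm
    apply Finset.sum_subtype
    intro s
    simp
  rw [h0]
  simp only [levelProb, mul_assoc, ← Finset.mul_sum]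
  congr 1
  simp only [Finset.sum_mul, Finset.mul_sum]
  apply Finset.sum_comm'
  intro s e
  simp only [Finset.mem_filter, Finset.mem_univ, true_and, Finset.mem_powersetCard]
  constructor
  · rintro ⟨⟨h1, _⟩, h2, h3⟩
    exact ⟨⟨h3, h1⟩, h2⟩
  · rintro ⟨⟨h1, h2⟩, h3⟩
    exact ⟨⟨h2, e, h3, h1⟩, h3, h1⟩

theorem levelProb_pos (H : WeightedHypergraph V k) {l : ℕ} (s : H.Level l) :
    0 < H.levelProb l s.1 := by
  obtain ⟨s, hs, e, he, hse⟩ := s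
  have hl : l ≤ k := by
    rw [← hs, ← H.card_edge e he]
    exact Finset.card_le_card hse
  have h1 : 0 < k.choose l := Nat.choose_pos hl
  unfold levelProb
  have : 0 < ∑ e ∈ H.edges with s ⊆ e, H.prob e := by
    apply Finset.sum_pos
    · intro e he
      exact H.prob_pos e (Finset.mem_filter.1 he).1
    · exact ⟨e, Finset.mem_filter.2 ⟨he, hse⟩⟩
  positivity

/-- The inner product on a level weighted by the induced distribution. -/
noncomputable def levelIp (H : WeightedHypergraph V k) (l : ℕ) (f g : H.Level l → ℝ) : ℝ :=
  ∑ s : H.Level l, H.levelProb l s.1 * (f s * g s)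

/-- Detailed balance: both sides weight an incident pair `s ⊆ t` by `Π_{i+1}(t) / (i+1)`. -/
theorem levelIp_up (H : WeightedHypergraph V k) (i : ℕ) (f : H.Level i → ℝ)
    (g : H.Level (i + 1) → ℝ) :
    H.levelIp (i + 1) (H.up i f) g = H.levelIp i f (H.down i g) := by
  simp only [levelIp, up, down, LinearMap.coe_mk, AddHom.coe_mk, Finset.mul_sum, Finset.sum_mul]
  rw [Finset.sum_comm' (t' := Finset.univ)
    (s' := fun s : H.Level i => Finset.univ.filter fun t : H.Level (i + 1) => s.1 ⊆ t.1)
    (by intro s t; simp)]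
  apply Finset.sum_congr rfl
  intro s _
  apply Finset.sum_congr rfl
  intro t _
  have := (H.levelProb_pos s).ne'
  field_simp

theorem levelIp_upTo (H : WeightedHypergraph V k) (m j : ℕ) (f : H.Level m → ℝ)
    (g : H.Level (m + j) → ℝ) :
    H.levelIp (m + j) (H.upTo m j f) g = H.levelIp m f (H.downTo m j g) := by
  induction j with
  | zero => rfl
  | succ j ih =>
    have h1 := H.levelIp_up (m + j) (H.upTo m j f) g
    rw [ih] at h1
    exact h1

/-- The function on the first level that corresponds to a function on the vertices. -/
def lift (H : WeightedHypergraph V k) (f : V → ℝ) : H.Level 1 → ℝ := fun s => ∑ v ∈ s.1, f v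

theorem exists_lift (H : WeightedHypergraph V k) (F : H.Level 1 → ℝ) : ∃ f, F = H.lift f := by
  classical
  refine ⟨fun v => if h : ({v} : Finset V).card = 1 ∧ ∃ e ∈ H.edges, {v} ⊆ e then F ⟨{v}, h⟩
    else 0, ?_⟩
  funext s
  obtain ⟨s, hs⟩ := s
  obtain ⟨v, rfl⟩ := Finset.card_eq_one.1 hs.1
  simp only [lift, Finset.sum_singleton]
  rw [dif_pos hs]

/-- Every vertex of `s` lies in all but one of its facets, so averaging uniform averages over the
facets gives the uniform average over `s`. -/
theorem upTo_lift (H : WeightedHypergraph V k) (j : ℕ) (f : V → ℝ) (s : H.Level (1 + j)) :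
    H.upTo 1 j (H.lift f) s = (1 / (1 + j : ℝ)) * ∑ v ∈ s.1, f v := by
  induction j with
  | zero => simp [upTo, lift]
  | succ j ih =>
    change (1 / (((1 + j : ℕ) : ℝ) + 1)) * ∑ t : H.Level (1 + j) with t.1 ⊆ s.1,
      H.upTo 1 j (H.lift f) t = _
    have h1 : ∑ t : H.Level (1 + j) with t.1 ⊆ s.1, H.upTo 1 j (H.lift f) t =
        ∑ t ∈ s.1.powersetCard (j + 1), (1 / (1 + j : ℝ)) * ∑ v ∈ t, f v := by
      obtain ⟨s, hs, e, he, hse⟩ := s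
      apply Finset.sum_bij (fun t _ => t.1)
      · intro t ht
        rw [Finset.mem_powersetCard]
        exact ⟨(Finset.mem_filter.1 ht).2, t.2.1.trans (add_comm _ _)⟩
      · intro t _ t' _ h
        exact Subtype.ext h
      · intro t ht
        rw [Finset.mem_powersetCard] at ht
        exact ⟨⟨t, ht.2.trans (add_comm _ _), e, he, ht.1.trans hse⟩, by simpa using ht.1, rfl⟩
      · intro t _
        exact ih t
    rw [h1, ← Finset.mul_sum, sum_powersetCard_sum, s.2.1]
    have h2 : ((1 + (j + 1) - 1).choose j : ℝ) = 1 + j := by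
      rw [show 1 + (j + 1) - 1 = j + 1 by omega, Nat.choose_succ_self_right]
      push_cast
      ring
    rw [h2]
    push_cast
    have : (1 + j : ℝ) ≠ 0 := by positivity
    field_simp
    ring

theorem levelIp_lift (H : WeightedHypergraph V k) (f g : V → ℝ) :
    H.levelIp 1 (H.lift f) (H.lift g) = (1 / k) * H.ip f g := by
  have h1 := H.sum_level 1 (fun s => (∑ v ∈ s, f v) * ∑ v ∈ s, g v)
  rw [Nat.choose_one_right] at h1
  rw [ip_eq_sum_edges]
  refine h1.trans ?_
  congr 1
  apply Finset.sum_congr rfl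
  intro e _
  rw [Finset.powersetCard_one, Finset.sum_map]
  simp

/-- The factor between the Dirichlet forms of the walk through `X(j + 2)` and of the walk
through the hyperedges. -/
theorem levelIp_upTo_lift (H : WeightedHypergraph V k) (j : ℕ) (hj : j + 2 ≤ k) (f g : V → ℝ) :
    H.levelIp 1 (H.lift f) (H.lift g) -
      H.levelIp (1 + (j + 1)) (H.upTo 1 (j + 1) (H.lift f)) (H.upTo 1 (j + 1) (H.lift g)) =
    ((j + 1) / ((j + 2) * (k - 1)) : ℝ) * H.energy f g := by
  have h1 := H.sum_level (1 + (j + 1)) (fun s => ((1 / (1 + (j + 1 : ℕ) : ℝ)) * ∑ v ∈ s, f v) *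
    ((1 / (1 + (j + 1 : ℕ) : ℝ)) * ∑ v ∈ s, g v))
  have h2 : H.levelIp (1 + (j + 1)) (H.upTo 1 (j + 1) (H.lift f))
      (H.upTo 1 (j + 1) (H.lift g)) = ∑ s : H.Level (1 + (j + 1)), H.levelProb (1 + (j + 1)) s.1 *
      (((1 / (1 + (j + 1 : ℕ) : ℝ)) * ∑ v ∈ s.1, f v) *
    ((1 / (1 + (j + 1 : ℕ) : ℝ)) * ∑ v ∈ s.1, g v)) := by
    unfold levelIp
    simp only [upTo_lift]
  rw [h2, h1, levelIp_lift]
  obtain ⟨q, rfl⟩ : ∃ q, k = q + 2 := ⟨k - 2, by omega⟩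
  have h3 : ∀ e ∈ H.edges, H.prob e * ∑ s ∈ e.powersetCard (1 + (j + 1)),
      (((1 / (1 + (j + 1 : ℕ) : ℝ)) * ∑ v ∈ s, f v) *
      ((1 / (1 + (j + 1 : ℕ) : ℝ)) * ∑ v ∈ s, g v)) =
      (1 / (j + 2 : ℝ)) ^ 2 * (((q + 1).choose (j + 1) - q.choose j : ℝ) *
        (H.prob e * ∑ v ∈ e, f v * g v) +
        (q.choose j : ℝ) * (H.prob e * ((∑ v ∈ e, f v) * ∑ v ∈ e, g v))) := by
    intro e he
    have h4 := sum_powersetCard_sum_mul_sum e j f g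
    rw [H.card_edge e he, show q + 2 - 1 = q + 1 by omega, show q + 2 - 2 = q by omega] at h4
    have h5 : ∀ s : Finset V, (((1 / (1 + (j + 1 : ℕ) : ℝ)) * ∑ v ∈ s, f v) *
      ((1 / (1 + (j + 1 : ℕ) : ℝ)) * ∑ v ∈ s, g v)) =
      (1 / (j + 2 : ℝ)) ^ 2 * ((∑ v ∈ s, f v) * ∑ v ∈ s, g v) := by
      intro s
      push_cast
      rw [show (1 + (j + 1) : ℝ) = j + 2 by ring]
      ring
    simp only [h5, ← Finset.mul_sum]
    rw [show 1 + (j + 1) = j + 2 by omega, h4]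
    ring
  rw [Finset.sum_congr rfl h3, ← Finset.mul_sum, Finset.sum_add_distrib, ← Finset.mul_sum,
    ← Finset.mul_sum, ← ip_eq_sum_edges, energy]
  set I := H.ip f g
  set J := ∑ e ∈ H.edges, H.prob e * ((∑ v ∈ e, f v) * ∑ v ∈ e, g v)
  -- With `l = j + 2`, the absorption identities leave only the ratios `C(k-1,l-1)/C(k,l) = l/k` and
  -- `C(k-2,l-2)/C(k,l) = l(l-1)/(k(k-1))`. The coefficients of `I` and `J` then stand in the ratio
  -- `1 : -1/k`, which is why a multiple of `energy` appears for every `l`.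
  have hA : ((q + 1).choose (j + 1) : ℝ) * (j + 1) = (q + 1) * q.choose j := by
    have := Nat.add_one_mul_choose_eq q j
    exact_mod_cast this.symm
  have hB : ((q + 2).choose (1 + (j + 1)) : ℝ) * (j + 2) = (q + 2) * (q + 1).choose (j + 1) := by
    have := Nat.add_one_mul_choose_eq (q + 1) (j + 1)
    rw [show 1 + (j + 1) = j + 1 + 1 by omega]
    have h : ((q + 1 + 1 : ℕ) : ℝ) * (q + 1).choose (j + 1) =
      ((q + 1 + 1).choose (j + 1 + 1) : ℝ) * ((j + 1 + 1 : ℕ) : ℝ) := by exact_mod_cast this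
    push_cast at h
    linear_combination -h
  have hc : (0 : ℝ) < q.choose j := by exact_mod_cast Nat.choose_pos (by omega)
  set C := (q.choose j : ℝ)
  have hA' : ((q + 1).choose (j + 1) : ℝ) = (q + 1) * C / (j + 1) := by
    rw [eq_div_iff (by positivity), hA]
  have hB' : ((q + 2).choose (1 + (j + 1)) : ℝ) = (q + 2) * ((q + 1) * C / (j + 1)) / (j + 2) := by
    rw [eq_div_iff (by positivity), hB, hA']
  rw [hB', hA']
  push_cast
  have h6 : (q + 2 - 1 : ℝ) = q + 1 := by ring
  rw [h6]
  field_simp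
  ring

end WeightedHypergraph

/-! ### Second eigenvalues of a pair of adjoint operators -/

section TwoSpaces

variable {M₁ M₂ : Type*} [AddCommGroup M₁] [Module ℝ M₁] [Module.Finite ℝ M₁] [Module.Free ℝ M₁]
  [AddCommGroup M₂] [Module ℝ M₂] [Module.Finite ℝ M₂] [Module.Free ℝ M₂]

theorem core_inner_comm {M : Type*} [AddCommGroup M] [Module ℝ M]
    (c : InnerProductSpace.Core ℝ M) (x y : M) : c.inner x y = c.inner y x := by
  simpa using c.conj_inner_symm y x

theorem core_inner_nonneg {M : Type*} [AddCommGroup M] [Module ℝ M]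
    (c : InnerProductSpace.Core ℝ M) (x : M) : 0 ≤ c.inner x x := by
  simpa using c.re_inner_nonneg x

theorem core_smul_left {M : Type*} [AddCommGroup M] [Module ℝ M]
    (c : InnerProductSpace.Core ℝ M) (r : ℝ) (x y : M) :
    c.inner (r • x) y = r * c.inner x y := by
  simpa using c.smul_left x y r

theorem core_smul_right {M : Type*} [AddCommGroup M] [Module ℝ M]
    (c : InnerProductSpace.Core ℝ M) (r : ℝ) (x y : M) :
    c.inner x (r • y) = r * c.inner x y := by
  rw [core_inner_comm, core_smul_left, core_inner_comm]

theorem core_zero_left {M : Type*} [AddCommGroup M] [Module ℝ M]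
    (c : InnerProductSpace.Core ℝ M) (y : M) : c.inner 0 y = 0 := by
  simpa using core_smul_left c 0 0 y

/-- The orthogonal sum of two inner products. -/
@[reducible] noncomputable def prodCore (c₁ : InnerProductSpace.Core ℝ M₁) (c₂ : InnerProductSpace.Core ℝ M₂) :
    InnerProductSpace.Core ℝ (M₁ × M₂) where
  inner x y := c₁.inner x.1 y.1 + c₂.inner x.2 y.2
  conj_inner_symm x y := by
    simp [core_inner_comm c₁ y.1, core_inner_comm c₂ y.2]
  re_inner_nonneg x := by
    simpa using add_nonneg (core_inner_nonneg c₁ x.1) (core_inner_nonneg c₂ x.2)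
  add_left x y z := by
    simp only [Prod.fst_add, Prod.snd_add, c₁.add_left, c₂.add_left]
    ring
  smul_left x y r := by
    simp only [Prod.smul_fst, Prod.smul_snd, core_smul_left, conj_trivial]
    ring
  definite x h := by
    have h1 := core_inner_nonneg c₁ x.1
    have h2 := core_inner_nonneg c₂ x.2
    change c₁.inner x.1 x.1 + c₂.inner x.2 x.2 = 0 at h
    exact Prod.ext (c₁.definite _ (by linarith)) (c₂.definite _ (by linarith))

theorem exists_ne_zero_inner_eq_zero (c : InnerProductSpace.Core ℝ M₁) (u : M₁) (hu : u ≠ 0)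
    (hdim : 2 ≤ Module.finrank ℝ M₁) : ∃ x, x ≠ 0 ∧ c.inner x u = 0 := by
  by_contra! h
  have hu' : c.inner u u ≠ 0 := fun h0 => hu (c.definite u h0)
  have : Module.finrank ℝ M₁ ≤ 1 := by
    apply finrank_le_one u
    intro w
    refine ⟨c.inner w u / c.inner u u, ?_⟩
    by_contra hne
    refine h (w + (-(c.inner w u / c.inner u u)) • u) ?_ ?_
    · rw [neg_smul, ← sub_eq_add_neg]
      exact sub_ne_zero.2 (Ne.symm hne)
    · rw [c.add_left, core_smul_left]
      field_simp
      ring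
  omega

/-- The second eigenvalues of `D U` and of the bipartite walk of a pair of adjoint operators. -/
theorem second_eigenvalue_adjoint_pair (c₁ : InnerProductSpace.Core ℝ M₁)
    (c₂ : InnerProductSpace.Core ℝ M₂) (U : M₁ →ₗ[ℝ] M₂) (D : M₂ →ₗ[ℝ] M₁)
    (hadj : ∀ x y, c₂.inner (U x) y = c₁.inner x (D y)) (u₁ : M₁) (u₂ : M₂) (hu : u₁ ≠ 0)
    (hU : U u₁ = u₂) (hD : D u₂ = u₁) (hdim : 2 ≤ Module.finrank ℝ M₁) (ε : ℝ) (hε : 0 < ε)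
    (h : secondEigenvalue (D.comp U) = 1 - ε ∨
      secondEigenvalue ((D.comp (LinearMap.snd ℝ M₁ M₂)).prod
        (U.comp (LinearMap.fst ℝ M₁ M₂))) = 1 - ε) :
    (∀ x, c₁.inner x u₁ = 0 → c₂.inner (U x) (U x) ≤ (1 - ε) * c₁.inner x x) ∧
      (1 ≤ ε ∨ ∃ x θ, x ≠ 0 ∧ c₁.inner x u₁ = 0 ∧ θ ≤ 2 * ε ∧ D (U x) = (1 - θ) • x) := by
  have hadj' : ∀ x y, c₁.inner (D y) x = c₂.inner y (U x) := by
    intro x y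
    rw [core_inner_comm, ← hadj, core_inner_comm]
  rcases h with h | h
  · obtain ⟨ha, x, hx0, hxu, hx⟩ := secondEigenvalue_of_core c₁ (D.comp U)
      (fun x y => by
        change c₁.inner (D (U x)) y = c₁.inner x (D (U y))
        rw [hadj', ← hadj]) u₁ hu
      (by rw [LinearMap.comp_apply, hU, hD]) hdim (by rw [h]; linarith)
    rw [h] at ha hx
    refine ⟨fun x hx => ?_, Or.inr ⟨x, ε, hx0, hxu, by linarith, hx⟩⟩
    rw [hadj, core_inner_comm]
    exact ha x hx
  · have hu2 : ((u₁, u₂) : M₁ × M₂) ≠ 0 := fun h0 => hu (congrArg Prod.fst h0)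
    obtain ⟨ha, ⟨x, y⟩, hxy0, hxyu, hxy⟩ := secondEigenvalue_of_core (prodCore c₁ c₂)
      ((D.comp (LinearMap.snd ℝ M₁ M₂)).prod (U.comp (LinearMap.fst ℝ M₁ M₂)))
      (fun x y => by
        change c₁.inner (D x.2) y.1 + c₂.inner (U x.1) y.2 =
          c₁.inner x.1 (D y.2) + c₂.inner x.2 (U y.1)
        rw [hadj', ← hadj, add_comm]) (u₁, u₂) hu2
      (by
        change (D u₂, U u₁) = _
        rw [hU, hD]) (by
        rw [Module.finrank_prod]
        omega) (by rw [h]; linarith)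
    rw [h] at ha hxy
    have ha' : ∀ x y, c₁.inner x u₁ + c₂.inner y u₂ = 0 →
        c₁.inner (D y) x + c₂.inner (U x) y ≤ (1 - ε) * (c₁.inner x x + c₂.inner y y) :=
      fun x y hxy => ha (x, y) hxy
    have hxyu' : c₁.inner x u₁ + c₂.inner y u₂ = 0 := hxyu
    have hx : D y = (1 - ε) • x := congrArg Prod.fst hxy
    have hy : U x = (1 - ε) • y := congrArg Prod.snd hxy
    -- The quadratic form of the bipartite walk vanishes on vectors `(z, 0)`, and some of these are
    -- orthogonal to the fixed vector. So its second eigenvalue cannot be negative.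
    have hle1 : ε ≤ 1 := by
      obtain ⟨z, hz0, hzu⟩ := exists_ne_zero_inner_eq_zero c₁ u₁ hu hdim
      have h1 := ha' z 0 (by rw [hzu, core_zero_left, add_zero])
      rw [map_zero, core_zero_left, core_zero_left, core_inner_comm c₂, core_zero_left] at h1
      have h2 : 0 < c₁.inner z z :=
        lt_of_le_of_ne (core_inner_nonneg c₁ z) fun h0 => hz0 (c₁.definite z h0.symm)
      by_contra! hlt
      nlinarith
    constructor
    · intro z hz
      have hUz : c₂.inner (U z) u₂ = 0 := by rw [hadj, hD, hz]
      -- Test vectors `(z, s U z)`. The optimal choice `s = 1/(1-ε)` yields `|Uz|² ≤ (1-ε)² |z|²`,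
      -- which is more than needed; for `ε = 1` any positive `s` forces `Uz = 0`.
      have hs : ∀ s : ℝ, 2 * s * c₂.inner (U z) (U z) ≤
          (1 - ε) * (c₁.inner z z + s ^ 2 * c₂.inner (U z) (U z)) := by
        intro s
        have h1 := ha' z (s • U z) (by rw [hz, core_smul_left, hUz, mul_zero, add_zero])
        rw [hadj', core_smul_left, core_smul_right, core_smul_left, core_smul_right] at h1
        nlinarith
      have h0 := core_inner_nonneg c₁ z
      have h0' := core_inner_nonneg c₂ (U z)
      rcases hle1.eq_or_lt with rfl | hlt
      · have := hs 1
        nlinarith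
      · have h1 := hs (1 / (1 - ε))
        have h2 : 0 < 1 - ε := by linarith
        have h3 : 2 * (1 / (1 - ε)) * c₂.inner (U z) (U z) =
            (1 / (1 - ε)) * (2 * c₂.inner (U z) (U z)) := by ring
        have h4 : (1 - ε) * (c₁.inner z z + (1 / (1 - ε)) ^ 2 * c₂.inner (U z) (U z)) =
            (1 / (1 - ε)) * ((1 - ε) ^ 2 * c₁.inner z z + c₂.inner (U z) (U z)) := by
          field_simp
        rw [h3, h4] at h1
        have h5 := le_of_mul_le_mul_left h1 (by positivity)
        have h6 : (1 - ε) ^ 2 * c₁.inner z z ≤ (1 - ε) * c₁.inner z z := by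
          apply mul_le_mul_of_nonneg_right _ h0
          nlinarith
        linarith
    -- For `ε = 1` the eigenvector may have first component zero and then says nothing about `D U`;
    -- the alternative `1 ≤ ε` is kept instead, where the expansion bound is trivial.
    · rcases hle1.eq_or_lt with rfl | hlt
      · exact Or.inl le_rfl
      · right
        have h2 : 0 < 1 - ε := by linarith
        -- The first component is an eigenvector of `D U` for `(1-ε)²`, and `1 - (1-ε)² ≤ 2ε`.
        refine ⟨x, 1 - (1 - ε) ^ 2, ?_, ?_, by nlinarith, ?_⟩
        · rintro rfl
          rw [map_zero] at hy
          have : y = 0 := (smul_eq_zero.1 hy.symm).resolve_left h2.ne'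
          exact hxy0 (by rw [this]; rfl)
        · have h3 : (1 - ε) * c₁.inner x u₁ = c₂.inner y u₂ := by
            rw [← core_smul_left, ← hx, hadj', hU]
          have h4 : (2 - ε) * c₁.inner x u₁ = 0 := by linarith
          exact (mul_eq_zero.1 h4).resolve_left (by linarith)
        · rw [hy, map_smul, hx, smul_smul]
          congr 1
          ring

end TwoSpaces

/-! ### From the eigenvalue hypothesis to the walk through the hyperedges -/

namespace WeightedHypergraph

variable {V : Type*} [Fintype V] [DecidableEq V] {k : ℕ}

/-- The weighted inner product on a level, bundled. -/
@[reducible] noncomputable def levelCore (H : WeightedHypergraph V k) (l : ℕ) :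
    InnerProductSpace.Core ℝ (H.Level l → ℝ) where
  inner f g := H.levelIp l f g
  conj_inner_symm f g := by
    simp only [levelIp, conj_trivial]
    exact Finset.sum_congr rfl fun s _ => by ring
  re_inner_nonneg f := by
    simp only [levelIp, RCLike.re_to_real]
    exact Finset.sum_nonneg fun s _ => mul_nonneg (H.levelProb_pos s).le (mul_self_nonneg _)
  add_left f g h := by
    simp only [levelIp, Pi.add_apply, ← Finset.sum_add_distrib]
    exact Finset.sum_congr rfl fun s _ => by ring
  smul_left f g r := by
    simp only [levelIp, Pi.smul_apply, smul_eq_mul, conj_trivial, Finset.mul_sum]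
    exact Finset.sum_congr rfl fun s _ => by ring
  definite f hf := by
    funext s
    have h1 := (Finset.sum_eq_zero_iff_of_nonneg (fun s _ =>
      mul_nonneg (H.levelProb_pos s).le (mul_self_nonneg (f s)))).1 hf s (Finset.mem_univ s)
    simpa [(H.levelProb_pos s).ne'] using h1

theorem edges_nonempty (H : WeightedHypergraph V k) : H.edges.Nonempty := by
  by_contra h
  have := H.sum_prob
  rw [Finset.not_nonempty_iff_eq_empty.1 h] at this
  simp at this

theorem deg_nonneg (H : WeightedHypergraph V k) (v : V) : 0 ≤ H.deg v :=
  Finset.sum_nonneg fun e he => (H.prob_pos e (Finset.mem_filter.1 he).1).le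

theorem ip_self_nonneg (H : WeightedHypergraph V k) (f : V → ℝ) : 0 ≤ H.ip f f :=
  Finset.sum_nonneg fun v _ => mul_nonneg (H.deg_nonneg v) (mul_self_nonneg _)

/-- Cauchy–Schwarz on each hyperedge, which has `k` vertices. -/
theorem energy_self_nonneg (H : WeightedHypergraph V k) (f : V → ℝ) : 0 ≤ H.energy f f := by
  unfold energy
  rw [ip_eq_sum_edges, Finset.mul_sum, ← Finset.sum_sub_distrib]
  apply Finset.sum_nonneg
  intro e he
  have h1 : (∑ v ∈ e, f v) ^ 2 ≤ k * ∑ v ∈ e, f v ^ 2 := by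
    have := sq_sum_le_card_mul_sum_sq (s := e) (f := f)
    rwa [H.card_edge e he] at this
  have h2 := H.prob_pos e he
  rcases Nat.eq_zero_or_pos k with rfl | hk
  · simp only [Nat.cast_zero, div_zero, zero_mul, sub_zero]
    exact mul_nonneg h2.le (Finset.sum_nonneg fun v _ => mul_self_nonneg _)
  · have hk' : (0 : ℝ) < k := by exact_mod_cast hk
    have h3 : (1 / (k : ℝ)) * (∑ v ∈ e, f v) ^ 2 ≤ ∑ v ∈ e, f v ^ 2 := by
      rw [one_div, inv_mul_le_iff₀ hk']
      exact h1
    have h4 : H.prob e * ∑ v ∈ e, f v * f v -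
        1 / k * (H.prob e * ((∑ v ∈ e, f v) * ∑ v ∈ e, f v)) =
        H.prob e * (∑ v ∈ e, f v ^ 2 - (1 / (k : ℝ)) * (∑ v ∈ e, f v) ^ 2) := by
      simp only [← sq]
      ring
    rw [h4]
    exact mul_nonneg h2.le (by linarith)

theorem card_level_one (H : WeightedHypergraph V k) : k ≤ Fintype.card (H.Level 1) := by
  obtain ⟨e, he⟩ := H.edges_nonempty
  refine ((H.card_edge e he).symm.le.trans (Fintype.card_coe e).symm.le).trans ?_
  apply Fintype.card_le_of_injective
    (fun v : e => (⟨{v.1}, Finset.card_singleton _, e, he, by simp⟩ : H.Level 1))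
  intro v w h
  have h1 : ({v.1} : Finset V) = {w.1} := congrArg Subtype.val h
  exact Subtype.ext (Finset.singleton_injective h1)

theorem lift_one (H : WeightedHypergraph V k) : H.lift (fun _ => 1) = fun _ => 1 := by
  funext s
  simp [lift, s.2.1]

theorem upTo_one (H : WeightedHypergraph V k) (j : ℕ) :
    H.upTo 1 j (H.lift fun _ => 1) = fun _ => 1 := by
  funext s
  rw [upTo_lift]
  simp only [Finset.sum_const, s.2.1, nsmul_eq_mul]
  push_cast
  have : (1 + j : ℝ) ≠ 0 := by positivity
  field_simp

theorem energy_one (H : WeightedHypergraph V k) (hk : 0 < k) (f : V → ℝ) :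
    H.energy f (fun _ => 1) = 0 := by
  unfold energy
  rw [ip_eq_sum_edges, Finset.mul_sum, ← Finset.sum_sub_distrib]
  apply Finset.sum_eq_zero
  intro e he
  have hk' : (k : ℝ) ≠ 0 := by exact_mod_cast hk.ne'
  simp only [mul_one, Finset.sum_const, H.card_edge e he, nsmul_eq_mul]
  field_simp
  ring

/-- Constants have zero energy against everything and are preserved by the up operators. By
adjointness the two sides therefore have the same inner product with every function on the first
level, so no marginal of `Π_l` has to be computed. -/
theorem downTo_one (H : WeightedHypergraph V k) (j : ℕ) (hj : j + 2 ≤ k) :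
    H.downTo 1 (j + 1) (fun _ => 1) = H.lift fun _ => 1 := by
  have h1 : ∀ f : V → ℝ, H.levelIp 1 (H.lift f) (H.downTo 1 (j + 1) (fun _ => 1)) =
      H.levelIp 1 (H.lift f) (H.lift fun _ => 1) := by
    intro f
    have h2 := H.levelIp_upTo_lift j hj f (fun _ => 1)
    rw [H.energy_one (by omega), mul_zero, upTo_one, levelIp_upTo] at h2
    linarith
  obtain ⟨g, hg⟩ := H.exists_lift (H.downTo 1 (j + 1) (fun _ => 1) - H.lift fun _ => 1)
  have h3 := h1 g
  rw [← hg] at h3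
  rw [← sub_eq_zero]
  apply (H.levelCore 1).definite
  set a := H.downTo 1 (j + 1) (fun _ => 1)
  set b := H.lift fun _ => 1
  change H.levelIp 1 (a - b) (a - b) = 0
  have h4 : H.levelIp 1 (a - b) (a - b) = H.levelIp 1 (a - b) a - H.levelIp 1 (a - b) b := by
    simp only [levelIp, Pi.sub_apply, ← Finset.sum_sub_distrib]
    exact Finset.sum_congr rfl fun s _ => by ring
  rw [h4, h3, sub_self]

theorem ip_one (H : WeightedHypergraph V k) (f : V → ℝ) :
    H.ip f (fun _ => 1) = ∑ v, H.deg v * f v := by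
  simp [ip]

/-- The consequences of the eigenvalue hypothesis for the Dirichlet form of the walk through
the hyperedges. -/
theorem energy_of_secondEigenvalue (H : WeightedHypergraph V k) (l : ℕ) (ε : ℝ) (hl : 2 ≤ l)
    (hlk : l ≤ k) (hε : 0 < ε)
    (h : secondEigenvalue (H.upDownWalk 1 (l - 1)) = 1 - ε ∨
        secondEigenvalue (H.bipartiteWalk 1 (l - 1)) = 1 - ε) :
    (∀ f, ∑ v, H.deg v * f v = 0 → ε * H.ip f f ≤ H.energy f f) ∧
    (1 ≤ ε ∨ ∃ ψ γ, 0 < H.ip ψ ψ ∧ ∑ v, H.deg v * ψ v = 0 ∧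
      (∀ g, H.energy ψ g = γ * H.ip ψ g) ∧ k * γ ≤ 4 * ε * (k - 1)) := by
  obtain ⟨j, rfl⟩ : ∃ j, l = j + 2 := ⟨l - 2, by omega⟩
  rw [show j + 2 - 1 = j + 1 by omega] at h
  have hk' : (0 : ℝ) < k := by exact_mod_cast (by omega : 0 < k)
  have hk1 : (0 : ℝ) < k - 1 := by
    have : (2 : ℝ) ≤ k := by exact_mod_cast hl.trans hlk
    linarith
  have hu : H.lift (fun _ => 1) ≠ 0 := by
    rw [lift_one]
    intro h0
    obtain ⟨s⟩ : Nonempty (H.Level 1) := by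
      rw [← Fintype.card_pos_iff]
      have := H.card_level_one
      omega
    simpa using congrFun h0 s
  obtain ⟨ha, hb⟩ := second_eigenvalue_adjoint_pair (H.levelCore 1) (H.levelCore (1 + (j + 1)))
    (H.upTo 1 (j + 1)) (H.downTo 1 (j + 1)) (H.levelIp_upTo 1 (j + 1))
    (H.lift fun _ => 1) (fun _ => 1) hu (H.upTo_one _) (H.downTo_one j hlk)
    (by
      rw [Module.finrank_fintype_fun_eq_card]
      have := H.card_level_one
      omega) ε hε h
  -- This is `k(l-1) ≤ l(k-1)`, from `l ≤ k`: the gap of the walk through the hyperedges is at least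
  -- that of the walk through `X(l)`, so the lower bound loses no constant here.
  have hcoef : (k : ℝ) * ((j + 1) / ((j + 2) * (k - 1))) ≤ 1 := by
    rw [← mul_div_assoc, div_le_one (by positivity)]
    have : (j : ℝ) + 2 ≤ k := by exact_mod_cast hlk
    nlinarith
  constructor
  · intro f hf
    have h1 : H.levelIp (1 + (j + 1)) (H.upTo 1 (j + 1) (H.lift f)) (H.upTo 1 (j + 1) (H.lift f))
        ≤ (1 - ε) * H.levelIp 1 (H.lift f) (H.lift f) := by
      apply ha (H.lift f)
      change H.levelIp 1 (H.lift f) (H.lift fun _ => 1) = 0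
      rw [levelIp_lift, ip_one, hf, mul_zero]
    have h2 := H.levelIp_upTo_lift j hlk f f
    have h3 : ε * H.levelIp 1 (H.lift f) (H.lift f) ≤
        ((j + 1) / ((j + 2) * (k - 1)) : ℝ) * H.energy f f := by linarith
    rw [levelIp_lift] at h3
    have h4 := H.energy_self_nonneg f
    calc ε * H.ip f f = k * (ε * (1 / k * H.ip f f)) := by field_simp
      _ ≤ k * (((j + 1) / ((j + 2) * (k - 1)) : ℝ) * H.energy f f) := by gcongr
      _ = (k * ((j + 1) / ((j + 2) * (k - 1)))) * H.energy f f := by ring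
      _ ≤ 1 * H.energy f f := by gcongr
      _ = _ := one_mul _
  · refine hb.imp_right ?_
    rintro ⟨x, θ, hx0, hxu, hθ, hx⟩
    obtain ⟨ψ, rfl⟩ := H.exists_lift x
    change H.levelIp 1 (H.lift ψ) (H.lift fun _ => 1) = 0 at hxu
    rw [levelIp_lift, ip_one] at hxu
    have hpos : 0 < H.levelIp 1 (H.lift ψ) (H.lift ψ) :=
      lt_of_le_of_ne (core_inner_nonneg (H.levelCore 1) _)
        fun h0 => hx0 ((H.levelCore 1).definite _ h0.symm)
    rw [levelIp_lift] at hpos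
    -- `γ` is `θ` divided by the factor between the two operators `1 - N^{(2)}` and `1 - W`; thus
    -- `kγ/(k-1) = θ·l/(l-1) ≤ 2θ ≤ 4ε`.
    refine ⟨ψ, θ * ((j + 2) * (k - 1)) / ((j + 1) * k), ?_, ?_, ?_, ?_⟩
    · exact (mul_pos_iff_of_pos_left (by positivity)).1 hpos
    · exact (mul_eq_zero.1 hxu).resolve_left (by positivity)
    · intro g
      have h2 := H.levelIp_upTo_lift j hlk ψ g
      have h3 : H.levelIp (1 + (j + 1)) (H.upTo 1 (j + 1) (H.lift ψ))
          (H.upTo 1 (j + 1) (H.lift g)) = (1 - θ) * H.levelIp 1 (H.lift ψ) (H.lift g) := by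
        have h4 := core_inner_comm (H.levelCore (1 + (j + 1))) (H.upTo 1 (j + 1) (H.lift ψ))
          (H.upTo 1 (j + 1) (H.lift g))
        have h5 := core_inner_comm (H.levelCore 1) (H.lift g) ((1 - θ) • H.lift ψ)
        rw [core_smul_left] at h5
        change H.levelIp _ _ _ = H.levelIp _ _ _ at h4
        change H.levelIp _ _ _ = (1 - θ) * H.levelIp _ _ _ at h5
        rw [h4, levelIp_upTo, hx, h5]
      rw [h3, levelIp_lift] at h2
      have h6 : θ * (1 / k * H.ip ψ g) = ((j + 1) / ((j + 2) * (k - 1)) : ℝ) * H.energy ψ g := by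
        linarith
      have hne : (k - 1 : ℝ) ≠ 0 := hk1.ne'
      field_simp at h6 ⊢
      linarith
    · have h1 : (k : ℝ) * (θ * ((j + 2) * (k - 1)) / ((j + 1) * k)) =
          θ * ((j + 2) / (j + 1)) * (k - 1) := by
        field_simp
      rw [h1]
      apply mul_le_mul_of_nonneg_right _ hk1.le
      have h2 : ((j : ℝ) + 2) / (j + 1) ≤ 2 := by
        rw [div_le_iff₀ (by positivity)]
        have : (0 : ℝ) ≤ j := by positivity
        linarith
      have h3 : 0 ≤ ((j : ℝ) + 2) / (j + 1) := by positivity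
      nlinarith

end WeightedHypergraph

/-! ### Co-area and Cheeger inequalities for non-negative functions -/

/-- Induction on non-negative functions by subtracting the least positive value on the support. -/
theorem peel_induction {V : Type*} [Fintype V] {p : ℕ → (V → ℝ) → Prop}
    (zero : ∀ N, p N 0)
    (step : ∀ N h c, (∀ u, 0 ≤ h u) → 0 < c → (∀ u, 0 < h u → c ≤ h u) →
      p N (fun u => h u - if 0 < h u then c else 0) → p (N + 1) h) (N : ℕ) (h : V → ℝ)
    (h0 : ∀ u, 0 ≤ h u) (hN : (Finset.univ.filter fun u => 0 < h u).card ≤ N) : p N h := by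
  induction N generalizing h with
  | zero =>
    have : h = 0 := by
      funext u
      have h1 := Finset.card_eq_zero.1 (Nat.le_zero.1 hN)
      have h2 : u ∉ Finset.univ.filter fun u => 0 < h u := by simp [h1]
      simp only [Finset.mem_filter, Finset.mem_univ, true_and, not_lt] at h2
      exact le_antisymm h2 (h0 u)
    rw [this]
    exact zero 0
  | succ N ih =>
    rcases (Finset.univ.filter fun u => 0 < h u).eq_empty_or_nonempty with he | hne
    · have : h = 0 := by
        funext u
        have h2 : u ∉ Finset.univ.filter fun u => 0 < h u := by simp [he]
        simp only [Finset.mem_filter, Finset.mem_univ, true_and, not_lt] at h2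
        exact le_antisymm h2 (h0 u)
      rw [this]
      exact zero _
    · obtain ⟨w, hw, hmin⟩ := Finset.exists_min_image _ h hne
      simp only [Finset.mem_filter, Finset.mem_univ, true_and] at hw hmin
      refine step N h (h w) h0 hw hmin (ih _ ?_ ?_)
      · intro u
        split_ifs with hu
        · exact sub_nonneg.2 (hmin u hu)
        · simpa using h0 u
      · rw [← Nat.lt_add_one_iff]
        refine lt_of_lt_of_le (Finset.card_lt_card ?_) hN
        rw [Finset.ssubset_iff_of_subset]
        · exact ⟨w, by simpa using hw, by simp [hw]⟩
        · intro u hu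
          simp only [Finset.mem_filter, Finset.mem_univ, true_and] at hu ⊢
          by_contra hu'
          rw [if_neg hu', sub_zero] at hu
          exact hu' hu

namespace WeightedHypergraph

variable {V : Type*} [Fintype V] [DecidableEq V] {k : ℕ}

/-- The probability of the boundary of a vertex set. -/
noncomputable def cut (H : WeightedHypergraph V k) (S : Finset V) : ℝ :=
  ∑ e ∈ H.boundary S, H.prob e

/-- The sum of a function of two vertices over the pairs of vertices in a random hyperedge. -/
noncomputable def pairSum (H : WeightedHypergraph V k) (F : V → V → ℝ) : ℝ :=
  ∑ e ∈ H.edges, H.prob e * ∑ u ∈ e, ∑ v ∈ e, F u v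

theorem pairSum_mono (H : WeightedHypergraph V k) {F G : V → V → ℝ} (h : ∀ u v, F u v ≤ G u v) :
    H.pairSum F ≤ H.pairSum G := by
  apply Finset.sum_le_sum
  intro e he
  apply mul_le_mul_of_nonneg_left _ (H.prob_pos e he).le
  exact Finset.sum_le_sum fun u _ => Finset.sum_le_sum fun v _ => h u v

theorem pairSum_add (H : WeightedHypergraph V k) (F G : V → V → ℝ) :
    H.pairSum (fun u v => F u v + G u v) = H.pairSum F + H.pairSum G := by
  simp only [pairSum, Finset.sum_add_distrib, mul_add]

theorem pairSum_const_mul (H : WeightedHypergraph V k) (c : ℝ) (F : V → V → ℝ) :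
    H.pairSum (fun u v => c * F u v) = c * H.pairSum F := by
  rw [pairSum, pairSum, Finset.mul_sum]
  refine Finset.sum_congr rfl fun e _ => ?_
  simp only [← Finset.mul_sum]
  ring

theorem pairSum_nonneg (H : WeightedHypergraph V k) {F : V → V → ℝ} (h : ∀ u v, 0 ≤ F u v) :
    0 ≤ H.pairSum F := by
  apply Finset.sum_nonneg
  intro e he
  exact mul_nonneg (H.prob_pos e he).le
    (Finset.sum_nonneg fun u _ => Finset.sum_nonneg fun v _ => h u v)

theorem pairSum_sq_sub (H : WeightedHypergraph V k) (hk : 0 < k) (f : V → ℝ) :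
    H.pairSum (fun u v => (f u - f v) ^ 2) = 2 * k * H.energy f f := by
  have hk' : (k : ℝ) ≠ 0 := by exact_mod_cast hk.ne'
  unfold energy pairSum
  rw [ip_eq_sum_edges, Finset.mul_sum (s := H.edges) (a := 1 / (k : ℝ)),
    ← Finset.sum_sub_distrib, Finset.mul_sum]
  apply Finset.sum_congr rfl
  intro e he
  have h1 : ∑ u ∈ e, ∑ v ∈ e, (f u - f v) ^ 2 =
      2 * k * ∑ v ∈ e, f v * f v - 2 * ((∑ v ∈ e, f v) * ∑ v ∈ e, f v) := by
    have h2 : ∀ u v, (f u - f v) ^ 2 = f u * f u + f v * f v - 2 * (f u * f v) := by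
      intros
      ring
    simp only [h2, Finset.sum_sub_distrib, Finset.sum_add_distrib, Finset.sum_const,
      H.card_edge e he, nsmul_eq_mul, ← Finset.mul_sum, ← Finset.sum_mul]
    ring
  rw [h1]
  field_simp

theorem cut_nonneg (H : WeightedHypergraph V k) (S : Finset V) : 0 ≤ H.cut S :=
  Finset.sum_nonneg fun e he => (H.prob_pos e (Finset.mem_filter.1 he).1).le

theorem vol_nonneg (H : WeightedHypergraph V k) (S : Finset V) : 0 ≤ H.vol S :=
  Finset.sum_nonneg fun v _ => H.deg_nonneg v

theorem vol_mono (H : WeightedHypergraph V k) {S T : Finset V} (h : S ⊆ T) : H.vol S ≤ H.vol T :=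
  Finset.sum_le_sum_of_subset_of_nonneg h fun v _ _ => H.deg_nonneg v

/-- A crossing hyperedge has `a, b ≥ 1` vertices on the two sides with `a + b = k`, hence `2ab ≥
2(k-1)` separated ordered pairs. -/
theorem cut_le_pairSum (H : WeightedHypergraph V k) (S : Finset V) :
    2 * (k - 1) * H.cut S ≤
      H.pairSum (fun u v => |(if u ∈ S then 1 else 0) - (if v ∈ S then 1 else 0)|) := by
  unfold cut boundary pairSum
  rw [Finset.sum_filter, Finset.mul_sum]
  apply Finset.sum_le_sum
  intro e he
  have hp := (H.prob_pos e he).le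
  split_ifs with hb
  · rw [mul_comm]
    apply mul_le_mul_of_nonneg_left _ hp
    have h1 : ∀ u v : V, |((if u ∈ S then 1 else 0) - (if v ∈ S then 1 else 0) : ℝ)| =
        (if u ∈ S then 1 else 0) * (if v ∈ S then 0 else 1) +
        (if u ∈ S then 0 else 1) * (if v ∈ S then 1 else 0) := by
      intro u v
      split_ifs <;> norm_num
    have ha : ∑ u ∈ e, (if u ∈ S then (1 : ℝ) else 0) = (e ∩ S).card := by
      rw [Finset.sum_ite_mem]
      simp
    have hb' : ∑ u ∈ e, (if u ∈ S then (0 : ℝ) else 1) = (e \ S).card := by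
      have : ∀ u, (if u ∈ S then (0 : ℝ) else 1) = if u ∉ S then 1 else 0 := by
        intro u
        split_ifs <;> simp_all
      simp only [this]
      rw [← Finset.sum_filter, Finset.sdiff_eq_filter]
      simp
    simp only [h1, Finset.sum_add_distrib, ← Finset.mul_sum, ← Finset.sum_mul, ha, hb']
    have hc : ((e ∩ S).card : ℝ) + (e \ S).card = k := by
      rw [← H.card_edge e he]
      exact_mod_cast Finset.card_inter_add_card_sdiff e S
    have h3 : (1 : ℝ) ≤ (e ∩ S).card := by exact_mod_cast hb.1.card_pos
    have h4 : (1 : ℝ) ≤ (e \ S).card := by exact_mod_cast hb.2.card_pos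
    nlinarith
  · rw [mul_zero]
    exact mul_nonneg hp (Finset.sum_nonneg fun u _ => Finset.sum_nonneg fun v _ => abs_nonneg _)

/-- The co-area inequality. -/
theorem coarea (H : WeightedHypergraph V k) (hk : 2 ≤ k) (φ : ℝ) (h : V → ℝ)
    (h0 : ∀ u, 0 ≤ h u)
    (hφ : ∀ t > 0, φ * H.vol (Finset.univ.filter fun u => t ≤ h u) ≤
      H.cut (Finset.univ.filter fun u => t ≤ h u)) :
    2 * (k - 1) * φ * ∑ v, H.deg v * h v ≤ H.pairSum (fun u v => |h u - h v|) := by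
  have hk1 : (0 : ℝ) ≤ k - 1 := by
    have : (2 : ℝ) ≤ k := by exact_mod_cast hk
    linarith
  refine peel_induction (p := fun _ h =>
    (∀ t > 0, φ * H.vol (Finset.univ.filter fun u => t ≤ h u) ≤
      H.cut (Finset.univ.filter fun u => t ≤ h u)) →
    2 * (k - 1) * φ * ∑ v, H.deg v * h v ≤ H.pairSum (fun u v => |h u - h v|)) ?_ ?_ _ h h0 le_rfl hφ
  · intro N _
    simp [pairSum]
  · intro N h c h0 hc hmin ih hφ
    set S := Finset.univ.filter fun u => 0 < h u with hS
    -- The support is itself a threshold set, at the least positive value `c`, so the expansion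
    -- hypothesis applies to it.
    have hS' : (Finset.univ.filter fun u => c ≤ h u) = S := by
      ext u
      simp only [hS, Finset.mem_filter, Finset.mem_univ, true_and]
      exact ⟨fun h => hc.trans_le h, hmin u⟩
    have h1 := ih (by
      intro t ht
      have h2 : (Finset.univ.filter fun u => t ≤ h u - if 0 < h u then c else 0) =
          Finset.univ.filter fun u => t + c ≤ h u := by
        ext u
        simp only [Finset.mem_filter, Finset.mem_univ, true_and]
        split_ifs with hu
        · rw [le_sub_iff_add_le]
        · constructor <;> intro h3 <;> linarith
      rw [h2]
      exact hφ _ (by linarith))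
    have h2 := hφ c hc
    rw [hS'] at h2
    have h3 := H.cut_le_pairSum S
    have h4 : ∑ v, H.deg v * h v = ∑ v, H.deg v * (h v - if 0 < h v then c else 0) +
        c * H.vol S := by
      rw [vol, hS, Finset.sum_filter, Finset.mul_sum, ← Finset.sum_add_distrib]
      refine Finset.sum_congr rfl fun v _ => ?_
      split_ifs <;> ring
    -- The pair sum splits exactly: values on the support are at least `c` and those off it are
    -- zero, so peeling shortens each difference across `S` by `c` and changes no other.
    have h5 : H.pairSum (fun u v => |h u - h v|) =
        H.pairSum (fun u v => |(h u - if 0 < h u then c else 0) -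
          (h v - if 0 < h v then c else 0)|) +
        c * H.pairSum (fun u v => |(if u ∈ S then 1 else 0) - (if v ∈ S then 1 else 0)|) := by
      rw [← pairSum_const_mul, ← pairSum_add]
      congr 1
      funext u v
      simp only [hS, Finset.mem_filter, Finset.mem_univ, true_and]
      split_ifs with hu hv hv
      · simp
      · have : h v = 0 := le_antisymm (not_lt.1 hv) (h0 v)
        rw [this, abs_of_nonneg (by linarith [h0 u]), abs_of_nonneg (by linarith [hmin u hu])]
        norm_num
      · have : h u = 0 := le_antisymm (not_lt.1 hu) (h0 u)
        rw [this, abs_of_nonpos (by linarith [h0 v]), abs_of_nonpos (by linarith [hmin v hv])]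
        norm_num
      · simp
    rw [h4, h5]
    have h6 : 2 * (k - 1) * φ * (c * H.vol S) ≤ c * (2 * (k - 1) * H.cut S) := by
      have : 2 * (k - 1) * φ * (c * H.vol S) = c * (2 * (k - 1)) * (φ * H.vol S) := by ring
      rw [this]
      have h7 : 0 ≤ c * (2 * (k - 1 : ℝ)) := by positivity
      exact (mul_le_mul_of_nonneg_left h2 h7).trans_eq (by ring)
    have h7 := mul_le_mul_of_nonneg_left h3 hc.le
    rw [mul_add]
    linarith

/-- A linear version of the Cheeger inequality, with the number of vertices as the constant. -/
theorem linear_coarea (H : WeightedHypergraph V k) (hk : 2 ≤ k) (φ : ℝ) (g : V → ℝ)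
    (g0 : ∀ u, 0 ≤ g u)
    (hφ : ∀ t > 0, φ * H.vol (Finset.univ.filter fun u => t ≤ g u) ≤
      H.cut (Finset.univ.filter fun u => t ≤ g u)) :
    2 * (k - 1) * φ * H.ip g g ≤
      Fintype.card V * H.pairSum (fun u v => (g u - g v) ^ 2) := by
  have hk1 : (0 : ℝ) ≤ k - 1 := by
    have : (2 : ℝ) ≤ k := by exact_mod_cast hk
    linarith
  by_cases hφ0 : φ ≤ 0
  · have h1 : 0 ≤ H.pairSum (fun u v => (g u - g v) ^ 2) :=
      H.pairSum_nonneg fun u v => sq_nonneg _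
    have h2 := H.ip_self_nonneg g
    have h3 : 2 * (k - 1) * φ * H.ip g g ≤ 0 :=
      mul_nonpos_of_nonpos_of_nonneg (mul_nonpos_of_nonneg_of_nonpos (by positivity) hφ0) h2
    exact h3.trans (by positivity)
  push Not at hφ0
  refine peel_induction (p := fun N g =>
    (∀ t > 0, φ * H.vol (Finset.univ.filter fun u => t ≤ g u) ≤
      H.cut (Finset.univ.filter fun u => t ≤ g u)) →
    2 * (k - 1) * φ * H.ip g g ≤ N * H.pairSum (fun u v => (g u - g v) ^ 2)) ?_ ?_ _ g g0
    (Finset.card_le_univ _) hφ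
  · intro N _
    simp [pairSum, ip]
  · intro N h c h0 hc hmin ih hφ
    set S := Finset.univ.filter fun u => 0 < h u with hS
    have hS' : (Finset.univ.filter fun u => c ≤ h u) = S := by
      ext u
      simp only [hS, Finset.mem_filter, Finset.mem_univ, true_and]
      exact ⟨fun h => hc.trans_le h, hmin u⟩
    have h1 := ih (by
      intro t ht
      have h2 : (Finset.univ.filter fun u => t ≤ h u - if 0 < h u then c else 0) =
          Finset.univ.filter fun u => t + c ≤ h u := by
        ext u
        simp only [Finset.mem_filter, Finset.mem_univ, true_and]
        split_ifs with hu
        · rw [le_sub_iff_add_le]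
        · constructor <;> intro h3 <;> linarith
      rw [h2]
      exact hφ _ (by linarith))
    have h2 := hφ c hc
    rw [hS'] at h2
    have h3 := H.cut_le_pairSum S
    set h' : V → ℝ := fun u => h u - if 0 < h u then c else 0 with hh'
    set Q := H.pairSum (fun u v => |(if u ∈ S then 1 else 0) - (if v ∈ S then 1 else 0)|) with hQ
    -- Weighted Cauchy–Schwarz, with defect `(h - c - Nc)²` at each vertex of `S`. Its weights are
    -- chosen so that one peel raises the constant from `N` to `N + 1`; the number of peels is at
    -- most the number of vertices.
    have h4 : (N : ℝ) * H.ip h h ≤ (N + 1) * (H.ip h' h' + N * (c ^ 2 * H.vol S)) := by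
      rw [vol, hS, Finset.sum_filter, ip, ip]
      simp only [Finset.mul_sum]
      rw [← Finset.sum_add_distrib, Finset.mul_sum]
      refine Finset.sum_le_sum fun v _ => ?_
      have hd := H.deg_nonneg v
      simp only [hh']
      split_ifs with hv
      · have : (N : ℝ) * (h v * h v) ≤ (N + 1) * ((h v - c) * (h v - c) + N * c ^ 2) := by
          nlinarith [sq_nonneg (h v - c - N * c)]
        nlinarith
      · have : h v = 0 := le_antisymm (not_lt.1 hv) (h0 v)
        simp [this]
    -- For `N = 0` the estimate above is vacuous. The induction hypothesis then gives `H.ip h' h' =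
    -- 0`, so `h` equals `c` on every vertex of `S` of non-zero degree.
    have h4' : N = 0 → H.ip h' h' = 0 → H.ip h h = c ^ 2 * H.vol S := by
      rintro - hz
      have hz' : ∀ v, H.deg v * (h' v * h' v) = 0 := by
        intro v
        exact (Finset.sum_eq_zero_iff_of_nonneg (fun v _ =>
          mul_nonneg (H.deg_nonneg v) (mul_self_nonneg _))).1 hz v (Finset.mem_univ v)
      rw [vol, hS, Finset.sum_filter, ip, Finset.mul_sum]
      refine Finset.sum_congr rfl fun v _ => ?_
      have := hz' v
      simp only [hh'] at this
      split_ifs at this ⊢ with hv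
      · rcases mul_eq_zero.1 this with h5 | h5
        · simp [h5]
        · have : h v = c := by
            have := mul_self_eq_zero.1 h5
            linarith
          rw [this]
          ring
      · have : h v = 0 := le_antisymm (not_lt.1 hv) (h0 v)
        simp [this]
    -- For a pair separated by `S` this is `a² + c² ≤ (a + c)²` with `a ≥ 0`.
    have h5 : H.pairSum (fun u v => (h' u - h' v) ^ 2) + c ^ 2 * Q ≤
        H.pairSum (fun u v => (h u - h v) ^ 2) := by
      rw [hQ, ← pairSum_const_mul, ← pairSum_add]
      apply H.pairSum_mono
      intro u v
      simp only [hS, hh', Finset.mem_filter, Finset.mem_univ, true_and]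
      split_ifs with hu hv hv
      · simp
      · have : h v = 0 := le_antisymm (not_lt.1 hv) (h0 v)
        rw [this]
        norm_num
        nlinarith [hmin u hu]
      · have : h u = 0 := le_antisymm (not_lt.1 hu) (h0 u)
        rw [this]
        norm_num
        nlinarith [hmin v hv]
      · simp
    have h6 : 2 * (k - 1) * φ * (c ^ 2 * H.vol S) ≤ c ^ 2 * Q := by
      have : 2 * (k - 1) * φ * (c ^ 2 * H.vol S) = c ^ 2 * (2 * (k - 1) * (φ * H.vol S)) := by ring
      rw [this]
      exact mul_le_mul_of_nonneg_left
        ((mul_le_mul_of_nonneg_left h2 (by positivity)).trans h3) (by positivity)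
    have hP0 : 0 ≤ H.pairSum (fun u v => (h' u - h' v) ^ 2) :=
      H.pairSum_nonneg fun u v => sq_nonneg _
    rcases Nat.eq_zero_or_pos N with hN | hN
    · have hz : H.ip h' h' = 0 := by
        have h8 := H.ip_self_nonneg h'
        rw [hN, Nat.cast_zero, zero_mul] at h1
        have h9 : 0 < 2 * (k - 1) * φ := by
          have : (2 : ℝ) ≤ k := by exact_mod_cast hk
          have : (0 : ℝ) < k - 1 := by linarith
          positivity
        nlinarith
      rw [h4' hN hz, hN]
      push_cast
      linarith
    · have hN' : (0 : ℝ) < N := by exact_mod_cast hN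
      refine le_of_mul_le_mul_left ?_ hN'
      have hA : 0 ≤ 2 * (k - 1) * φ := by positivity
      calc (N : ℝ) * (2 * (k - 1) * φ * H.ip h h) = 2 * (k - 1) * φ * (N * H.ip h h) := by ring
        _ ≤ 2 * (k - 1) * φ * ((N + 1) * (H.ip h' h' + N * (c ^ 2 * H.vol S))) :=
          mul_le_mul_of_nonneg_left h4 hA
        _ = (N + 1) * (2 * (k - 1) * φ * H.ip h' h' +
            N * (2 * (k - 1) * φ * (c ^ 2 * H.vol S))) := by ring
        _ ≤ (N + 1) * (N * H.pairSum (fun u v => (h' u - h' v) ^ 2) + N * (c ^ 2 * Q)) := by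
          gcongr
        _ = N * ((N + 1) * (H.pairSum (fun u v => (h' u - h' v) ^ 2) + c ^ 2 * Q)) := by ring
        _ ≤ N * ((N + 1) * H.pairSum (fun u v => (h u - h v) ^ 2)) := by gcongr
        _ = _ := by push_cast; ring

/-- The Cheeger inequality for non-negative functions. -/
theorem cheeger_nonneg (H : WeightedHypergraph V k) (hk : 2 ≤ k) (φ : ℝ) (hφ0 : 0 ≤ φ) (g : V → ℝ)
    (g0 : ∀ u, 0 ≤ g u)
    (hφ : ∀ t > 0, φ * H.vol (Finset.univ.filter fun u => t ≤ g u) ≤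
      H.cut (Finset.univ.filter fun u => t ≤ g u)) :
    (k - 1) * φ ^ 2 * H.ip g g ≤ 2 * k * H.energy g g := by
  have hk1 : (0 : ℝ) ≤ k - 1 := by
    have : (2 : ℝ) ≤ k := by exact_mod_cast hk
    linarith
  rcases hφ0.eq_or_lt with rfl | hφ0
  · have := H.energy_self_nonneg g
    simp only [ne_eq, OfNat.ofNat_ne_zero, not_false_eq_true, zero_pow, mul_zero, zero_mul]
    positivity
  have h1 := H.coarea hk φ (fun u => g u ^ 2) (fun u => sq_nonneg _) (by
    intro t ht
    have h2 : (Finset.univ.filter fun u => t ≤ g u ^ 2) =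
        Finset.univ.filter fun u => √t ≤ g u := by
      ext u
      simp only [Finset.mem_filter, Finset.mem_univ, true_and]
      rw [Real.sqrt_le_left (g0 u)]
    rw [h2]
    exact hφ _ (Real.sqrt_pos.2 ht))
  -- AM–GM with weight `φ`, then `(g u + g v)² ≤ 2 (g u)² + 2 (g v)²`. The diagonal is subtracted
  -- because the left side vanishes there; otherwise the final coefficient would be `k - 2` in place
  -- of `k - 1`, which is useless for graphs.
  have h2 : H.pairSum (fun u v => |g u ^ 2 - g v ^ 2|) ≤
      H.pairSum (fun u v => φ⁻¹ * (g u - g v) ^ 2 +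
        (φ / 4) * (2 * g u ^ 2 + 2 * g v ^ 2 - if u = v then 4 * g u ^ 2 else 0)) := by
    apply H.pairSum_mono
    intro u v
    split_ifs with huv
    · rw [huv]
      ring_nf
      simp
    · have h3 : g u ^ 2 - g v ^ 2 = (g u - g v) * (g u + g v) := by ring
      have h4 : φ⁻¹ * (g u - g v) ^ 2 + (φ / 4) * (g u + g v) ^ 2 - (g u - g v) * (g u + g v) =
          φ⁻¹ * ((g u - g v) - φ / 2 * (g u + g v)) ^ 2 := by
        field_simp
        ring
      have h5 : φ⁻¹ * (g u - g v) ^ 2 + (φ / 4) * (g u + g v) ^ 2 + (g u - g v) * (g u + g v) =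
          φ⁻¹ * ((g u - g v) + φ / 2 * (g u + g v)) ^ 2 := by
        field_simp
        ring
      have h6 : 0 ≤ φ⁻¹ * ((g u - g v) - φ / 2 * (g u + g v)) ^ 2 := by positivity
      have h7 : 0 ≤ φ⁻¹ * ((g u - g v) + φ / 2 * (g u + g v)) ^ 2 := by positivity
      have h8 : (φ / 4) * (g u + g v) ^ 2 ≤ (φ / 4) * (2 * g u ^ 2 + 2 * g v ^ 2 - 0) := by
        apply mul_le_mul_of_nonneg_left _ (by positivity)
        nlinarith [sq_nonneg (g u - g v)]
      rw [h3, abs_le]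
      constructor <;> linarith
  rw [pairSum_add, pairSum_const_mul, pairSum_const_mul, H.pairSum_sq_sub (by omega)] at h2
  have h3 : H.pairSum (fun u v => 2 * g u ^ 2 + 2 * g v ^ 2 - if u = v then 4 * g u ^ 2 else 0) =
      4 * (k - 1) * H.ip g g := by
    rw [ip_eq_sum_edges, pairSum, Finset.mul_sum]
    refine Finset.sum_congr rfl fun e he => ?_
    have h4 : ∑ u ∈ e, ∑ v ∈ e, (2 * g u ^ 2 + 2 * g v ^ 2 - if u = v then 4 * g u ^ 2 else 0) =
        4 * (k - 1) * ∑ v ∈ e, g v * g v := by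
      have h5 : ∀ u ∈ e, ∑ v ∈ e, (2 * g u ^ 2 + 2 * g v ^ 2 - if u = v then 4 * g u ^ 2 else 0) =
          2 * (k - 2) * g u ^ 2 + 2 * ∑ v ∈ e, g v ^ 2 := by
        intro u hu
        rw [Finset.sum_sub_distrib, Finset.sum_ite_eq, if_pos hu, Finset.sum_add_distrib,
          Finset.sum_const, H.card_edge e he, ← Finset.mul_sum, nsmul_eq_mul]
        ring
      rw [Finset.sum_congr rfl h5, Finset.sum_add_distrib, Finset.sum_const, H.card_edge e he,
        ← Finset.mul_sum, nsmul_eq_mul]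
      simp only [← sq]
      ring
    rw [h4]
    ring
  rw [h3] at h2
  have h4 : ∑ v, H.deg v * g v ^ 2 = H.ip g g := by simp only [ip, sq]
  rw [h4] at h1
  have h5 := h1.trans h2
  have h6 := mul_le_mul_of_nonneg_left h5 hφ0.le
  have h7 : φ * (φ⁻¹ * (2 * k * H.energy g g) + φ / 4 * (4 * (k - 1) * H.ip g g)) =
      2 * k * H.energy g g + φ ^ 2 * (k - 1) * H.ip g g := by
    field_simp
  rw [h7] at h6
  linarith

end WeightedHypergraph

/-! ### Sweep cuts and the bounds for the conductance -/

namespace WeightedHypergraph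

variable {V : Type*} [Fintype V] [DecidableEq V] {k : ℕ}

theorem vol_filter_add_vol_filter_not (H : WeightedHypergraph V k) (p : V → Prop)
    [DecidablePred p] : H.vol (Finset.univ.filter p) + H.vol (Finset.univ.filter fun u => ¬ p u) =
      H.vol Finset.univ := by
  simp only [vol]
  exact Finset.sum_filter_add_sum_filter_not _ _ _

/-- The median is the least value of `f` with at most half of the volume strictly above it. By
minimality the next smaller value has more than half above it. -/
theorem exists_median (H : WeightedHypergraph V k) (f : V → ℝ) :
    ∃ c, H.vol (Finset.univ.filter fun u => c < f u) ≤ H.vol Finset.univ / 2 ∧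
      H.vol (Finset.univ.filter fun u => f u < c) ≤ H.vol Finset.univ / 2 := by
  rcases isEmpty_or_nonempty V with hV | hV
  · refine ⟨0, ?_, ?_⟩ <;> simp [vol]
  set A := Finset.univ.filter fun v => H.vol (Finset.univ.filter fun u => f v < f u) ≤
    H.vol Finset.univ / 2 with hA
  have hAne : A.Nonempty := by
    obtain ⟨v, _, hv⟩ := Finset.exists_max_image Finset.univ f Finset.univ_nonempty
    refine ⟨v, ?_⟩
    simp only [hA, Finset.mem_filter, Finset.mem_univ, true_and]
    have : (Finset.univ.filter fun u => f v < f u) = ∅ := by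
      ext u
      simpa using hv u (Finset.mem_univ u)
    rw [this]
    have := H.vol_nonneg Finset.univ
    simp only [vol, Finset.sum_empty]
    positivity
  obtain ⟨w, hw, hmin⟩ := Finset.exists_min_image A f hAne
  simp only [hA, Finset.mem_filter, Finset.mem_univ, true_and] at hw hmin
  refine ⟨f w, hw, ?_⟩
  rcases (Finset.univ.filter fun u => f u < f w).eq_empty_or_nonempty with he | hne
  · rw [he]
    have := H.vol_nonneg Finset.univ
    simp only [vol, Finset.sum_empty]
    positivity
  · obtain ⟨x, hx, hmax⟩ := Finset.exists_max_image _ f hne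
    simp only [Finset.mem_filter, Finset.mem_univ, true_and] at hx hmax
    have h1 : H.vol Finset.univ / 2 < H.vol (Finset.univ.filter fun u => f x < f u) := by
      by_contra! h
      exact absurd (hmin x h) (not_le.2 hx)
    have h2 := H.vol_filter_add_vol_filter_not (fun u => f x < f u)
    have h3 : (Finset.univ.filter fun u => f u < f w) ⊆
        Finset.univ.filter fun u => ¬ f x < f u := by
      intro u
      simp only [Finset.mem_filter, Finset.mem_univ, true_and, not_lt]
      exact hmax u
    have := H.vol_mono h3
    linarith

theorem ip_sub_const (H : WeightedHypergraph V k) (f : V → ℝ) (c : ℝ)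
    (hf : ∑ v, H.deg v * f v = 0) :
    H.ip (fun u => f u - c) (fun u => f u - c) = H.ip f f + c ^ 2 * H.vol Finset.univ := by
  have : H.ip (fun u => f u - c) (fun u => f u - c) =
      H.ip f f + c ^ 2 * H.vol Finset.univ - 2 * c * ∑ v, H.deg v * f v := by
    simp only [ip, vol, Finset.mul_sum, ← Finset.sum_add_distrib, ← Finset.sum_sub_distrib]
    exact Finset.sum_congr rfl fun v _ => by ring
  rw [this, hf]
  ring

/-- Subtract a median and take positive and negative parts. As `f` has mean zero, the shift does not
decrease the norm; the energies of the parts add up to at most that of `f`; so one part has Rayleigh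
quotient at most `R`. Its threshold sets are sweep cuts of `f`. -/
theorem exists_nonneg_of_energy_le (H : WeightedHypergraph V k) (hk : 0 < k) (f : V → ℝ) (R : ℝ)
    (hf : ∑ v, H.deg v * f v = 0) (hpos : 0 < H.ip f f) (hR : H.energy f f ≤ R * H.ip f f) :
    ∃ g : V → ℝ, (∀ u, 0 ≤ g u) ∧
      H.vol (Finset.univ.filter fun u => 0 < g u) ≤ H.vol Finset.univ / 2 ∧
      0 < H.ip g g ∧ H.energy g g ≤ R * H.ip g g ∧
      ∀ t > 0, (Finset.univ.filter fun u => t ≤ g u) = ∅ ∨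
        ∃ w, (Finset.univ.filter fun u => t ≤ g u) = (Finset.univ.filter fun u => f w ≤ f u) ∨
          (Finset.univ.filter fun u => t ≤ g u) = (Finset.univ.filter fun u => f u ≤ f w) := by
  obtain ⟨c, hc1, hc2⟩ := H.exists_median f
  have hR0 : 0 ≤ R := by
    have := H.energy_self_nonneg f
    by_contra! h
    nlinarith
  have hk' : (0 : ℝ) < k := by exact_mod_cast hk
  set g₁ : V → ℝ := fun u => max (f u - c) 0 with hg₁
  set g₂ : V → ℝ := fun u => max (c - f u) 0 with hg₂
  have hip : H.ip f f ≤ H.ip g₁ g₁ + H.ip g₂ g₂ := by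
    have h1 := H.ip_sub_const f c hf
    have h2 : H.ip g₁ g₁ + H.ip g₂ g₂ = H.ip (fun u => f u - c) (fun u => f u - c) := by
      simp only [ip, ← Finset.sum_add_distrib, hg₁, hg₂]
      refine Finset.sum_congr rfl fun v _ => ?_
      rcases le_total (f v) c with h | h
      · rw [max_eq_right (by linarith), max_eq_left (by linarith)]
        ring
      · rw [max_eq_left (by linarith), max_eq_right (by linarith)]
        ring
    rw [h2, h1]
    have := mul_nonneg (sq_nonneg c) (H.vol_nonneg Finset.univ)
    linarith
  have hen : H.energy g₁ g₁ + H.energy g₂ g₂ ≤ H.energy f f := by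
    have h1 : H.pairSum (fun u v => (g₁ u - g₁ v) ^ 2 + (g₂ u - g₂ v) ^ 2) ≤
        H.pairSum (fun u v => (f u - f v) ^ 2) := by
      apply H.pairSum_mono
      intro u v
      simp only [hg₁, hg₂]
      rcases le_total (f u) c with h | h <;> rcases le_total (f v) c with h' | h'
      · rw [max_eq_right (by linarith), max_eq_right (by linarith), max_eq_left (by linarith),
          max_eq_left (by linarith)]
        apply le_of_eq
        ring
      · rw [max_eq_right (by linarith), max_eq_left (by linarith), max_eq_left (by linarith),
          max_eq_right (by linarith)]
        nlinarith
      · rw [max_eq_left (by linarith), max_eq_right (by linarith), max_eq_right (by linarith),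
          max_eq_left (by linarith)]
        nlinarith
      · rw [max_eq_left (by linarith), max_eq_left (by linarith), max_eq_right (by linarith),
          max_eq_right (by linarith)]
        apply le_of_eq
        ring
    rw [pairSum_add, H.pairSum_sq_sub hk, H.pairSum_sq_sub hk, H.pairSum_sq_sub hk,
      ← mul_add] at h1
    exact le_of_mul_le_mul_left h1 (by positivity)
  have hsupp₁ : H.vol (Finset.univ.filter fun u => 0 < g₁ u) ≤ H.vol Finset.univ / 2 := by
    refine le_of_eq_of_le ?_ hc1
    congr 1
    ext u
    simp [hg₁]
  have hsupp₂ : H.vol (Finset.univ.filter fun u => 0 < g₂ u) ≤ H.vol Finset.univ / 2 := by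
    refine le_of_eq_of_le ?_ hc2
    congr 1
    ext u
    simp [hg₂]
  have hlev₁ : ∀ t > 0, (Finset.univ.filter fun u => t ≤ g₁ u) = ∅ ∨
        ∃ w, (Finset.univ.filter fun u => t ≤ g₁ u) = (Finset.univ.filter fun u => f w ≤ f u) := by
    intro t ht
    rcases (Finset.univ.filter fun u => t ≤ g₁ u).eq_empty_or_nonempty with he | hne
    · exact Or.inl he
    · right
      obtain ⟨w, hw, hmin⟩ := Finset.exists_min_image _ f hne
      refine ⟨w, ?_⟩
      have h1 : ∀ u, t ≤ g₁ u ↔ c + t ≤ f u := by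
        intro u
        simp only [hg₁, le_max_iff]
        constructor
        · rintro (h | h) <;> linarith
        · intro h
          left
          linarith
      simp only [Finset.mem_filter, Finset.mem_univ, true_and, h1] at hw hmin
      ext u
      simp only [Finset.mem_filter, Finset.mem_univ, true_and, h1]
      exact ⟨hmin u, hw.trans⟩
  have hlev₂ : ∀ t > 0, (Finset.univ.filter fun u => t ≤ g₂ u) = ∅ ∨
        ∃ w, (Finset.univ.filter fun u => t ≤ g₂ u) = (Finset.univ.filter fun u => f u ≤ f w) := by
    intro t ht
    rcases (Finset.univ.filter fun u => t ≤ g₂ u).eq_empty_or_nonempty with he | hne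
    · exact Or.inl he
    · right
      obtain ⟨w, hw, hmax⟩ := Finset.exists_max_image _ f hne
      refine ⟨w, ?_⟩
      have h1 : ∀ u, t ≤ g₂ u ↔ f u ≤ c - t := by
        intro u
        simp only [hg₂, le_max_iff]
        constructor
        · rintro (h | h) <;> linarith
        · intro h
          left
          linarith
      simp only [Finset.mem_filter, Finset.mem_univ, true_and, h1] at hw hmax
      ext u
      simp only [Finset.mem_filter, Finset.mem_univ, true_and, h1]
      exact ⟨hmax u, fun h => h.trans hw⟩
  by_cases h1 : 0 < H.ip g₁ g₁ ∧ H.energy g₁ g₁ ≤ R * H.ip g₁ g₁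
  · exact ⟨g₁, fun u => le_max_right _ _, hsupp₁, h1.1, h1.2,
      fun t ht => (hlev₁ t ht).imp_right fun ⟨w, hw⟩ => ⟨w, Or.inl hw⟩⟩
  by_cases h2 : 0 < H.ip g₂ g₂ ∧ H.energy g₂ g₂ ≤ R * H.ip g₂ g₂
  · exact ⟨g₂, fun u => le_max_right _ _, hsupp₂, h2.1, h2.2,
      fun t ht => (hlev₂ t ht).imp_right fun ⟨w, hw⟩ => ⟨w, Or.inr hw⟩⟩
  exfalso
  have e1 := H.energy_self_nonneg g₁
  have e2 := H.energy_self_nonneg g₂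
  have h3 : R * H.ip f f ≤ R * (H.ip g₁ g₁ + H.ip g₂ g₂) := mul_le_mul_of_nonneg_left hip hR0
  have i1 := H.ip_self_nonneg g₁
  have i2 := H.ip_self_nonneg g₂
  rcases i1.eq_or_lt with i1 | i1
  · have h4 : R * H.ip g₂ g₂ < H.energy g₂ g₂ := by
      by_contra! h
      exact h2 ⟨by linarith, h⟩
    rw [← i1] at h3
    nlinarith
  · have h4 : R * H.ip g₁ g₁ < H.energy g₁ g₁ := by
      by_contra! h
      exact h1 ⟨i1, h⟩
    rcases i2.eq_or_lt with i2 | i2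
    · rw [← i2] at h3
      nlinarith
    · have h5 : R * H.ip g₂ g₂ < H.energy g₂ g₂ := by
        by_contra! h
        exact h2 ⟨i2, h⟩
      nlinarith

theorem mul_vol_le_cut (H : WeightedHypergraph V k) {φ : ℝ} {S : Finset V}
    (hS : H.vol S ≤ H.vol Finset.univ / 2) (h : H.IsAdmissible S → φ ≤ H.expansion S) :
    φ * H.vol S ≤ H.cut S := by
  rcases (H.vol_nonneg S).eq_or_lt with h0 | h0
  · rw [← h0, mul_zero]
    exact H.cut_nonneg S
  · have h1 := h ⟨h0, hS⟩
    rwa [expansion, le_div_iff₀ h0] at h1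

/-- The sweep cuts of a function of small Rayleigh quotient have small expansion. -/
theorem sweep (H : WeightedHypergraph V k) (hk : 2 ≤ k) (f : V → ℝ) (R φ : ℝ)
    (hf : ∑ v, H.deg v * f v = 0) (hpos : 0 < H.ip f f) (hR : H.energy f f ≤ R * H.ip f f)
    (hφ0 : 0 ≤ φ)
    (hup : ∀ w, H.IsAdmissible (Finset.univ.filter fun u => f w ≤ f u) →
      φ ≤ H.expansion (Finset.univ.filter fun u => f w ≤ f u))
    (hdown : ∀ w, H.IsAdmissible (Finset.univ.filter fun u => f u ≤ f w) →
      φ ≤ H.expansion (Finset.univ.filter fun u => f u ≤ f w)) :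
    (k - 1) * φ ^ 2 ≤ 2 * k * R := by
  obtain ⟨g, g0, gs, gpos, gR, glev⟩ := H.exists_nonneg_of_energy_le (by omega) f R hf hpos hR
  have h1 := H.cheeger_nonneg hk φ hφ0 g g0 (by
    intro t ht
    apply H.mul_vol_le_cut
    · refine (H.vol_mono ?_).trans gs
      intro u
      simp only [Finset.mem_filter, Finset.mem_univ, true_and]
      exact ht.trans_le
    · intro hadm
      rcases glev t ht with h | ⟨w, h | h⟩
      · rw [h] at hadm
        exact absurd hadm.1 (by simp [vol])
      · rw [h] at hadm ⊢
        exact hup w hadm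
      · rw [h] at hadm ⊢
        exact hdown w hadm)
  refine le_of_mul_le_mul_right (h1.trans ?_) gpos
  have : (0 : ℝ) ≤ 2 * k := by positivity
  nlinarith [mul_le_mul_of_nonneg_left gR this]

/-- Linear in `R` where `sweep` is quadratic in `φ`, at the price of the number of vertices. For
very small `R` this is the stronger bound, and it pays for the loss of the component candidates. -/
theorem linear_cheeger (H : WeightedHypergraph V k) (hk : 2 ≤ k) (f : V → ℝ) (R φ : ℝ)
    (hf : ∑ v, H.deg v * f v = 0) (hpos : 0 < H.ip f f) (hR : H.energy f f ≤ R * H.ip f f)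
    (hφ : ∀ S, H.IsAdmissible S → φ ≤ H.expansion S) :
    (k - 1) * φ ≤ Fintype.card V * k * R := by
  obtain ⟨g, g0, gs, gpos, gR, -⟩ := H.exists_nonneg_of_energy_le (by omega) f R hf hpos hR
  have h1 := H.linear_coarea hk φ g g0 (by
    intro t ht
    apply H.mul_vol_le_cut
    · refine (H.vol_mono ?_).trans gs
      intro u
      simp only [Finset.mem_filter, Finset.mem_univ, true_and]
      exact ht.trans_le
    · exact hφ _)
  rw [H.pairSum_sq_sub (by omega)] at h1
  refine le_of_mul_le_mul_right ?_ gpos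
  have h2 : (0 : ℝ) ≤ Fintype.card V * (2 * k) := by positivity
  nlinarith [mul_le_mul_of_nonneg_left gR h2]

theorem vol_univ (H : WeightedHypergraph V k) : H.vol Finset.univ = k := by
  have h1 := H.sum_deg_mul (fun _ => 1)
  simp only [mul_one, Finset.sum_const, nsmul_eq_mul] at h1
  rw [vol, h1]
  have : ∀ e ∈ H.edges, H.prob e * (e.card : ℝ) = H.prob e * k := fun e he => by
    rw [H.card_edge e he]
  rw [Finset.sum_congr rfl this, ← Finset.sum_mul, H.sum_prob, one_mul]

theorem cut_le_vol (H : WeightedHypergraph V k) (S : Finset V) : H.cut S ≤ H.vol S := by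
  have h1 : H.vol S = ∑ e ∈ H.edges, H.prob e * ∑ v ∈ e, if v ∈ S then 1 else 0 := by
    rw [← sum_deg_mul, vol]
    simp
  rw [h1, cut, boundary, Finset.sum_filter]
  apply Finset.sum_le_sum
  intro e he
  have hp := (H.prob_pos e he).le
  split_ifs with hb
  · obtain ⟨v, hv⟩ := hb.1
    rw [Finset.mem_inter] at hv
    have h2 : (1 : ℝ) ≤ ∑ v ∈ e, if v ∈ S then 1 else 0 := by
      have := Finset.single_le_sum (f := fun v => if v ∈ S then (1 : ℝ) else 0)
        (fun v _ => by split_ifs <;> norm_num) hv.1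
      simpa [hv.2] using this
    nlinarith
  · exact mul_nonneg hp (Finset.sum_nonneg fun v _ => by split_ifs <;> norm_num)

theorem expansion_nonneg (H : WeightedHypergraph V k) (S : Finset V) : 0 ≤ H.expansion S :=
  div_nonneg (H.cut_nonneg S) (H.vol_nonneg S)

theorem expansion_le_one (H : WeightedHypergraph V k) (S : Finset V) : H.expansion S ≤ 1 :=
  div_le_one_of_le₀ (H.cut_le_vol S) (H.vol_nonneg S)

theorem isAdmissible_singleton (H : WeightedHypergraph V k) (hk : 2 ≤ k) {e : Finset V}
    (he : e ∈ H.edges) {v : V} (hv : v ∈ e) : H.IsAdmissible {v} := by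
  have hk' : (2 : ℝ) ≤ k := by exact_mod_cast hk
  constructor
  · simp only [vol, Finset.sum_singleton, deg]
    exact Finset.sum_pos (fun e he => H.prob_pos e (Finset.mem_filter.1 he).1)
      ⟨e, Finset.mem_filter.2 ⟨he, hv⟩⟩
  · rw [vol_univ]
    simp only [vol, Finset.sum_singleton, deg]
    have : ∑ e ∈ H.edges with v ∈ e, H.prob e ≤ ∑ e ∈ H.edges, H.prob e :=
      Finset.sum_le_sum_of_subset_of_nonneg (Finset.filter_subset _ _)
        fun e he _ => (H.prob_pos e he).le
    rw [H.sum_prob] at this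
    linarith

theorem exists_isAdmissible (H : WeightedHypergraph V k) (hk : 2 ≤ k) : ∃ S, H.IsAdmissible S := by
  obtain ⟨e, he⟩ := H.edges_nonempty
  have : e.Nonempty := by
    rw [← Finset.card_pos, H.card_edge e he]
    omega
  obtain ⟨v, hv⟩ := this
  exact ⟨{v}, H.isAdmissible_singleton hk he hv⟩

theorem conductance_le (H : WeightedHypergraph V k) {S : Finset V} (hS : H.IsAdmissible S) :
    H.conductance ≤ H.expansion S := by
  apply csInf_le
  · refine ⟨0, ?_⟩
    rintro x ⟨S, _, rfl⟩
    exact H.expansion_nonneg S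
  · exact ⟨S, hS, rfl⟩

/-- The easy direction of the Cheeger inequality. -/
theorem le_expansion (H : WeightedHypergraph V k) (hk : 2 ≤ k) {ε : ℝ}
    (h : ∀ f, ∑ v, H.deg v * f v = 0 → ε * H.ip f f ≤ H.energy f f) (hε : 0 ≤ ε) {S : Finset V}
    (hS : H.IsAdmissible S) : ε / k ≤ H.expansion S := by
  have hk' : (0 : ℝ) < k := by exact_mod_cast (by omega : 0 < k)
  obtain ⟨h0, h2⟩ := hS
  rw [vol_univ] at h2
  set c := H.vol S / k with hc
  set f : V → ℝ := fun v => if v ∈ S then 1 else 0 with hf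
  have hvol : ∑ v, H.deg v * f v = H.vol S := by simp [hf, vol]
  have hipf : H.ip f f = H.vol S := by simp [hf, ip, vol]
  have h1 := h (fun v => f v - c) (by
    simp only [mul_sub, Finset.sum_sub_distrib, hvol, ← Finset.sum_mul]
    have := H.vol_univ
    rw [vol] at this
    rw [this, hc]
    field_simp
    ring)
  have h3 : H.ip (fun v => f v - c) (fun v => f v - c) = H.vol S - H.vol S ^ 2 / k := by
    have : H.ip (fun v => f v - c) (fun v => f v - c) =
        H.ip f f + c ^ 2 * H.vol Finset.univ - 2 * c * ∑ v, H.deg v * f v := by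
      simp only [ip, vol, Finset.mul_sum, ← Finset.sum_add_distrib, ← Finset.sum_sub_distrib]
      exact Finset.sum_congr rfl fun v _ => by ring
    rw [this, hvol, hipf, vol_univ, hc]
    field_simp
    ring
  -- The crude count of all `k²` ordered pairs in a crossing hyperedge suffices for the stated
  -- constant.
  have h4 : 2 * k * H.energy (fun v => f v - c) (fun v => f v - c) ≤ k ^ 2 * H.cut S := by
    rw [← H.pairSum_sq_sub (by omega), cut, boundary, Finset.sum_filter, pairSum, Finset.mul_sum]
    apply Finset.sum_le_sum
    intro e he
    have hp := (H.prob_pos e he).le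
    split_ifs with hb
    · rw [mul_comm]
      apply mul_le_mul_of_nonneg_right _ hp
      calc ∑ u ∈ e, ∑ v ∈ e, (f u - c - (f v - c)) ^ 2 ≤ ∑ u ∈ e, ∑ v ∈ e, (1 : ℝ) := by
            refine Finset.sum_le_sum fun u _ => Finset.sum_le_sum fun v _ => ?_
            rw [sub_sub_sub_cancel_right]
            simp only [hf]
            split_ifs <;> norm_num
        _ = _ := by
          simp [H.card_edge e he, sq]
    · have h5 : ∀ u ∈ e, ∀ v ∈ e, f u = f v := by
        intro u hu v hv
        simp only [hf]
        by_contra hne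
        apply hb
        by_cases h6 : u ∈ S <;> by_cases h7 : v ∈ S
        · simp [h6, h7] at hne
        · exact ⟨⟨u, by simp [hu, h6]⟩, ⟨v, by simp [hv, h7]⟩⟩
        · exact ⟨⟨v, by simp [hv, h7]⟩, ⟨u, by simp [hu, h6]⟩⟩
        · simp [h6, h7] at hne
      rw [mul_zero]
      apply le_of_eq
      rw [Finset.sum_eq_zero, mul_zero]
      intro u hu
      apply Finset.sum_eq_zero
      intro v hv
      rw [h5 u hu v hv]
      ring
  rw [h3] at h1
  rw [expansion, div_le_div_iff₀ hk' h0]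
  change ε * H.vol S ≤ H.cut S * k
  have h5 : H.vol S ^ 2 / k ≤ H.vol S / 2 := by
    rw [div_le_iff₀ hk']
    nlinarith
  have h6 : ε * (H.vol S / 2) ≤ ε * (H.vol S - H.vol S ^ 2 / k) :=
    mul_le_mul_of_nonneg_left (by linarith) hε
  have h7 : 2 * k * (ε * (H.vol S / 2)) ≤ k ^ 2 * H.cut S :=
    (mul_le_mul_of_nonneg_left (h6.trans h1) (by positivity)).trans h4
  refine le_of_mul_le_mul_left ?_ hk'
  nlinarith

theorem expansion_bounds (H : WeightedHypergraph V k) (l : ℕ) (ε : ℝ) (hl : 2 ≤ l)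
    (hlk : l ≤ k) (hε : 0 < ε)
    (h : secondEigenvalue (H.upDownWalk 1 (l - 1)) = 1 - ε ∨
        secondEigenvalue (H.bipartiteWalk 1 (l - 1)) = 1 - ε) :
    ε / k ≤ H.conductance ∧ H.conductance ≤ 4 * √ε := by
  obtain ⟨ha, hb⟩ := H.energy_of_secondEigenvalue l ε hl hlk hε h
  have hk : 2 ≤ k := hl.trans hlk
  constructor
  · apply le_csInf
    · obtain ⟨S, hS⟩ := H.exists_isAdmissible hk
      exact ⟨_, S, hS, rfl⟩
    · rintro x ⟨S, hS, rfl⟩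
      exact H.le_expansion hk ha hε.le hS
  · rcases hb with hb | ⟨ψ, γ, hpos, hψ, hen, hγ⟩
    · obtain ⟨S, hS⟩ := H.exists_isAdmissible hk
      have h1 : 1 ≤ √ε := Real.one_le_sqrt.2 hb
      linarith [H.conductance_le hS, H.expansion_le_one S]
    · have h0 : 0 ≤ H.conductance := by
        apply Real.sInf_nonneg
        rintro x ⟨S, _, rfl⟩
        exact H.expansion_nonneg S
      -- For the exact eigenfunction this gives `φ² ≤ 2kγ/(k-1) ≤ 8ε`. The spare factor 2 in `16ε`
      -- is what the power iteration needs.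
      have h1 := H.sweep hk ψ γ H.conductance hψ hpos (hen ψ).le h0
        (fun w hw => H.conductance_le hw) (fun w hw => H.conductance_le hw)
      have hk1 : (0 : ℝ) < k - 1 := by
        have : (2 : ℝ) ≤ k := by exact_mod_cast hk
        linarith
      have h2 : H.conductance ^ 2 ≤ (4 * √ε) ^ 2 := by
        rw [mul_pow, Real.sq_sqrt hε.le]
        refine le_of_mul_le_mul_left ?_ hk1
        nlinarith
      exact le_of_sq_le_sq h2 (by positivity)

end WeightedHypergraph

/-! ### Moments of the walk and power iteration -/

theorem le_pow_mul_of_sq_le {a : ℕ → ℝ} (h0 : ∀ n, 0 ≤ a n)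
    (hlog : ∀ n, a (n + 1) ^ 2 ≤ a n * a (n + 2)) {ρ : ℝ} {N : ℕ} (hpos : 0 < a N)
    (hN : a (N + 1) ≤ ρ * a N) : a N ≤ ρ ^ N * a 0 := by
  induction N with
  | zero => simp
  | succ N ih =>
    -- Consecutive ratios of a log-convex sequence increase, so a bound for the last ratio passes to
    -- all earlier ones.
    have h1 := hlog N
    have h2 : 0 < a N := by
      rcases (h0 N).eq_or_lt with h | h
      · rw [← h, zero_mul] at h1
        nlinarith
      · exact h
    have h3 : a (N + 1) ≤ ρ * a N := by
      refine le_of_mul_le_mul_left ?_ hpos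
      nlinarith [mul_le_mul_of_nonneg_left hN h2.le]
    have h4 : 0 < ρ := by
      by_contra! h
      nlinarith
    calc a (N + 1) ≤ ρ * a N := h3
      _ ≤ ρ * (ρ ^ N * a 0) := mul_le_mul_of_nonneg_left (ih h2 h3) h4.le
      _ = _ := by ring

namespace WeightedHypergraph

variable {V : Type*} [Fintype V] [DecidableEq V] {k : ℕ}

/-- The walk that moves to a random vertex of a random hyperedge at the current vertex. -/
noncomputable def walk (H : WeightedHypergraph V k) (f : V → ℝ) (u : V) : ℝ :=
  (∑ e ∈ H.edges with u ∈ e, H.prob e * ∑ w ∈ e, f w) / (k * H.deg u)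

theorem prob_le_deg (H : WeightedHypergraph V k) {e : Finset V} (he : e ∈ H.edges) {u : V}
    (hu : u ∈ e) : H.prob e ≤ H.deg u :=
  Finset.single_le_sum (f := H.prob) (fun e he => (H.prob_pos e (Finset.mem_filter.1 he).1).le)
    (Finset.mem_filter.2 ⟨he, hu⟩)

theorem deg_pos (H : WeightedHypergraph V k) {e : Finset V} (he : e ∈ H.edges) {u : V}
    (hu : u ∈ e) : 0 < H.deg u :=
  (H.prob_pos e he).trans_le (H.prob_le_deg he hu)

theorem ip_walk (H : WeightedHypergraph V k) (hk : 0 < k) (f g : V → ℝ) :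
    H.ip (H.walk f) g =
      (1 / k) * ∑ e ∈ H.edges, H.prob e * ((∑ v ∈ e, f v) * ∑ v ∈ e, g v) := by
  have hk' : (k : ℝ) ≠ 0 := by exact_mod_cast hk.ne'
  have h1 : ∀ u, H.deg u * (H.walk f u * g u) =
      (1 / k) * ∑ e ∈ H.edges with u ∈ e, H.prob e * (∑ w ∈ e, f w) * g u := by
    intro u
    unfold walk
    rw [← Finset.sum_mul]
    by_cases hu : H.deg u = 0
    · have : (H.edges.filter fun e => u ∈ e) = ∅ := by
        rw [Finset.filter_eq_empty_iff]
        intro e he hue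
        exact (H.deg_pos he hue).ne' hu
      simp [this, hu]
    · field_simp
  simp only [ip, h1, ← Finset.mul_sum]
  congr 1
  rw [Finset.sum_comm' (t' := H.edges) (s' := fun e => e) (by intro u e; simp [and_comm])]
  refine Finset.sum_congr rfl fun e _ => ?_
  rw [← Finset.mul_sum, mul_assoc]

theorem ip_comm (H : WeightedHypergraph V k) (f g : V → ℝ) : H.ip f g = H.ip g f := by
  simp only [ip, mul_comm (f _)]

theorem ip_walk_comm (H : WeightedHypergraph V k) (hk : 0 < k) (f g : V → ℝ) :
    H.ip (H.walk f) g = H.ip f (H.walk g) := by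
  rw [H.ip_comm f, H.ip_walk hk, H.ip_walk hk]
  simp only [mul_comm (∑ v ∈ _, f v)]

theorem energy_eq (H : WeightedHypergraph V k) (hk : 0 < k) (f g : V → ℝ) :
    H.energy f g = H.ip f g - H.ip (H.walk f) g := by
  rw [H.ip_walk hk, energy]

theorem ip_sq_le (H : WeightedHypergraph V k) (f g : V → ℝ) :
    H.ip f g ^ 2 ≤ H.ip f f * H.ip g g := by
  have h := Finset.sum_mul_sq_le_sq_mul_sq Finset.univ (fun v => √(H.deg v) * f v)
    (fun v => √(H.deg v) * g v)
  have h1 : ∀ (a b : V → ℝ) v, √(H.deg v) * a v * (√(H.deg v) * b v) = H.deg v * (a v * b v) := by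
    intro a b v
    rw [mul_mul_mul_comm, Real.mul_self_sqrt (H.deg_nonneg v)]
  simp only [sq (√(H.deg _) * _), h1] at h
  exact h

theorem ip_walk_sq_le (H : WeightedHypergraph V k) (hk : 0 < k) (f g : V → ℝ) :
    H.ip (H.walk f) g ^ 2 ≤ H.ip (H.walk f) f * H.ip (H.walk g) g := by
  rw [H.ip_walk hk, H.ip_walk hk, H.ip_walk hk]
  have h := Finset.sum_mul_sq_le_sq_mul_sq H.edges (fun e => √(H.prob e) * ∑ v ∈ e, f v)
    (fun e => √(H.prob e) * ∑ v ∈ e, g v)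
  have h1 : ∀ (a b : V → ℝ), ∑ e ∈ H.edges, √(H.prob e) * (∑ v ∈ e, a v) *
      (√(H.prob e) * ∑ v ∈ e, b v) =
      ∑ e ∈ H.edges, H.prob e * ((∑ v ∈ e, a v) * ∑ v ∈ e, b v) := by
    intro a b
    refine Finset.sum_congr rfl fun e he => ?_
    rw [mul_mul_mul_comm, Real.mul_self_sqrt (H.prob_pos e he).le]
  simp only [sq (√(H.prob _) * _), h1] at h
  rw [mul_pow]
  have h2 : (0 : ℝ) ≤ (1 / k) ^ 2 := by positivity
  nlinarith [mul_le_mul_of_nonneg_left h h2]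

theorem ip_walk_self_nonneg (H : WeightedHypergraph V k) (hk : 0 < k) (f : V → ℝ) :
    0 ≤ H.ip (H.walk f) f := by
  rw [H.ip_walk hk]
  have : 0 ≤ ∑ e ∈ H.edges, H.prob e * ((∑ v ∈ e, f v) * ∑ v ∈ e, f v) :=
    Finset.sum_nonneg fun e he => mul_nonneg (H.prob_pos e he).le (mul_self_nonneg _)
  positivity

theorem ip_iterate (H : WeightedHypergraph V k) (hk : 0 < k) (f g : V → ℝ) (i : ℕ) :
    H.ip (H.walk^[i] f) g = H.ip f (H.walk^[i] g) := by
  induction i generalizing f g with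
  | zero => rfl
  | succ i ih =>
    rw [Function.iterate_succ_apply', H.ip_walk_comm hk, ih, ← Function.iterate_succ_apply]

theorem moment_nonneg (H : WeightedHypergraph V k) (hk : 0 < k) (f : V → ℝ) (i : ℕ) :
    0 ≤ H.ip (H.walk^[i] f) f := by
  obtain ⟨s, rfl | rfl⟩ := i.even_or_odd'
  · rw [two_mul, Function.iterate_add_apply, H.ip_iterate hk]
    exact H.ip_self_nonneg _
  · rw [two_mul, add_assoc, Function.iterate_add_apply, H.ip_iterate hk,
      Function.iterate_succ_apply']
    exact H.ip_walk_self_nonneg hk _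

/-- Share the iterates between both arguments. Then the claim is Cauchy–Schwarz for the inner
product if `i` is even, and for the positive semidefinite form of the walk if `i` is odd. -/
theorem moment_log_convex (H : WeightedHypergraph V k) (hk : 0 < k) (f : V → ℝ) (i : ℕ) :
    H.ip (H.walk^[i + 1] f) f ^ 2 ≤ H.ip (H.walk^[i] f) f * H.ip (H.walk^[i + 2] f) f := by
  obtain ⟨s, rfl | rfl⟩ := i.even_or_odd'
  · have h1 : H.ip (H.walk^[2 * s + 1] f) f = H.ip (H.walk^[s] f) (H.walk^[s + 1] f) := by
      rw [show 2 * s + 1 = (s + 1) + s by ring, Function.iterate_add_apply, H.ip_iterate hk]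
    have h2 : H.ip (H.walk^[2 * s] f) f = H.ip (H.walk^[s] f) (H.walk^[s] f) := by
      rw [show 2 * s = s + s by ring, Function.iterate_add_apply, H.ip_iterate hk]
    have h3 : H.ip (H.walk^[2 * s + 2] f) f = H.ip (H.walk^[s + 1] f) (H.walk^[s + 1] f) := by
      rw [show 2 * s + 2 = (s + 1) + (s + 1) by ring, Function.iterate_add_apply, H.ip_iterate hk]
    rw [h1, h2, h3]
    exact H.ip_sq_le _ _
  · have h1 : H.ip (H.walk^[2 * s + 1 + 1] f) f =
        H.ip (H.walk (H.walk^[s] f)) (H.walk^[s + 1] f) := by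
      rw [show 2 * s + 1 + 1 = (s + 1) + (s + 1) by ring, Function.iterate_add_apply,
        H.ip_iterate hk, ← Function.iterate_succ_apply' (H.walk) s]
    have h2 : H.ip (H.walk^[2 * s + 1] f) f = H.ip (H.walk (H.walk^[s] f)) (H.walk^[s] f) := by
      rw [show 2 * s + 1 = s + (s + 1) by ring, Function.iterate_add_apply, H.ip_iterate hk,
        ← Function.iterate_succ_apply' (H.walk) s]
    have h3 : H.ip (H.walk^[2 * s + 1 + 2] f) f =
        H.ip (H.walk (H.walk^[s + 1] f)) (H.walk^[s + 1] f) := by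
      rw [show 2 * s + 1 + 2 = (s + 1) + ((s + 1) + 1) by ring, Function.iterate_add_apply,
        H.ip_iterate hk, ← Function.iterate_succ_apply' (H.walk) (s + 1)]
    rw [h1, h2, h3]
    exact H.ip_walk_sq_le hk _ _

/-- Isolated vertices are the reason for this: `walk` is zero there by division by zero, so
constants are preserved only at vertices of non-zero degree. The values at isolated vertices are
never read and carry no weight in `ip`. -/
theorem walk_congr (H : WeightedHypergraph V k) {f g : V → ℝ} (h : ∀ u, H.deg u ≠ 0 → f u = g u) :
    H.walk f = H.walk g := by
  funext u
  unfold walk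
  congr 1
  refine Finset.sum_congr rfl fun e he => ?_
  rw [Finset.mem_filter] at he
  congr 1
  exact Finset.sum_congr rfl fun w hw => h w (H.deg_pos he.1 hw).ne'

theorem walk_sub_const (H : WeightedHypergraph V k) (hk : 0 < k) (f : V → ℝ) (c : ℝ) {u : V}
    (hu : H.deg u ≠ 0) : H.walk (fun v => f v - c) u = H.walk f u - c := by
  have hk' : (k : ℝ) ≠ 0 := by exact_mod_cast hk.ne'
  unfold walk
  have h1 : ∀ e ∈ H.edges.filter (fun e => u ∈ e), H.prob e * ∑ w ∈ e, (f w - c) =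
      H.prob e * ∑ w ∈ e, f w - (k * c) * H.prob e := by
    intro e he
    rw [Finset.sum_sub_distrib, Finset.sum_const, H.card_edge e (Finset.mem_filter.1 he).1,
      nsmul_eq_mul]
    ring
  rw [Finset.sum_congr rfl h1, Finset.sum_sub_distrib, ← Finset.mul_sum]
  change (_ - k * c * H.deg u) / (k * H.deg u) = _
  field_simp

theorem iterate_walk_sub_const (H : WeightedHypergraph V k) (hk : 0 < k) (f : V → ℝ) (c : ℝ)
    (t : ℕ) {u : V} (hu : H.deg u ≠ 0) :
    H.walk^[t] (fun v => f v - c) u = H.walk^[t] f u - c := by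
  induction t generalizing u with
  | zero => rfl
  | succ t ih =>
    rw [Function.iterate_succ_apply', Function.iterate_succ_apply',
      H.walk_congr (g := fun v => H.walk^[t] f v - c) (fun v hv => ih hv),
      H.walk_sub_const hk _ _ hu]

theorem ip_congr (H : WeightedHypergraph V k) {f g f' g' : V → ℝ}
    (hf : ∀ u, H.deg u ≠ 0 → f u = f' u) (hg : ∀ u, H.deg u ≠ 0 → g u = g' u) :
    H.ip f g = H.ip f' g' := by
  refine Finset.sum_congr rfl fun u _ => ?_
  by_cases hu : H.deg u = 0
  · simp [hu]
  · rw [hf u hu, hg u hu]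

/-- Power iteration from some vertex finds a function of Rayleigh quotient at most twice the
spectral gap. -/
theorem power_iteration (H : WeightedHypergraph V k) (hk : 0 < k) (ψ : V → ℝ) (γ : ℝ)
    (hpos : 0 < H.ip ψ ψ) (hψ : ∑ v, H.deg v * ψ v = 0)
    (hen : ∀ g, H.energy ψ g = γ * H.ip ψ g) (hγ0 : 0 < γ) (hγ : γ < 1 / 2) (T : ℕ)
    (hT : Fintype.card V ≤ 2 * T * γ) :
    ∃ v c, ∑ u, H.deg u * (H.walk^[T] (Pi.single v 1) u - c) = 0 ∧
      0 < H.ip (fun u => H.walk^[T] (Pi.single v 1) u - c)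
        (fun u => H.walk^[T] (Pi.single v 1) u - c) ∧
      H.energy (fun u => H.walk^[T] (Pi.single v 1) u - c)
        (fun u => H.walk^[T] (Pi.single v 1) u - c) ≤
      2 * γ * H.ip (fun u => H.walk^[T] (Pi.single v 1) u - c)
        (fun u => H.walk^[T] (Pi.single v 1) u - c) := by
  have hk' : (0 : ℝ) < k := by exact_mod_cast hk
  -- A vertex that carries at least the average share of the norm of `ψ` is a start with sufficient
  -- overlap.
  obtain ⟨v, hv⟩ : ∃ v, H.ip ψ ψ ≤ Fintype.card V * (H.deg v * (ψ v * ψ v)) := by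
    by_contra! h
    have hne : Nonempty V := by
      by_contra hne
      rw [not_nonempty_iff] at hne
      simp [ip] at hpos
    have h1 : ∑ v, Fintype.card V * (H.deg v * (ψ v * ψ v)) < ∑ _v : V, H.ip ψ ψ :=
      Finset.sum_lt_sum_of_nonempty Finset.univ_nonempty fun v _ => h v
    rw [← Finset.mul_sum, Finset.sum_const, Finset.card_univ, nsmul_eq_mul] at h1
    exact lt_irrefl _ h1
  have hn : (0 : ℝ) < Fintype.card V := by
    exact_mod_cast Fintype.card_pos_iff.2 ⟨v⟩
  -- The weighted mean of the indicator of `v`, as the total volume is `k`.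
  set c := H.deg v / k with hc
  set f₀ : V → ℝ := fun u => (Pi.single v 1 : V → ℝ) u - c with hf₀
  set x := H.walk^[T] f₀ with hx
  have hxg : ∀ u, H.deg u ≠ 0 → H.walk^[T] (Pi.single v 1) u - c = x u := fun u hu =>
    (H.iterate_walk_sub_const hk _ _ T hu).symm
  have hone : ∀ f, H.ip (H.walk f) (fun _ => 1) = H.ip f (fun _ => 1) := by
    intro f
    have h1 := H.energy_one hk f
    rw [H.energy_eq hk] at h1
    linarith
  have hone' : H.ip x (fun _ => 1) = 0 := by
    have h1 : ∀ t, H.ip (H.walk^[t] f₀) (fun _ => 1) = H.ip f₀ (fun _ => 1) := by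
      intro t
      induction t with
      | zero => rfl
      | succ t ih => rw [Function.iterate_succ_apply', hone, ih]
    rw [hx, h1, ip_one, hf₀]
    simp only [mul_sub, Finset.sum_sub_distrib, ← Finset.sum_mul]
    have h2 := H.vol_univ
    rw [vol] at h2
    rw [h2, hc]
    simp [Pi.single_apply]
    field_simp
    ring
  have hipx : H.ip x ψ = (1 - γ) ^ T * (H.deg v * ψ v) := by
    have h1 : ∀ t, H.ip (H.walk^[t] f₀) ψ = (1 - γ) ^ t * H.ip f₀ ψ := by
      intro t
      induction t with
      | zero => simp
      | succ t ih =>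
        have h2 := hen (H.walk^[t] f₀)
        rw [H.energy_eq hk, H.ip_walk_comm hk, H.ip_comm ψ, H.ip_comm ψ] at h2
        rw [Function.iterate_succ_apply', pow_succ]
        linear_combination (1 - γ) * ih - h2
    rw [hx, h1]
    congr 1
    have h3 : H.ip f₀ ψ = ∑ u, H.deg u * ((Pi.single v 1 : V → ℝ) u * ψ u) -
        c * ∑ u, H.deg u * ψ u := by
      rw [Finset.mul_sum, ← Finset.sum_sub_distrib]
      exact Finset.sum_congr rfl fun u _ => by rw [hf₀]; ring
    rw [h3, hψ]
    simp [Pi.single_apply]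
  have hdv : 0 < H.deg v := by
    refine lt_of_le_of_ne (H.deg_nonneg v) fun h0 => ?_
    rw [← h0] at hv
    linarith
  -- Cauchy–Schwarz against `ψ`: the component of the iterate along `ψ` decays only like `(1 -
  -- γ)^T`.
  have hxx : (1 - γ) ^ (2 * T) * H.deg v ≤ Fintype.card V * H.ip x x := by
    have h1 := H.ip_sq_le x ψ
    rw [hipx] at h1
    refine le_of_mul_le_mul_right ?_ hpos
    calc (1 - γ) ^ (2 * T) * H.deg v * H.ip ψ ψ
        ≤ (1 - γ) ^ (2 * T) * H.deg v * (Fintype.card V * (H.deg v * (ψ v * ψ v))) := by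
          apply mul_le_mul_of_nonneg_left hv
          have : 0 < 1 - γ := by linarith
          positivity
      _ = Fintype.card V * ((1 - γ) ^ T * (H.deg v * ψ v)) ^ 2 := by ring
      _ ≤ Fintype.card V * (H.ip x x * H.ip ψ ψ) := mul_le_mul_of_nonneg_left h1 hn.le
      _ = _ := by ring
  have hxpos : 0 < H.ip x x := by
    have h1 : 0 < (1 - γ) ^ (2 * T) * H.deg v := by
      have : 0 < 1 - γ := by linarith
      positivity
    by_contra! h
    nlinarith
  have hf₀f₀ : H.ip f₀ f₀ ≤ H.deg v := by
    have h3 : H.ip f₀ f₀ = ∑ u, H.deg u * ((Pi.single v 1 : V → ℝ) u * (Pi.single v 1 : V → ℝ) u) -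
        2 * c * ∑ u, H.deg u * (Pi.single v 1 : V → ℝ) u + c ^ 2 * H.vol Finset.univ := by
      rw [Finset.mul_sum, vol, Finset.mul_sum, ← Finset.sum_sub_distrib, ← Finset.sum_add_distrib]
      exact Finset.sum_congr rfl fun u _ => by rw [hf₀]; ring
    rw [h3, vol_univ]
    simp only [Pi.single_apply, mul_ite, mul_one, mul_zero, Finset.sum_ite_eq',
      Finset.mem_univ, if_true]
    have h4 : c ^ 2 * k = c * H.deg v := by
      rw [hc]
      field_simp
    have h5 : 0 ≤ c := by positivity
    nlinarith
  have hmain : H.energy x x ≤ 2 * γ * H.ip x x := by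
    -- A larger Rayleigh quotient means that the last ratio of moments is below `1 - 2γ`. By
    -- log-convexity the norm then decayed at that rate throughout, faster than the `ψ`-component
    -- allows.
    by_contra! hlt
    have h1 := le_pow_mul_of_sq_le (a := fun i => H.ip (H.walk^[i] f₀) f₀) (ρ := 1 - 2 * γ)
      (N := 2 * T) (H.moment_nonneg hk f₀) (H.moment_log_convex hk f₀) (by
        simp only [two_mul, Function.iterate_add_apply]
        rw [H.ip_iterate hk]
        exact hxpos) (by
        have e1 : H.ip (H.walk^[2 * T + 1] f₀) f₀ = H.ip (H.walk x) x := by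
          rw [show 2 * T + 1 = T + (T + 1) by ring, Function.iterate_add_apply, H.ip_iterate hk,
            Function.iterate_succ_apply']
        have e2 : H.ip (H.walk^[2 * T] f₀) f₀ = H.ip x x := by
          rw [show 2 * T = T + T by ring, Function.iterate_add_apply, H.ip_iterate hk]
        simp only [e1, e2]
        rw [H.energy_eq hk] at hlt
        linarith)
    have e2 : H.ip (H.walk^[2 * T] f₀) f₀ = H.ip x x := by
      rw [show 2 * T = T + T by ring, Function.iterate_add_apply, H.ip_iterate hk]
    simp only [e2, Function.iterate_zero, id] at h1
    have hρ : 0 < 1 - 2 * γ := by linarith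
    -- Comparing both rates leaves `(1 + γ)^(2T) ≤ n`, whereas Bernoulli's inequality gives at least
    -- `1 + 2Tγ > n`.
    have h2 : ((1 - 2 * γ) * (1 + γ)) ^ (2 * T) ≤ (1 - γ) ^ (2 * T) :=
      pow_le_pow_left₀ (by positivity) (by nlinarith) _
    have h3 : (1 - 2 * γ) ^ (2 * T) * (1 + γ) ^ (2 * T) * H.deg v ≤
        (1 - 2 * γ) ^ (2 * T) * Fintype.card V * H.deg v := by
      rw [← mul_pow]
      calc _ ≤ (1 - γ) ^ (2 * T) * H.deg v := mul_le_mul_of_nonneg_right h2 hdv.le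
        _ ≤ Fintype.card V * H.ip x x := hxx
        _ ≤ Fintype.card V * ((1 - 2 * γ) ^ (2 * T) * H.ip f₀ f₀) :=
          mul_le_mul_of_nonneg_left h1 hn.le
        _ ≤ Fintype.card V * ((1 - 2 * γ) ^ (2 * T) * H.deg v) := by gcongr
        _ = _ := by ring
    have h4 := le_of_mul_le_mul_left (le_of_mul_le_mul_right h3 hdv) (by positivity)
    have h5 := one_add_mul_le_pow (show (-2 : ℝ) ≤ γ by linarith) (2 * T)
    push_cast at h5
    linarith
  refine ⟨v, c, ?_, ?_, ?_⟩
  · rw [← ip_one, H.ip_congr hxg (fun _ _ => rfl), hone']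
  · rw [H.ip_congr hxg hxg]
    exact hxpos
  · have h1 : H.energy (fun u => H.walk^[T] (Pi.single v 1) u - c)
        (fun u => H.walk^[T] (Pi.single v 1) u - c) = H.energy x x := by
      rw [H.energy_eq hk, H.energy_eq hk, H.walk_congr hxg, H.ip_congr hxg hxg,
        H.ip_congr (fun _ _ => rfl) hxg]
    rw [h1, H.ip_congr hxg hxg]
    exact hmain

/-! ### Components above a hyperedge, and why the two families of candidates suffice -/

/-- The vertex set `S` is closed under the hyperedges that are heavier than `e₀`. -/
def IsClosedAbove (H : WeightedHypergraph V k) (e₀ S : Finset V) : Prop :=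
  ∀ e ∈ H.edges, H.prob e₀ < H.prob e → (e ∩ S).Nonempty → e ⊆ S

/-- The vertex set `S` is the least one that contains `v` and is closed under the hyperedges that
are heavier than `e₀`. -/
def IsComponent (H : WeightedHypergraph V k) (e₀ : Finset V) (v : V) (S : Finset V) : Prop :=
  v ∈ S ∧ H.IsClosedAbove e₀ S ∧ ∀ S', v ∈ S' → H.IsClosedAbove e₀ S' → S ⊆ S'

theorem isComponent_singleton (H : WeightedHypergraph V k) {e₀ : Finset V}
    (h : ∀ e ∈ H.edges, H.prob e ≤ H.prob e₀) (v : V) : H.IsComponent e₀ v {v} :=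
  ⟨Finset.mem_singleton_self v, fun e he hlt => absurd hlt (not_lt.2 (h e he)),
    fun _ hv _ => Finset.singleton_subset_iff.2 hv⟩

/-- Take `e₀` heaviest in the boundary of `S₀` and `v` of largest degree in `S₀`. No hyperedge
heavier than `e₀` crosses `S₀`, so the component stays inside `S₀`. Hyperedges crossing the
component are no heavier than `e₀`, which loses a factor of at most the number of hyperedges in the
cut; the degree of `v` alone is at least `vol S₀ / n`. -/
theorem exists_component_expansion_le (H : WeightedHypergraph V k) {S₀ : Finset V}
    (hS₀ : H.IsAdmissible S₀) (hpos : 0 < H.expansion S₀) :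
    ∃ e₀ ∈ H.edges, ∃ v, ∀ S, H.IsComponent e₀ v S →
      H.IsAdmissible S ∧ H.expansion S ≤ H.edges.card * Fintype.card V * H.expansion S₀ := by
  have hne : (H.boundary S₀).Nonempty := by
    by_contra h
    rw [Finset.not_nonempty_iff_eq_empty] at h
    simp [expansion, h] at hpos
  obtain ⟨e₀, he₀, hmax⟩ := Finset.exists_max_image _ H.prob hne
  have hne' : S₀.Nonempty := by
    by_contra h
    rw [Finset.not_nonempty_iff_eq_empty] at h
    have := hS₀.1
    simp [vol, h] at this
  obtain ⟨v, hv, hvmax⟩ := Finset.exists_max_image S₀ H.deg hne'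
  have he₀' : e₀ ∈ H.edges := (Finset.mem_filter.1 he₀).1
  refine ⟨e₀, he₀', v, ?_⟩
  rintro S ⟨hvS, hcl, hleast⟩
  have hSS : S ⊆ S₀ := by
    apply hleast S₀ hv
    intro e he hlt hmeet
    by_contra hns
    have : e ∈ H.boundary S₀ :=
      Finset.mem_filter.2 ⟨he, hmeet, Finset.sdiff_nonempty.2 hns⟩
    exact absurd (hmax e this) (not_le.2 hlt)
  have hvol : H.vol S₀ ≤ Fintype.card V * H.deg v := by
    calc H.vol S₀ ≤ ∑ _u ∈ S₀, H.deg v := Finset.sum_le_sum hvmax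
      _ = S₀.card * H.deg v := by rw [Finset.sum_const, nsmul_eq_mul]
      _ ≤ _ := by
        apply mul_le_mul_of_nonneg_right _ (H.deg_nonneg v)
        exact_mod_cast Finset.card_le_univ S₀
  have hdS : H.deg v ≤ H.vol S :=
    Finset.single_le_sum (f := H.deg) (fun u _ => H.deg_nonneg u) hvS
  have hdpos : 0 < H.deg v := by
    have := hS₀.1
    by_contra! h
    have h2 : (Fintype.card V : ℝ) * H.deg v ≤ 0 :=
      mul_nonpos_of_nonneg_of_nonpos (by positivity) h
    linarith
  have hSpos : 0 < H.vol S := hdpos.trans_le hdS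
  have hcut : H.cut S ≤ H.edges.card * H.cut S₀ := by
    have h1 : H.prob e₀ ≤ H.cut S₀ :=
      Finset.single_le_sum (f := H.prob)
        (fun e he => (H.prob_pos e (Finset.mem_filter.1 he).1).le) he₀
    calc H.cut S ≤ ∑ _e ∈ H.boundary S, H.prob e₀ := by
          apply Finset.sum_le_sum
          intro e he
          obtain ⟨he, hmeet, hns⟩ := Finset.mem_filter.1 he
          by_contra! hlt
          exact Finset.sdiff_nonempty.1 hns (hcl e he hlt hmeet)
      _ = (H.boundary S).card * H.prob e₀ := by rw [Finset.sum_const, nsmul_eq_mul]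
      _ ≤ H.edges.card * H.cut S₀ := by
        have h2 : ((H.boundary S).card : ℝ) ≤ H.edges.card := by
          exact_mod_cast Finset.card_le_card (Finset.filter_subset _ _)
        have := (H.prob_pos e₀ he₀').le
        gcongr
  refine ⟨⟨hSpos, (H.vol_mono hSS).trans hS₀.2⟩, ?_⟩
  rw [expansion, div_le_iff₀ hSpos]
  have h3 : H.cut S₀ = H.expansion S₀ * H.vol S₀ := by
    rw [expansion, div_mul_cancel₀ _ hS₀.1.ne', cut]
  calc H.cut S ≤ H.edges.card * (H.expansion S₀ * H.vol S₀) := by rw [← h3]; exact hcut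
    _ ≤ H.edges.card * (H.expansion S₀ * (Fintype.card V * H.vol S)) := by
      have : H.vol S₀ ≤ Fintype.card V * H.vol S :=
        hvol.trans (mul_le_mul_of_nonneg_left hdS (by positivity))
      gcongr
    _ = _ := by ring

/-- A vertex set at least as good as all components above a hyperedge and all sweep cuts of the
power iteration satisfies the Cheeger bound. -/
theorem expansion_le_of_candidates (H : WeightedHypergraph V k) (l : ℕ) (ε : ℝ) (hl : 2 ≤ l)
    (hlk : l ≤ k) (hε : 0 < ε)
    (h : secondEigenvalue (H.upDownWalk 1 (l - 1)) = 1 - ε ∨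
        secondEigenvalue (H.bipartiteWalk 1 (l - 1)) = 1 - ε) (T : ℕ)
    (hT : Fintype.card V ^ 5 * H.edges.card ^ 2 ≤ T) (A : Finset V)
    (hcomp : ∀ e₀ ∈ H.edges, ∀ v, ∃ S, H.IsComponent e₀ v S ∧
      (H.IsAdmissible S → H.IsAdmissible A ∧ H.expansion A ≤ H.expansion S))
    (hup : ∀ v w, H.IsAdmissible (Finset.univ.filter fun u =>
        H.walk^[T] (Pi.single v 1) w ≤ H.walk^[T] (Pi.single v 1) u) →
      H.expansion A ≤ H.expansion (Finset.univ.filter fun u =>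
        H.walk^[T] (Pi.single v 1) w ≤ H.walk^[T] (Pi.single v 1) u))
    (hdown : ∀ v w, H.IsAdmissible (Finset.univ.filter fun u =>
        H.walk^[T] (Pi.single v 1) u ≤ H.walk^[T] (Pi.single v 1) w) →
      H.expansion A ≤ H.expansion (Finset.univ.filter fun u =>
        H.walk^[T] (Pi.single v 1) u ≤ H.walk^[T] (Pi.single v 1) w)) :
    H.IsAdmissible A ∧ H.expansion A ≤ 4 * √ε := by
  obtain ⟨ha, hb⟩ := H.energy_of_secondEigenvalue l ε hl hlk hε h
  have hk : 2 ≤ k := hl.trans hlk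
  have hk2 : (2 : ℝ) ≤ k := by exact_mod_cast hk
  have hk1 : (0 : ℝ) < k - 1 := by linarith
  constructor
  -- Above a heaviest hyperedge all components are singletons, and a vertex of that hyperedge is
  -- admissible because `k ≥ 2`. So there is always an admissible candidate.
  · obtain ⟨e₀, he₀, hmax⟩ := Finset.exists_max_image _ H.prob H.edges_nonempty
    have : e₀.Nonempty := by
      rw [← Finset.card_pos, H.card_edge e₀ he₀]
      omega
    obtain ⟨v, hv⟩ := this
    obtain ⟨S, hS, hadm⟩ := hcomp e₀ he₀ v
    have hS' : S = {v} := by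
      have h1 := H.isComponent_singleton hmax v
      exact (hS.2.2 _ h1.1 h1.2.1).antisymm (h1.2.2 _ hS.1 hS.2.1)
    exact (hadm (hS' ▸ H.isAdmissible_singleton hk he₀ hv)).1
  · by_cases hε1 : 1 / 16 ≤ ε
    · have h1 : 1 / 4 ≤ √ε := by
        apply Real.le_sqrt_of_sq_le
        linarith
      linarith [H.expansion_le_one A]
    push Not at hε1
    rcases hb with hb | ⟨ψ, γ, hpos, hψ, hen, hγ⟩
    · linarith
    have hγ4 : γ < 1 / 4 := by nlinarith
    have hγε : ε ≤ γ := by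
      have := ha ψ hψ
      rw [hen] at this
      exact le_of_mul_le_mul_right this hpos
    have hγ0 : 0 < γ := hε.trans_le hγε
    have hA0 := H.expansion_nonneg A
    suffices hsq : H.expansion A ^ 2 ≤ (4 * √ε) ^ 2 from le_of_sq_le_sq hsq (by positivity)
    rw [mul_pow, Real.sq_sqrt hε.le]
    refine le_of_mul_le_mul_left ?_ hk1
    have hV : Nonempty V := by
      by_contra hne
      rw [not_nonempty_iff] at hne
      simp [ip] at hpos
    have hn : (0 : ℝ) < Fintype.card V := by
      exact_mod_cast Fintype.card_pos
    have hm : (0 : ℝ) < H.edges.card := by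
      exact_mod_cast H.edges_nonempty.card_pos
    set n : ℝ := (Fintype.card V : ℝ) with hn'
    set m : ℝ := (H.edges.card : ℝ) with hm'
    classical
    -- The threshold balances the two families. For `γ ≤ 1/(m²n⁴)` the loss `mn²` of the component
    -- bound is absorbed: `((k-1)φ)² ≤ (m²n⁴γ) k (kγ) ≤ 4εk(k-1)`.
    by_cases hsmall : m ^ 2 * n ^ 4 * γ ≤ 1
    · obtain ⟨S₀, hS₀, hmin⟩ := Finset.exists_min_image
        (Finset.univ.filter fun S => H.IsAdmissible S) H.expansion (by
          obtain ⟨S, hS⟩ := H.exists_isAdmissible hk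
          exact ⟨S, by simpa using hS⟩)
      simp only [Finset.mem_filter, Finset.mem_univ, true_and] at hS₀ hmin
      have hφ0 : 0 < H.expansion S₀ :=
        lt_of_lt_of_le (by positivity) (H.le_expansion hk ha hε.le hS₀)
      have h1 := H.linear_cheeger hk ψ γ (H.expansion S₀) hψ hpos (hen ψ).le hmin
      obtain ⟨e₀, he₀, v, hev⟩ := H.exists_component_expansion_le hS₀ hφ0
      obtain ⟨S, hS, hSA⟩ := hcomp e₀ he₀ v
      obtain ⟨hSadm, hSexp⟩ := hev S hS
      have h2 : H.expansion A ≤ m * n * H.expansion S₀ := (hSA hSadm).2.trans hSexp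
      have h3 : (k - 1) * H.expansion A ≤ m * n ^ 2 * (k * γ) := by
        calc (k - 1) * H.expansion A ≤ (k - 1) * (m * n * H.expansion S₀) :=
              mul_le_mul_of_nonneg_left h2 hk1.le
          _ = m * n * ((k - 1) * H.expansion S₀) := by ring
          _ ≤ m * n * (n * k * γ) := mul_le_mul_of_nonneg_left h1 (by positivity)
          _ = _ := by ring
      have h4 : ((k - 1) * H.expansion A) ^ 2 ≤ (m * n ^ 2 * (k * γ)) ^ 2 :=
        pow_le_pow_left₀ (mul_nonneg hk1.le hA0) h3 2
      have h5 : (m * n ^ 2 * (k * γ)) ^ 2 ≤ (k - 1) * (k * (4 * ε)) := by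
        calc (m * n ^ 2 * (k * γ)) ^ 2 = (m ^ 2 * n ^ 4 * γ) * (k * (k * γ)) := by ring
          _ ≤ 1 * (k * (k * γ)) := by gcongr
          _ ≤ 1 * (k * (4 * ε * (k - 1))) := by gcongr
          _ = _ := by ring
      have h6 : (k - 1) * ((k - 1) * H.expansion A ^ 2) ≤ (k - 1) * (k * (4 * ε)) := by
        nlinarith
      have h7 := le_of_mul_le_mul_left h6 hk1
      nlinarith
    -- Otherwise `γ > 1/(m²n⁴)`, and `T ≥ n⁵m²` steps give `Tγ ≥ n`, independently of the size of
    -- the weights.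
    · push Not at hsmall
      have hTn : n ≤ 2 * T * γ := by
        have h1 : n ^ 5 * m ^ 2 ≤ T := by
          rw [hn', hm']
          exact_mod_cast hT
        have h2 : n ^ 5 * m ^ 2 * γ ≤ T * γ := mul_le_mul_of_nonneg_right h1 hγ0.le
        nlinarith
      obtain ⟨v, c, hc1, hc2, hc3⟩ := H.power_iteration (by omega) ψ γ hpos hψ hen hγ0
        (by linarith) T hTn
      -- Here the constant 4 is used up: `φ² ≤ 2k(2γ)/(k-1) ≤ 16ε`.
      have h1 := H.sweep hk _ (2 * γ) (H.expansion A) hc1 hc2 hc3 hA0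
        (fun w => by simpa only [sub_le_sub_iff_right] using hup v w)
        (fun w => by simpa only [sub_le_sub_iff_right] using hdown v w)
      nlinarith

end WeightedHypergraph

/-! ### A language of bounded loops over arithmetic expressions -/

/-- Arithmetic expressions over registers and arrays; `pos a` is the indicator of `0 < a`. -/
inductive Ex where
  | lit (c : ℤ)
  | reg (r : ℕ)
  | add (a b : Ex)
  | sub (a b : Ex)
  | mul (a b : Ex)
  | div (a b : Ex)
  | get (A : ℕ) (a : Ex)
  | pos (a : Ex)

namespace Ex

/-- The value of an expression in a state. -/
def val : Ex → State → ℤ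
  | lit c, _ => c
  | reg r, s => s.reg r
  | add a b, s => a.val s + b.val s
  | sub a b, s => a.val s - b.val s
  | mul a b, s => a.val s * b.val s
  | div a b, s => a.val s / b.val s
  | get A a, s => s.mem A (a.val s).toNat
  | pos a, s => if 0 < a.val s then 1 else 0

/-- A program that computes the value of an expression in register `d`. -/
def code : Ex → ℕ → Prog
  | lit c, d => .instr (.const d c)
  | reg r, d => .seq (.instr (.const d 0)) (.instr (.add d r d))
  | add a b, d => .seq (a.code d) (.seq (b.code (d + 1)) (.instr (.add d d (d + 1))))
  | sub a b, d => .seq (a.code d) (.seq (b.code (d + 1)) (.instr (.sub d d (d + 1))))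
  | mul a b, d => .seq (a.code d) (.seq (b.code (d + 1)) (.instr (.mul d d (d + 1))))
  | div a b, d => .seq (a.code d) (.seq (b.code (d + 1)) (.instr (.div d d (d + 1))))
  | get A a, d => .seq (a.code d) (.instr (.load d A d))
  | pos a, d => .seq (a.code d) (.ifPos d (.instr (.const d 1)) (.instr (.const d 0)))

/-- All registers of the expression are below `d`. -/
def Below (d : ℕ) : Ex → Prop
  | lit _ => True
  | reg r => r < d
  | add a b | sub a b | mul a b | div a b => a.Below d ∧ b.Below d
  | get _ a | pos a => a.Below d

/-- A factor for the bit length of the value. -/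
def width : Ex → ℕ
  | lit c => bitLength c
  | reg _ => 1
  | add a b | sub a b => a.width + b.width + 1
  | mul a b => a.width + b.width
  | div a _ => a.width
  | get _ _ => 1
  | pos _ => 1

/-- A factor for the time to compute the value. -/
def time : Ex → ℕ
  | lit c => 1 + bitLength c
  | reg _ => 2
  | add a b | sub a b => a.time + b.time + (1 + a.width + b.width)
  | mul a b | div a b => a.time + b.time + (1 + a.width) * (1 + b.width)
  | get _ a => a.time + (a.width + 2)
  | pos a => a.time + (a.width + 3)

end Ex

/-- The low registers and the arrays of the two states agree. -/
def Agree (d : ℕ) (s σ : State) : Prop :=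
  (∀ r < d, s.reg r = σ.reg r) ∧ s.mem = σ.mem

theorem Agree.mono {d d' : ℕ} {s σ : State} (h : Agree d s σ) (hd : d' ≤ d) : Agree d' s σ :=
  ⟨fun r hr => h.1 r (hr.trans_le hd), h.2⟩

theorem Agree.trans {d : ℕ} {s σ τ : State} (h : Agree d s σ) (h' : Agree d σ τ) : Agree d s τ :=
  ⟨fun r hr => (h.1 r hr).trans (h'.1 r hr), h.2.trans h'.2⟩

/-- The low registers and the arrays hold integers of bit length at most `b`. -/
def Bounded (d b : ℕ) (s : State) : Prop :=
  (∀ r < d, bitLength (s.reg r) ≤ b) ∧ ∀ A i, bitLength (s.mem A i) ≤ b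

/-! ### Bit lengths and the cost of expressions -/

theorem bitLength_le_iff {z : ℤ} {b : ℕ} : bitLength z ≤ b ↔ z.natAbs < 2 ^ b :=
  Nat.size_le

theorem bitLength_mono {x y : ℤ} (h : x.natAbs ≤ y.natAbs) : bitLength x ≤ bitLength y :=
  Nat.size_le_size h

theorem bitLength_zero : bitLength 0 = 0 := rfl

theorem bitLength_one : bitLength 1 = 1 := Nat.size_one

theorem bitLength_add_le (x y : ℤ) : bitLength (x + y) ≤ bitLength x + bitLength y + 1 := by
  rw [bitLength_le_iff]
  have hx : x.natAbs < 2 ^ bitLength x := bitLength_le_iff.1 le_rfl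
  have hy : y.natAbs < 2 ^ bitLength y := bitLength_le_iff.1 le_rfl
  have h1 : 2 ^ bitLength x ≤ 2 ^ (bitLength x + bitLength y) :=
    Nat.pow_le_pow_right (by norm_num) (by omega)
  have h2 : 2 ^ bitLength y ≤ 2 ^ (bitLength x + bitLength y) :=
    Nat.pow_le_pow_right (by norm_num) (by omega)
  have h3 := Int.natAbs_add_le x y
  rw [pow_succ]
  omega

theorem bitLength_neg (x : ℤ) : bitLength (-x) = bitLength x := by
  simp [bitLength]

theorem bitLength_sub_le (x y : ℤ) : bitLength (x - y) ≤ bitLength x + bitLength y + 1 := by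
  rw [sub_eq_add_neg, ← bitLength_neg y]
  exact bitLength_add_le x (-y)

theorem bitLength_mul_le (x y : ℤ) : bitLength (x * y) ≤ bitLength x + bitLength y := by
  rw [bitLength_le_iff, Int.natAbs_mul, pow_add]
  exact Nat.mul_lt_mul'' (bitLength_le_iff.1 le_rfl) (bitLength_le_iff.1 le_rfl)

theorem bitLength_div_le (x y : ℤ) : bitLength (x / y) ≤ bitLength x :=
  bitLength_mono (Int.natAbs_ediv_le_natAbs x y)

/-- Intermediate values may exceed `b` bits, but only by a factor that depends on the expression
alone. The summand 1 in `b + 1` absorbs literals and carries. -/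
theorem Ex.bitLength_val_le {d b : ℕ} {s : State} (hs : Bounded d b s) (e : Ex) (he : e.Below d) :
    bitLength (e.val s) ≤ e.width * (b + 1) := by
  induction e with
  | lit c =>
    simp only [val, width]
    nlinarith
  | reg r =>
    have := hs.1 r he
    simp only [val, width]
    omega
  | add x y hx hy =>
    have h1 := hx he.1
    have h2 := hy he.2
    have h3 := bitLength_add_le (x.val s) (y.val s)
    simp only [val, width]
    nlinarith
  | sub x y hx hy =>
    have h1 := hx he.1
    have h2 := hy he.2
    have h3 := bitLength_sub_le (x.val s) (y.val s)
    simp only [val, width]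
    nlinarith
  | mul x y hx hy =>
    have h1 := hx he.1
    have h2 := hy he.2
    have h3 := bitLength_mul_le (x.val s) (y.val s)
    simp only [val, width]
    nlinarith
  | div x y hx hy => exact (bitLength_div_le _ _).trans (hx he.1)
  | get A x hx =>
    have := hs.2 A (x.val s).toNat
    simp only [val, width]
    omega
  | pos x hx =>
    simp only [val, width]
    split_ifs
    · rw [bitLength_one]
      omega
    · rw [bitLength_zero]
      omega

/-- The state with one register changed. -/
def State.setReg (s : State) (r : ℕ) (v : ℤ) : State := { s with reg := Function.update s.reg r v }

/-- The state with one array cell changed. -/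
def State.setMem (s : State) (A i : ℕ) (v : ℤ) : State :=
  { s with mem := Function.update s.mem A (Function.update (s.mem A) i v) }

@[simp] theorem State.setReg_reg (s : State) (r : ℕ) (v : ℤ) (r' : ℕ) :
    (s.setReg r v).reg r' = if r' = r then v else s.reg r' := by
  simp [setReg, Function.update_apply]

@[simp] theorem State.setReg_mem (s : State) (r : ℕ) (v : ℤ) : (s.setReg r v).mem = s.mem := rfl

@[simp] theorem State.setMem_reg (s : State) (A i : ℕ) (v : ℤ) : (s.setMem A i v).reg = s.reg := rfl

theorem State.setMem_mem (s : State) (A i : ℕ) (v : ℤ) (A' i' : ℕ) :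
    (s.setMem A i v).mem A' i' = if A' = A ∧ i' = i then v else s.mem A' i' := by
  by_cases h : A' = A
  · subst h
    simp [setMem, Function.update_apply]
  · simp [setMem, h]

theorem State.setMem_mem_of_ne (s : State) {A A' : ℕ} (i : ℕ) (v : ℤ) (h : A' ≠ A) :
    (s.setMem A i v).mem A' = s.mem A' := by
  simp [setMem, h]

theorem agree_setReg {d r : ℕ} (s : State) (v : ℤ) (h : d ≤ r) : Agree d (s.setReg r v) s :=
  ⟨fun r' hr' => by simp [(hr'.trans_le h).ne], rfl⟩

/-- Temporaries live at `d` and above, beyond all registers that the expression reads. The right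
operand is computed from `d + 1` on and so preserves the left one in `d`. The square comes from the
cost of multiplication and division. -/
theorem Ex.exec_code {d₀ b : ℕ} {σ : State} (hσ : Bounded d₀ b σ) (e : Ex) (he : e.Below d₀)
    (d : ℕ) (hd : d₀ ≤ d) (s : State) (hs : Agree d₀ s σ) :
    ∃ s' t, Exec (e.code d) s s' t ∧ Agree d s' s ∧ s'.reg d = e.val σ ∧
      t ≤ e.time * (b + 1) ^ 2 := by
  have hb : b + 1 ≤ (b + 1) ^ 2 := by nlinarith
  have hb1 : 1 ≤ (b + 1) ^ 2 := by nlinarith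
  have binary : ∀ (x y : Ex) (_ : x.Below d₀) (_ : y.Below d₀)
      (_ : ∀ d, d₀ ≤ d → ∀ s, Agree d₀ s σ → ∃ s' t, Exec (x.code d) s s' t ∧ Agree d s' s ∧
        s'.reg d = x.val σ ∧ t ≤ x.time * (b + 1) ^ 2)
      (_ : ∀ d, d₀ ≤ d → ∀ s, Agree d₀ s σ → ∃ s' t, Exec (y.code d) s s' t ∧ Agree d s' s ∧
        s'.reg d = y.val σ ∧ t ≤ y.time * (b + 1) ^ 2) (d : ℕ) (_ : d₀ ≤ d) (s : State)
      (_ : Agree d₀ s σ) (i : Instr) (f : ℤ → ℤ → ℤ) (q : ℕ)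
      (_ : ∀ s, i.eval s = s.setReg d (f (s.reg d) (s.reg (d + 1))))
      (_ : ∀ s : State, s.reg d = x.val σ → s.reg (d + 1) = y.val σ → i.cost s ≤ q * (b + 1) ^ 2),
      ∃ s' t, Exec (.seq (x.code d) (.seq (y.code (d + 1)) (.instr i))) s s' t ∧ Agree d s' s ∧
        s'.reg d = f (x.val σ) (y.val σ) ∧ t ≤ (x.time + y.time + q) * (b + 1) ^ 2 := by
    intro x y hxb hyb hx hy d hd s hs i f q hi hq
    obtain ⟨s₁, t₁, e₁, a₁, v₁, c₁⟩ := hx d hd s hs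
    have a₁' : Agree d₀ s₁ σ := (a₁.mono hd).trans hs
    obtain ⟨s₂, t₂, e₂, a₂, v₂, c₂⟩ := hy (d + 1) (by omega) s₁ a₁'
    have v₁' : s₂.reg d = x.val σ := (a₂.1 d (by omega)).trans v₁
    refine ⟨_, _, .seq e₁ (.seq e₂ (.instr i s₂)), ?_, ?_, ?_⟩
    · rw [hi]
      exact ((agree_setReg s₂ _ le_rfl).trans (a₂.mono (by omega))).trans a₁
    · rw [hi, State.setReg_reg, if_pos rfl, v₁', v₂]
    · have := hq s₂ v₁' v₂
      nlinarith
  induction e generalizing d s with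
  | lit c =>
    refine ⟨_, _, .instr _ s, agree_setReg s c le_rfl, ?_, ?_⟩
    · simp [Instr.eval, val]
    · simp only [Instr.cost, time]
      nlinarith
  | reg r =>
    refine ⟨_, _, .seq (.instr _ s) (.instr _ _),
      (agree_setReg _ _ le_rfl).trans (agree_setReg s 0 le_rfl), ?_, ?_⟩
    · have hr : r < d₀ := he
      have : r ≠ d := by omega
      simp [Instr.eval, val, this, hs.1 r hr]
    · have hr : r < d₀ := he
      have h1 : r ≠ d := by omega
      have h2 := hσ.1 r hr
      simp only [Instr.cost, time, Instr.eval, Function.update_apply, if_neg h1, hs.1 r hr,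
        if_true, bitLength_zero]
      nlinarith
  | add x y hx hy =>
    refine binary x y he.1 he.2 (hx he.1) (hy he.2) d hd s hs _ (· + ·) _ (fun _ => rfl) ?_
    intro s h1 h2
    simp only [Instr.cost, h1, h2]
    have h3 := bitLength_val_le hσ x he.1
    have h4 := bitLength_val_le hσ y he.2
    nlinarith
  | sub x y hx hy =>
    refine binary x y he.1 he.2 (hx he.1) (hy he.2) d hd s hs _ (· - ·) _ (fun _ => rfl) ?_
    intro s h1 h2
    simp only [Instr.cost, h1, h2]
    have h3 := bitLength_val_le hσ x he.1
    have h4 := bitLength_val_le hσ y he.2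
    nlinarith
  | mul x y hx hy =>
    refine binary x y he.1 he.2 (hx he.1) (hy he.2) d hd s hs _ (· * ·) _ (fun _ => rfl) ?_
    intro s h1 h2
    simp only [Instr.cost, h1, h2]
    have h3 := bitLength_val_le hσ x he.1
    have h4 := bitLength_val_le hσ y he.2
    calc _ ≤ ((1 + x.width) * (b + 1)) * ((1 + y.width) * (b + 1)) := by gcongr <;> nlinarith
      _ = _ := by ring
  | div x y hx hy =>
    refine binary x y he.1 he.2 (hx he.1) (hy he.2) d hd s hs _ (· / ·) _ (fun _ => rfl) ?_
    intro s h1 h2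
    simp only [Instr.cost, h1, h2]
    have h3 := bitLength_val_le hσ x he.1
    have h4 := bitLength_val_le hσ y he.2
    calc _ ≤ ((1 + x.width) * (b + 1)) * ((1 + y.width) * (b + 1)) := by gcongr <;> nlinarith
      _ = _ := by ring
  | get A x hx =>
    obtain ⟨s₁, t₁, e₁, a₁, v₁, c₁⟩ := hx he d hd s hs
    refine ⟨_, _, .seq e₁ (.instr _ s₁), (agree_setReg _ _ le_rfl).trans a₁, ?_, ?_⟩
    · simp [Instr.eval, val, v₁, a₁.2, hs.2]
    · have h3 := bitLength_val_le hσ x he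
      have h4 := hσ.2 A (x.val σ).toNat
      simp only [Instr.cost, time, v₁, a₁.2, hs.2]
      nlinarith
  | pos x hx =>
    obtain ⟨s₁, t₁, e₁, a₁, v₁, c₁⟩ := hx he d hd s hs
    have h3 := bitLength_val_le hσ x he
    by_cases hp : 0 < x.val σ
    · refine ⟨_, _, .seq e₁ (.ifTrue (by rw [v₁]; exact hp) (.instr _ s₁)),
        (agree_setReg _ _ le_rfl).trans a₁, ?_, ?_⟩
      · simp [Instr.eval, val, hp]
      · simp only [Instr.cost, time, v₁, bitLength_one]
        nlinarith
    · refine ⟨_, _, .seq e₁ (.ifFalse (by rw [v₁]; exact hp) (.instr _ s₁)),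
        (agree_setReg _ _ le_rfl).trans a₁, ?_, ?_⟩
      · simp [Instr.eval, val, hp]
      · simp only [Instr.cost, time, v₁, bitLength_zero]
        nlinarith

/-! ### Commands with bounded loops and their compilation -/

/-- Commands: assignments to registers and array cells, composition, and loops. The command
`loop i a c` performs `c` for the values `s.reg a - 1, …, 0` of register `i`. -/
inductive Cmd where
  | set (r : ℕ) (e : Ex)
  | put (A : ℕ) (a e : Ex)
  | seq (c d : Cmd)
  | loop (i a : ℕ) (c : Cmd)

/-- Iteration of a state transformer with a register counting down to zero. -/
def iterDown (f : State → State) (i : ℕ) : ℕ → State → State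
  | 0, s => s.setReg i 0
  | j + 1, s => iterDown f i j (f (s.setReg i j))

/-- The condition `P` holds whenever the body of the iteration is entered. -/
def safeDown (f : State → State) (P : State → Prop) (i : ℕ) : ℕ → State → Prop
  | 0, _ => True
  | j + 1, s => P (s.setReg i j) ∧ safeDown f P i j (f (s.setReg i j))

namespace Cmd

/-- The effect of a command. -/
def run : Cmd → State → State
  | set r e, s => s.setReg r (e.val s)
  | put A a e, s => s.setMem A (a.val s).toNat (e.val s)
  | seq c d, s => d.run (c.run s)
  | loop i a c, s => iterDown c.run i (s.reg a).toNat s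

/-- All values assigned by the command have bit length at most `b`. -/
def Safe (b : ℕ) : Cmd → State → Prop
  | set _ e, s => bitLength (e.val s) ≤ b
  | put _ _ e, s => bitLength (e.val s) ≤ b
  | seq c d, s => c.Safe b s ∧ d.Safe b (c.run s)
  | loop i a c, s => 0 ≤ s.reg a ∧ safeDown c.run (c.Safe b) i (s.reg a).toNat s

/-- The registers to which a command assigns. -/
def regs : Cmd → List ℕ
  | set r _ => [r]
  | put _ _ _ => []
  | seq c d => c.regs ++ d.regs
  | loop i _ c => i :: c.regs

/-- The arrays to which a command assigns. -/
def arrays : Cmd → List ℕ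
  | set _ _ => []
  | put A _ _ => [A]
  | seq c d => c.arrays ++ d.arrays
  | loop _ _ c => c.arrays

/-- The registers that bound the loops of a command. -/
def bounds : Cmd → List ℕ
  | set _ _ => []
  | put _ _ _ => []
  | seq c d => c.bounds ++ d.bounds
  | loop _ a c => a :: c.bounds

/-- All registers are below `d` and loop counters are not assigned to in the loops. -/
def WF (d : ℕ) : Cmd → Prop
  | set r e => r < d ∧ e.Below d
  | put _ a e => a.Below d ∧ e.Below d
  | seq c c' => c.WF d ∧ c'.WF d
  | loop i a c => i < d ∧ a < d ∧ i ∉ c.regs ∧ c.WF d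

/-- The program of a command; registers from `d` on are used for temporary values. -/
def code (d : ℕ) : Cmd → Prog
  | set r e => .seq (e.code d) (.seq (.instr (.const (d + 1) 0)) (.instr (.add r d (d + 1))))
  | put A a e => .seq (a.code d) (.seq (e.code (d + 1)) (.instr (.store A d (d + 1))))
  | seq c c' => .seq (c.code d) (c'.code d)
  | loop i a c => .seq (.seq (.instr (.const d 0)) (.instr (.add i a d)))
      (.whilePos i (.seq (.seq (.instr (.const d 1)) (.instr (.sub i i d))) (c.code d)))

/-- A factor for the running time in terms of the bounds of the loops. -/
def time (N : ℕ → ℕ) : Cmd → ℕ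
  | set _ e => e.time + e.width + 2
  | put _ a e => a.time + e.time + (1 + a.width + e.width)
  | seq c d => c.time N + d.time N
  | loop _ a c => 5 + N a * (5 + c.time N)

theorem iterDown_reg {f : State → State} {r : ℕ} (hf : ∀ s, (f s).reg r = s.reg r) {i : ℕ}
    (hi : r ≠ i) (j : ℕ) (s : State) : (iterDown f i j s).reg r = s.reg r := by
  induction j generalizing s with
  | zero => simp [iterDown, hi]
  | succ j ih => simp [iterDown, ih, hf, hi]

theorem iterDown_mem {f : State → State} {A : ℕ} (hf : ∀ s, (f s).mem A = s.mem A) (i j : ℕ)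
    (s : State) : (iterDown f i j s).mem A = s.mem A := by
  induction j generalizing s with
  | zero => simp [iterDown]
  | succ j ih => simp [iterDown, ih, hf]

theorem run_reg (c : Cmd) (s : State) {r : ℕ} (hr : r ∉ c.regs) : (c.run s).reg r = s.reg r := by
  induction c generalizing s with
  | set r' e =>
    simp only [regs, List.mem_singleton] at hr
    simp [run, hr]
  | put A a e => rfl
  | seq c d hc hd =>
    simp only [regs, List.mem_append, not_or] at hr
    simp [run, hc _ hr.1, hd _ hr.2]
  | loop i a c hc =>
    simp only [regs, List.mem_cons, not_or] at hr
    exact iterDown_reg (fun s => hc s hr.2) hr.1 _ _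

theorem run_mem (c : Cmd) (s : State) {A : ℕ} (hA : A ∉ c.arrays) :
    (c.run s).mem A = s.mem A := by
  induction c generalizing s with
  | set r' e => rfl
  | put A' a e =>
    simp only [arrays, List.mem_singleton] at hA
    exact s.setMem_mem_of_ne _ _ hA
  | seq c d hc hd =>
    simp only [arrays, List.mem_append, not_or] at hA
    simp [run, hc _ hA.1, hd _ hA.2]
  | loop i a c hc => exact iterDown_mem (fun s => hc s hA) _ _ _

theorem bounded_setReg {d b : ℕ} {s : State} (h : Bounded d b s) (r : ℕ) {v : ℤ}
    (hv : bitLength v ≤ b) : Bounded d b (s.setReg r v) := by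
  refine ⟨fun r' hr' => ?_, h.2⟩
  rw [State.setReg_reg]
  split_ifs
  · exact hv
  · exact h.1 r' hr'

/-- The program of a command has the effect of the command, within the time bound. -/
theorem exec_code {d b : ℕ} {N : ℕ → ℕ} (c : Cmd) (hc : c.WF d) (σ : State)
    (hN : ∀ a ∈ c.bounds, a ∉ c.regs ∧ (σ.reg a).toNat ≤ N a) (hσ : Bounded d b σ)
    (hsafe : c.Safe b σ) (s : State) (hs : Agree d s σ) :
    ∃ s' t, Exec (c.code d) s s' t ∧ Agree d s' (c.run σ) ∧ Bounded d b (c.run σ) ∧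
      t ≤ c.time N * (b + 1) ^ 2 := by
  have hb : b + 1 ≤ (b + 1) ^ 2 := by nlinarith
  have hb1 : 1 ≤ (b + 1) ^ 2 := by nlinarith
  induction c generalizing σ s with
  | set r e =>
    obtain ⟨s₁, t₁, e₁, a₁, v₁, c₁⟩ := e.exec_code hσ hc.2 d le_rfl s hs
    refine ⟨_, _, .seq e₁ (.seq (.instr _ _) (.instr _ _)), ⟨?_, ?_⟩,
      bounded_setReg hσ r hsafe, ?_⟩
    · intro r' hr'
      have h1 : r' ≠ d + 1 := by omega
      simp [Instr.eval, run, Function.update_apply, v₁, h1, a₁.1 r' hr', hs.1 r' hr']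
    · simp [Instr.eval, run, a₁.2, hs.2]
    · have := e.bitLength_val_le hσ hc.2
      simp only [Instr.cost, Instr.eval, Function.update_apply, if_true, time, bitLength_zero]
      rw [if_neg (by omega), v₁]
      nlinarith
  | put A a e =>
    obtain ⟨s₁, t₁, e₁, a₁, v₁, c₁⟩ := a.exec_code hσ hc.1 d le_rfl s hs
    obtain ⟨s₂, t₂, e₂, a₂, v₂, c₂⟩ := e.exec_code hσ hc.2 (d + 1) (by omega) s₁ (a₁.trans hs)
    have v₁' : s₂.reg d = a.val σ := (a₂.1 d (by omega)).trans v₁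
    have a₂' : Agree d s₂ σ := ((a₂.mono (by omega)).trans a₁).trans hs
    refine ⟨_, _, .seq e₁ (.seq e₂ (.instr _ _)), ⟨?_, ?_⟩, ⟨hσ.1, ?_⟩, ?_⟩
    · intro r' hr'
      simp [Instr.eval, run, a₂'.1 r' hr']
    · simp [Instr.eval, run, State.setMem, a₂'.2, v₁', v₂]
    · intro A' i'
      rw [run, State.setMem_mem]
      split_ifs
      · exact hsafe
      · exact hσ.2 A' i'
    · have h1 := a.bitLength_val_le hσ hc.1
      have h2 := e.bitLength_val_le hσ hc.2
      simp only [Instr.cost, time, v₁', v₂]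
      nlinarith
  | seq c c' ih ih' =>
    simp only [bounds, regs, List.mem_append, not_or] at hN
    obtain ⟨s₁, t₁, e₁, a₁, b₁, c₁⟩ := ih hc.1 σ
      (fun a ha => ⟨(hN a (Or.inl ha)).1.1, (hN a (Or.inl ha)).2⟩) hσ hsafe.1 s hs
    obtain ⟨s₂, t₂, e₂, a₂, b₂, c₂⟩ := ih' hc.2 (c.run σ)
      (fun a ha => ⟨(hN a (Or.inr ha)).1.2, by
        rw [run_reg c σ (hN a (Or.inr ha)).1.1]
        exact (hN a (Or.inr ha)).2⟩) b₁ hsafe.2 s₁ a₁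
    refine ⟨_, _, .seq e₁ e₂, a₂, b₂, ?_⟩
    simp only [time]
    nlinarith
  | loop i a c ih =>
    obtain ⟨hi, had, hic, hcwf⟩ := hc
    simp only [bounds, regs, List.mem_cons, not_or] at hN
    -- The machine tests the counter while it holds the number `j` of remaining passes and
    -- decrements it before the body, whereas `iterDown` sets it directly. The two states are
    -- compared at the test, hence the `σ.setReg i j`.
    have main : ∀ (j : ℕ) (s σ : State), Agree d s (σ.setReg i j) → Bounded d b (σ.setReg i j) →
        (∀ a ∈ c.bounds, (σ.reg a).toNat ≤ N a) → safeDown c.run (c.Safe b) i j σ →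
        ∃ s' t, Exec (.whilePos i (.seq (.seq (.instr (.const d 1)) (.instr (.sub i i d)))
          (c.code d))) s s' t ∧ Agree d s' (iterDown c.run i j σ) ∧
          Bounded d b (iterDown c.run i j σ) ∧ t ≤ (1 + j * (5 + c.time N)) * (b + 1) ^ 2 := by
      intro j
      induction j with
      | zero =>
        intro s σ hs hσ _ _
        have h0 : s.reg i = 0 := by simpa using hs.1 i hi
        refine ⟨_, _, .whileFalse (by rw [h0]; exact lt_irrefl _), hs, hσ, ?_⟩
        rw [h0, bitLength_zero]
        nlinarith
      | succ j ihj =>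
        intro s σ hs hσ hNc hsafe
        have h0 : s.reg i = (j + 1 : ℕ) := by simpa using hs.1 i hi
        have hbj1 : bitLength ((j + 1 : ℕ) : ℤ) ≤ b := by
          have := hσ.1 i hi
          simpa using this
        have hbj : bitLength (j : ℤ) ≤ b :=
          (bitLength_mono (by rw [Int.natAbs_natCast, Int.natAbs_natCast]; omega)).trans hbj1
        have hid : i ≠ d := by omega
        have hσ' : Bounded d b (σ.setReg i j) := by
          refine ⟨fun r hr => ?_, hσ.2⟩
          rw [State.setReg_reg]
          split_ifs with hri
          · exact hbj
          · have := hσ.1 r hr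
            rwa [State.setReg_reg, if_neg hri] at this
        have hs2 : Agree d ((s.setReg d 1).setReg i (s.reg i - 1)) (σ.setReg i j) := by
          refine ⟨fun r hr => ?_, hs.2⟩
          have hrd : r ≠ d := by omega
          by_cases hri : r = i
          · subst hri
            simp only [State.setReg_reg, if_true, h0]
            push_cast
            ring
          · have := hs.1 r hr
            simpa [hri, hrd] using this
        obtain ⟨s₃, t₃, e₃, a₃, b₃, c₃⟩ := ih hcwf (σ.setReg i j)
          (fun a ha => ⟨(hN a (Or.inr ha)).1.2, by
            rw [State.setReg_reg, if_neg (hN a (Or.inr ha)).1.1]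
            exact hNc a ha⟩) hσ' hsafe.1 _ hs2
        have hτi : (c.run (σ.setReg i j)).reg i = j := by
          rw [run_reg c _ hic]
          simp
        have hτ : Agree d (c.run (σ.setReg i j)) ((c.run (σ.setReg i j)).setReg i j) := by
          refine ⟨fun r hr => ?_, rfl⟩
          rw [State.setReg_reg]
          split_ifs with hri
          · rw [hri, hτi]
          · rfl
        obtain ⟨s₄, t₄, e₄, a₄, b₄, c₄⟩ := ihj s₃ (c.run (σ.setReg i j)) (a₃.trans hτ)
          (bounded_setReg b₃ i hbj) (fun a ha => by
            rw [run_reg c _ (hN a (Or.inr ha)).1.2, State.setReg_reg,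
              if_neg (hN a (Or.inr ha)).1.1]
            exact hNc a ha) hsafe.2
        have hexec : Exec (.seq (.seq (.instr (.const d 1)) (.instr (.sub i i d)))
            (c.code d)) s s₃ (((1 + bitLength 1) + (1 + bitLength (s.reg i) + bitLength 1)) + t₃) := by
          refine .seq ?_ e₃
          have h := Exec.seq (Exec.instr (.const d 1) s)
            (Exec.instr (.sub i i d) (Instr.eval (.const d 1) s))
          have h1 : Instr.eval (.sub i i d) (Instr.eval (.const d 1) s) =
              (s.setReg d 1).setReg i (s.reg i - 1) := by
            simp [Instr.eval, State.setReg, hid]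
          have h2 : Instr.cost (.sub i i d) (Instr.eval (.const d 1) s) =
              1 + bitLength (s.reg i) + bitLength 1 := by
            simp [Instr.eval, Instr.cost, hid]
          rw [h1, h2] at h
          exact h
        refine ⟨s₄, _, .whileTrue (by rw [h0]; positivity) hexec e₄, a₄, b₄, ?_⟩
        rw [h0, bitLength_one]
        nlinarith
    have hbound : ((σ.reg a).toNat : ℤ) = σ.reg a := Int.toNat_of_nonneg hsafe.1
    have hai : a ≠ i := (hN a (Or.inl rfl)).1.1
    have hs2 : Agree d ((s.setReg d 0).setReg i (s.reg a + 0))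
        (σ.setReg i ((σ.reg a).toNat : ℤ)) := by
      refine ⟨fun r hr => ?_, hs.2⟩
      have hrd : r ≠ d := by omega
      by_cases hri : r = i
      · subst hri
        simp [hbound, hs.1 a had]
      · simpa [hri, hrd] using hs.1 r hr
    obtain ⟨s', t, e, a', b', c'⟩ := main (σ.reg a).toNat _ σ hs2
      (bounded_setReg hσ i (by rw [hbound]; exact hσ.1 a had))
      (fun a' ha' => (hN a' (Or.inr ha')).2) hsafe.2
    have hexec : Exec (.seq (.instr (.const d 0)) (.instr (.add i a d))) s
        ((s.setReg d 0).setReg i (s.reg a + 0))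
        ((1 + bitLength 0) + (1 + bitLength (s.reg a) + bitLength 0)) := by
      have hda : a ≠ d := by omega
      have h := Exec.seq (Exec.instr (.const d 0) s)
        (Exec.instr (.add i a d) (Instr.eval (.const d 0) s))
      have h1 : Instr.eval (.add i a d) (Instr.eval (.const d 0) s) =
          (s.setReg d 0).setReg i (s.reg a + 0) := by
        simp [Instr.eval, State.setReg, hda]
      have h2 : Instr.cost (.add i a d) (Instr.eval (.const d 0) s) =
          1 + bitLength (s.reg a) + bitLength 0 := by
        simp [Instr.eval, Instr.cost, hda]
      rw [h1, h2] at h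
      exact h
    refine ⟨s', _, .seq hexec e, a', b', ?_⟩
    have h1 := hσ.1 a had
    rw [bitLength_zero, hs.1 a had]
    simp only [time]
    have h2 : (1 + (σ.reg a).toNat * (5 + c.time N)) * (b + 1) ^ 2 ≤
        (1 + N a * (5 + c.time N)) * (b + 1) ^ 2 := by
      gcongr
      exact (hN a (Or.inl rfl)).2
    nlinarith

/-- The running time is polynomial in the bounds of the loops. -/
theorem exists_polynomial_time (c : Cmd) (p : Polynomial ℕ) : ∃ q : Polynomial ℕ, ∀ (x : ℕ)
    (N : ℕ → ℕ), (∀ a, N a ≤ p.eval x) → c.time N ≤ q.eval x := by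
  induction c with
  | set r e => exact ⟨.C (e.time + e.width + 2), fun x N _ => by simp [time]⟩
  | put A a e =>
    exact ⟨.C (a.time + e.time + (1 + a.width + e.width)), fun x N _ => by simp [time]⟩
  | seq c d hc hd =>
    obtain ⟨q, hq⟩ := hc
    obtain ⟨q', hq'⟩ := hd
    refine ⟨q + q', fun x N h => ?_⟩
    rw [Polynomial.eval_add]
    exact add_le_add (hq x N h) (hq' x N h)
  | loop i a c hc =>
    obtain ⟨q, hq⟩ := hc
    refine ⟨.C 5 + p * (.C 5 + q), fun x N h => ?_⟩
    simp only [Polynomial.eval_add, Polynomial.eval_mul, Polynomial.eval_C, time]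
    gcongr
    · exact h a
    · exact hq x N h

/-! ### A program logic with frames and loop invariants -/

/-- The command is safe and leads to a state that satisfies `Q`. -/
def Ok (b : ℕ) (c : Cmd) (s : State) (Q : State → Prop) : Prop :=
  c.Safe b s ∧ Q (c.run s)

/-- The registers and arrays to which the command does not assign are the same. -/
def Frame (c : Cmd) (s s' : State) : Prop :=
  (∀ r ∉ c.regs, s'.reg r = s.reg r) ∧ ∀ A ∉ c.arrays, s'.mem A = s.mem A

theorem frame_run (c : Cmd) (s : State) : c.Frame s (c.run s) :=
  ⟨fun _ hr => c.run_reg s hr, fun _ hA => c.run_mem s hA⟩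

/-- The frame comes for free, so postconditions need only speak of what a command assigns to. -/
theorem Ok.mono {b : ℕ} {c : Cmd} {s : State} {Q Q' : State → Prop} (h : Ok b c s Q)
    (hQ : ∀ s', c.Frame s s' → Q s' → Q' s') : Ok b c s Q' :=
  ⟨h.1, hQ _ (c.frame_run s) h.2⟩

theorem Ok.seq {b : ℕ} {c d : Cmd} {s : State} {Q : State → Prop}
    (h : Ok b c s fun s' => Ok b d s' Q) : Ok b (.seq c d) s Q :=
  ⟨⟨h.1, h.2.1⟩, h.2.2⟩

theorem Ok.set {b r : ℕ} {e : Ex} {s : State} {Q : State → Prop} (h : bitLength (e.val s) ≤ b)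
    (hQ : Q (s.setReg r (e.val s))) : Ok b (.set r e) s Q :=
  ⟨h, hQ⟩

theorem Ok.put {b A : ℕ} {a e : Ex} {s : State} {Q : State → Prop} (h : bitLength (e.val s) ≤ b)
    (hQ : Q (s.setMem A (a.val s).toNat (e.val s))) : Ok b (.put A a e) s Q :=
  ⟨h, hQ⟩

/-- Counters run downwards: `Inv j` describes the state with the indices `j, …, N - 1` done. The
frame always refers to the state before the whole loop. -/
theorem Ok.loop {b i a : ℕ} {c : Cmd} {s : State} {Q : State → Prop} (Inv : ℕ → State → Prop)
    {N : ℕ} (hN : s.reg a = N) (h0 : Inv N s)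
    (step : ∀ j < N, ∀ s', (Cmd.loop i a c).Frame s s' → Inv (j + 1) s' →
      Ok b c (s'.setReg i j) (Inv j))
    (fin : ∀ s', (Cmd.loop i a c).Frame s s' → Inv 0 s' → Q (s'.setReg i 0)) :
    Ok b (.loop i a c) s Q := by
  have main : ∀ j ≤ N, ∀ s', (Cmd.loop i a c).Frame s s' → Inv j s' →
      safeDown c.run (c.Safe b) i j s' ∧ Q (iterDown c.run i j s') := by
    intro j
    induction j with
    | zero => exact fun _ s' hf h => ⟨trivial, fin s' hf h⟩
    | succ j ih =>
      intro hj s' hf h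
      obtain ⟨h1, h2⟩ := step j hj s' hf h
      have hframe : (Cmd.loop i a c).Frame s (c.run (s'.setReg i j)) := by
        constructor
        · intro r hr
          have hr' := hr
          simp only [regs, List.mem_cons, not_or] at hr'
          rw [run_reg c _ hr'.2, State.setReg_reg, if_neg hr'.1]
          exact hf.1 r hr
        · intro A hA
          rw [run_mem c _ hA]
          exact hf.2 A hA
      obtain ⟨h3, h4⟩ := ih (by omega) (c.run (s'.setReg i j)) hframe h2
      exact ⟨⟨h1, h3⟩, h4⟩
  obtain ⟨h1, h2⟩ := main N le_rfl s ⟨fun _ _ => rfl, fun _ _ => rfl⟩ h0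
  have hN' : (s.reg a).toNat = N := by simp [hN]
  refine ⟨⟨by simp [hN], ?_⟩, ?_⟩
  · rw [hN']
    exact h1
  · simp only [run]
    rw [hN']
    exact h2

/-- The sum of the values of `e`, for the register `i` below the register `a`, in register `r`. -/
def sumLoop (r i a : ℕ) (e : Ex) : Cmd :=
  .seq (.set r (.lit 0)) (.loop i a (.set r (.add (.reg r) e)))

/-- As all terms are non-negative, a bound for the total bounds every partial sum and so makes the
loop safe. -/
theorem Ok.sumLoop {b r i a : ℕ} {e : Ex} {s : State} {Q : State → Prop} {N : ℕ}
    (hN : s.reg a = N) (hri : r ≠ i) (har : a ≠ r) (F : ℕ → ℤ) (hF : ∀ j < N, 0 ≤ F j)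
    (hb : ∑ j ∈ Finset.range N, F j < 2 ^ b)
    (he : ∀ j < N, ∀ s', (∀ r', r' ≠ r → r' ≠ i → s'.reg r' = s.reg r') → s'.mem = s.mem →
      s'.reg i = (j : ℤ) → e.val s' = F j)
    (fin : ∀ s', (∀ r', r' ≠ r → r' ≠ i → s'.reg r' = s.reg r') → s'.mem = s.mem →
      s'.reg r = ∑ j ∈ Finset.range N, F j → Q s') :
    Ok b (Cmd.sumLoop r i a e) s Q := by
  refine .seq (.set (by simp [Ex.val, bitLength_zero]) ?_)
  refine .loop (fun j s' => s'.reg r = ∑ j' ∈ Finset.Ico j N, F j' ∧ s'.mem = s.mem) (N := N)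
    (by simp [har, hN]) (by simp [Ex.val]) ?_ ?_
  · rintro j hj s' hf ⟨h1, h2⟩
    have h3 : e.val (s'.setReg i j) = F j := by
      refine he j hj _ (fun r' hr hi => ?_) h2 (by simp)
      have := hf.1 r' (by simp [regs, hr, hi])
      rw [State.setReg_reg, if_neg hr] at this
      rw [State.setReg_reg, if_neg hi, this]
    have h4 : Ex.val (.add (.reg r) e) (s'.setReg i j) = ∑ j' ∈ Finset.Ico j N, F j' := by
      simp only [Ex.val, h3, State.setReg_reg, if_neg hri, h1]
      rw [Finset.sum_eq_sum_Ico_succ_bot hj, add_comm]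
    refine .set ?_ ⟨?_, h2⟩
    · rw [h4, bitLength_le_iff]
      have h5 : 0 ≤ ∑ j' ∈ Finset.Ico j N, F j' :=
        Finset.sum_nonneg fun j' hj' => hF j' (Finset.mem_Ico.1 hj').2
      have h6 : ∑ j' ∈ Finset.Ico j N, F j' ≤ ∑ j' ∈ Finset.range N, F j' := by
        apply Finset.sum_le_sum_of_subset_of_nonneg
        · intro x hx
          exact Finset.mem_range.2 (Finset.mem_Ico.1 hx).2
        · intro x hx _
          exact hF x (Finset.mem_range.1 hx)
      zify
      rw [abs_of_nonneg h5]
      exact h6.trans_lt hb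
    · rw [State.setReg_reg, if_pos rfl, h4]
  · rintro s' hf ⟨h1, h2⟩
    refine fin _ (fun r' hr hi => ?_) h2 ?_
    · have := hf.1 r' (by simp [regs, hr, hi])
      rw [State.setReg_reg, if_neg hr] at this
      rw [State.setReg_reg, if_neg hi, this]
    · rw [State.setReg_reg, if_neg hri, h1, Finset.range_eq_Ico]

/-- Assignment of the values of `e`, for the register `i` below the register `a`, to the cells of
array `A`. -/
def mapLoop (A i a : ℕ) (e : Ex) : Cmd :=
  .loop i a (.put A (.reg i) e)

/-- Since the loop descends, the cells up to `j` are still unchanged when cell `j` is computed. So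
`e` may read the cell that it replaces, as in-place updates do. -/
theorem Ok.mapLoop {b A i a : ℕ} {e : Ex} {s : State} {Q : State → Prop} {N : ℕ}
    (hN : s.reg a = N) (F : ℕ → ℤ) (hb : ∀ j < N, bitLength (F j) ≤ b)
    (he : ∀ j < N, ∀ s', (∀ r', r' ≠ i → s'.reg r' = s.reg r') →
      (∀ A', A' ≠ A → s'.mem A' = s.mem A') → (∀ j' ≤ j, s'.mem A j' = s.mem A j') →
      s'.reg i = (j : ℤ) → e.val s' = F j)
    (fin : ∀ s', (∀ r', r' ≠ i → s'.reg r' = s.reg r') →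
      (∀ A', A' ≠ A → s'.mem A' = s.mem A') → (∀ j < N, s'.mem A j = F j) → Q s') :
    Ok b (Cmd.mapLoop A i a e) s Q := by
  refine .loop (fun j s' => (∀ j' < j, s'.mem A j' = s.mem A j') ∧
    ∀ j' < N, j ≤ j' → s'.mem A j' = F j') hN ⟨fun _ _ => rfl, fun j' h h' => by omega⟩ ?_ ?_
  · rintro j hj s' hf ⟨h1, h2⟩
    have h3 : e.val (s'.setReg i j) = F j := by
      refine he j hj _ (fun r' hi => ?_) (fun A' hA => ?_) (fun j' hj' => ?_) (by simp)
      · rw [State.setReg_reg, if_neg hi]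
        exact hf.1 r' (by simp [regs, hi])
      · exact hf.2 A' (by simp [arrays, hA])
      · exact h1 j' (by omega)
    refine .put (by rw [h3]; exact hb j hj) ⟨fun j' hj' => ?_, fun j' hj' hle => ?_⟩
    · have : ¬ (A = A ∧ j' = ((Ex.reg i).val (s'.setReg i j)).toNat) := by
        simp only [Ex.val, State.setReg_reg, if_true, Int.toNat_natCast]
        omega
      rw [State.setMem_mem, if_neg this]
      exact h1 j' (by omega)
    · rw [State.setMem_mem, h3]
      simp only [Ex.val, State.setReg_reg, if_true, Int.toNat_natCast, true_and]
      split_ifs with hjj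
      · rw [hjj]
      · exact h2 j' hj' (by omega)
  · rintro s' hf ⟨h1, h2⟩
    refine fin _ (fun r' hi => ?_) (fun A' hA => ?_) (fun j hj => h2 j hj (by omega))
    · rw [State.setReg_reg, if_neg hi]
      exact hf.1 r' (by simp [regs, hi])
    · exact hf.2 A' (by simp [arrays, hA])

end Cmd

open Cmd

section FinLoops

theorem Cmd.Ok.sumLoopFin {b r i a : ℕ} {e : Ex} {s : State} {Q : State → Prop} {N : ℕ}
    (hN : s.reg a = N) (hri : r ≠ i) (har : a ≠ r) (F : Fin N → ℤ) (hF : ∀ j, 0 ≤ F j)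
    (hb : ∑ j, F j < 2 ^ b)
    (he : ∀ (j : Fin N) s', (∀ r', r' ≠ r → r' ≠ i → s'.reg r' = s.reg r') → s'.mem = s.mem →
      s'.reg i = (j.1 : ℤ) → e.val s' = F j)
    (fin : ∀ s', (∀ r', r' ≠ r → r' ≠ i → s'.reg r' = s.reg r') → s'.mem = s.mem →
      s'.reg r = ∑ j, F j → Q s') :
    Ok b (Cmd.sumLoop r i a e) s Q := by
  have hsum : ∑ j ∈ Finset.range N, (fun j => if h : j < N then F ⟨j, h⟩ else 0) j = ∑ j, F j := by
    rw [Finset.sum_range]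
    exact Finset.sum_congr rfl fun j _ => by simp
  refine .sumLoop hN hri har (fun j => if h : j < N then F ⟨j, h⟩ else 0) ?_ ?_ ?_ ?_
  · intro j hj
    simp only [hj, dif_pos]
    exact hF _
  · rw [hsum]
    exact hb
  · intro j hj s' h1 h2 h3
    simp only [hj, dif_pos]
    exact he ⟨j, hj⟩ s' h1 h2 h3
  · intro s' h1 h2 h3
    rw [hsum] at h3
    exact fin s' h1 h2 h3

theorem Cmd.Ok.mapLoopFin {b A i a : ℕ} {e : Ex} {s : State} {Q : State → Prop} {N : ℕ}
    (hN : s.reg a = N) (F : Fin N → ℤ) (hb : ∀ j, bitLength (F j) ≤ b)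
    (he : ∀ (j : Fin N) s', (∀ r', r' ≠ i → s'.reg r' = s.reg r') →
      (∀ A', A' ≠ A → s'.mem A' = s.mem A') → s'.mem A j.1 = s.mem A j.1 →
      s'.reg i = (j.1 : ℤ) → e.val s' = F j)
    (fin : ∀ s', (∀ r', r' ≠ i → s'.reg r' = s.reg r') →
      (∀ A', A' ≠ A → s'.mem A' = s.mem A') → (∀ j : Fin N, s'.mem A j.1 = F j) → Q s') :
    Ok b (Cmd.mapLoop A i a e) s Q := by
  refine .mapLoop hN (fun j => if h : j < N then F ⟨j, h⟩ else 0) ?_ ?_ ?_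
  · intro j hj
    simp only [hj, dif_pos]
    exact hb _
  · intro j hj s' h1 h2 h3 h4
    simp only [hj, dif_pos]
    exact he ⟨j, hj⟩ s' h1 h2 (h3 j le_rfl) h4
  · intro s' h1 h2 h3
    refine fin s' h1 h2 fun j => ?_
    rw [h3 j.1 j.2]
    simp

end FinLoops

theorem bitLength_le_of_nonneg {z : ℤ} {b : ℕ} (h0 : 0 ≤ z) (h : z < 2 ^ b) :
    bitLength z ≤ b := by
  rw [bitLength_le_iff]
  zify
  rwa [abs_of_nonneg h0]

/-! ### The hypergraph in terms of integer weights -/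

section Data

variable {n m : ℕ} (edge : Fin m → Finset (Fin n)) (weight : Fin m → ℕ)

/-- The degree of a vertex in terms of the integer weights. -/
def ideg (v : Fin n) : ℤ := ∑ j, if v ∈ edge j then (weight j : ℤ) else 0

/-- The volume of a vertex set in terms of the integer weights. -/
def ivol (S : Finset (Fin n)) : ℤ := ∑ v, if v ∈ S then ideg edge weight v else 0

/-- The weight of the boundary of a vertex set. -/
def icut (S : Finset (Fin n)) : ℤ :=
  ∑ j, if (edge j ∩ S).Nonempty ∧ (edge j \ S).Nonempty then (weight j : ℤ) else 0

/-- The total volume. -/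
def itotal : ℤ := ∑ v, ideg edge weight v

/-- The product of the non-zero degrees. -/
def idegProd : ℤ := ∏ v, if 0 < ideg edge weight v then ideg edge weight v else 1

/-- Admissible vertex sets in terms of the integer weights. -/
def IsIntAdmissible (S : Finset (Fin n)) : Prop :=
  0 < ivol edge weight S ∧ 2 * ivol edge weight S ≤ itotal edge weight

/-- The sum over the hyperedges at a vertex in a step of the power iteration. -/
def ipush (x : Fin n → ℤ) (u : Fin n) : ℤ :=
  ∑ j, if u ∈ edge j then (weight j : ℤ) * ∑ w, (if w ∈ edge j then x w else 0) else 0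

/-- A step of the power iteration with integers. -/
def istep (x : Fin n → ℤ) (u : Fin n) : ℤ :=
  ipush edge weight x u * (idegProd edge weight / ideg edge weight u)

/-- The set `S` is closed under the hyperedges heavier than the one of index `j`. -/
def IsIntClosed (j : Fin m) (S : Finset (Fin n)) : Prop :=
  ∀ e, weight j < weight e → (edge e ∩ S).Nonempty → edge e ⊆ S

/-- The least closed set that contains a vertex. -/
def IsIntComponent (j : Fin m) (v : Fin n) (S : Finset (Fin n)) : Prop :=
  v ∈ S ∧ IsIntClosed edge weight j S ∧ ∀ S', v ∈ S' → IsIntClosed edge weight j S' → S ⊆ S'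

theorem ideg_nonneg (v : Fin n) : 0 ≤ ideg edge weight v :=
  Finset.sum_nonneg fun j _ => by split_ifs <;> positivity

theorem ivol_nonneg (S : Finset (Fin n)) : 0 ≤ ivol edge weight S :=
  Finset.sum_nonneg fun v _ => by
    split_ifs
    · exact ideg_nonneg edge weight v
    · exact le_rfl

theorem ivol_le_itotal (S : Finset (Fin n)) : ivol edge weight S ≤ itotal edge weight :=
  Finset.sum_le_sum fun v _ => by
    split_ifs
    · exact le_rfl
    · exact ideg_nonneg edge weight v

theorem icut_nonneg (S : Finset (Fin n)) : 0 ≤ icut edge weight S :=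
  Finset.sum_nonneg fun j _ => by split_ifs <;> positivity

theorem icut_le (S : Finset (Fin n)) : icut edge weight S ≤ ∑ j, (weight j : ℤ) :=
  Finset.sum_le_sum fun j _ => by
    split_ifs
    · exact le_rfl
    · positivity

theorem one_le_idegProd : 1 ≤ idegProd edge weight := by
  have : 0 < idegProd edge weight := Finset.prod_pos fun v _ => by
    split_ifs with h
    · exact h
    · exact one_pos
  omega

end Data

/-- The integers that occur in the computation have bit length at most `b`. -/
structure Fits {n m : ℕ} (edge : Fin m → Finset (Fin n)) (weight : Fin m → ℕ) (T b : ℕ) :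
    Prop where
  one_le : 1 ≤ b
  card : (n : ℤ) < 2 ^ b
  card_edges : (m : ℤ) < 2 ^ b
  steps : (T : ℤ) < 2 ^ b
  weights : ∑ j, (weight j : ℤ) < 2 ^ b
  total : itotal edge weight < 2 ^ b
  degProd : idegProd edge weight < 2 ^ b
  edgeSum : ∀ v, ∀ t < T, ∀ j,
    ∑ w, (if w ∈ edge j then (istep edge weight)^[t] (Pi.single v 1) w else 0) < 2 ^ b
  push : ∀ v, ∀ t < T, ∀ u,
    ipush edge weight ((istep edge weight)^[t] (Pi.single v 1)) u < 2 ^ b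
  step : ∀ v, ∀ t < T, ∀ u, (istep edge weight)^[t + 1] (Pi.single v 1) u < 2 ^ b

/-- The state holds the input. -/
structure HasInput {n m : ℕ} (edge : Fin m → Finset (Fin n)) (weight : Fin m → ℕ) (s : State) :
    Prop where
  reg_zero : s.reg 0 = n
  reg_one : s.reg 1 = m
  weights : ∀ j : Fin m, s.mem 0 j = weight j
  incidence : ∀ (j : Fin m) (v : Fin n), s.mem 1 (j * n + v) = if v ∈ edge j then 1 else 0

/-- The state holds the input and the degrees. -/
structure HasDegrees {n m : ℕ} (edge : Fin m → Finset (Fin n)) (weight : Fin m → ℕ) (T : ℕ)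
    (s : State) : Prop extends HasInput edge weight s where
  reg_two : s.reg 2 = T
  reg_three : s.reg 3 = itotal edge weight
  reg_four : s.reg 4 = idegProd edge weight
  degrees : ∀ v : Fin n, s.mem 4 v = ideg edge weight v

/-- Array `3` holds the indicator function of `S`. -/
def HasCandidate {n : ℕ} (S : Finset (Fin n)) (s : State) : Prop :=
  ∀ v : Fin n, s.mem 3 v = if v ∈ S then 1 else 0

/-- Array `2` and registers `5`, `6` hold the best admissible set of a family. -/
def HasBest {n m : ℕ} (edge : Fin m → Finset (Fin n)) (weight : Fin m → ℕ)
    (𝒮 : Set (Finset (Fin n))) (s : State) : Prop :=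
  ∃ O : Finset (Fin n), (∀ v : Fin n, s.mem 2 v = if v ∈ O then 1 else 0) ∧
    ((s.reg 5 = 1 ∧ s.reg 6 = 0 ∧ ∀ S ∈ 𝒮, ¬ IsIntAdmissible edge weight S) ∨
      (s.reg 5 = icut edge weight O ∧ s.reg 6 = ivol edge weight O ∧
        IsIntAdmissible edge weight O ∧ ∀ S ∈ 𝒮, IsIntAdmissible edge weight S →
          icut edge weight O * ivol edge weight S ≤ icut edge weight S * ivol edge weight O))

/-! ### Evaluating a candidate set -/

section Program

variable {n m : ℕ} {edge : Fin m → Finset (Fin n)} {weight : Fin m → ℕ} {T b : ℕ}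

theorem HasInput.congr {s s' : State} (h : HasInput edge weight s)
    (h0 : s'.reg 0 = s.reg 0) (h1 : s'.reg 1 = s.reg 1) (m0 : s'.mem 0 = s.mem 0)
    (m1 : s'.mem 1 = s.mem 1) : HasInput edge weight s' :=
  ⟨h0.trans h.reg_zero, h1.trans h.reg_one, fun j => by rw [m0, h.weights],
    fun j v => by rw [m1, h.incidence]⟩

theorem HasDegrees.congr {s s' : State} (h : HasDegrees edge weight T s)
    (hr : ∀ r ≤ 4, s'.reg r = s.reg r) (m0 : s'.mem 0 = s.mem 0)
    (m1 : s'.mem 1 = s.mem 1) (m4 : s'.mem 4 = s.mem 4) : HasDegrees edge weight T s' :=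
  ⟨h.toHasInput.congr (hr 0 (by norm_num)) (hr 1 (by norm_num)) m0 m1,
    (hr 2 (by norm_num)).trans h.reg_two, (hr 3 (by norm_num)).trans h.reg_three,
    (hr 4 (by norm_num)).trans h.reg_four, fun v => by rw [m4, h.degrees]⟩

theorem HasCandidate.congr {S : Finset (Fin n)} {s s' : State} (h : HasCandidate S s)
    (m3 : s'.mem 3 = s.mem 3) : HasCandidate S s' := fun v => by rw [m3, h v]

theorem HasBest.congr {𝒮 : Set (Finset (Fin n))} {s s' : State} (h : HasBest edge weight 𝒮 s)
    (h5 : s'.reg 5 = s.reg 5) (h6 : s'.reg 6 = s.reg 6) (m2 : s'.mem 2 = s.mem 2) :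
    HasBest edge weight 𝒮 s' := by
  unfold HasBest
  rw [h5, h6, m2]
  exact h

/-- The entry of the incidence matrix for the hyperedge and the vertex in two registers. -/
def incidenceEx (x y : ℕ) : Ex := .get 1 (.add (.mul (.reg x) (.reg 0)) (.reg y))

theorem HasInput.val_incidence {s : State} (h : HasInput edge weight s) {x y : ℕ} {j : Fin m}
    {v : Fin n} (hx : s.reg x = (j.1 : ℤ)) (hy : s.reg y = (v.1 : ℤ)) :
    (incidenceEx x y).val s = if v ∈ edge j then 1 else 0 := by
  simp only [incidenceEx, Ex.val, hx, hy, h.reg_zero]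
  have : ((j.1 : ℤ) * (n : ℤ) + (v.1 : ℤ)).toNat = j * n + v := by
    have h1 : (j.1 : ℤ) * (n : ℤ) + (v.1 : ℤ) = ((j * n + v : ℕ) : ℤ) := by push_cast; rfl
    rw [h1, Int.toNat_natCast]
  rw [this, h.incidence]

theorem sum_indicator_eq_card (A : Finset (Fin n)) :
    ∑ v, (if v ∈ A then (1 : ℤ) else 0) = A.card := by
  simp

theorem sum_incidence_mul (A S : Finset (Fin n)) :
    ∑ v, ((if v ∈ A then (1 : ℤ) else 0) * if v ∈ S then 1 else 0) = (A ∩ S).card := by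
  rw [← sum_indicator_eq_card]
  refine Finset.sum_congr rfl fun v _ => ?_
  simp only [Finset.mem_inter]
  split_ifs <;> simp_all

theorem sum_incidence_mul_not (A S : Finset (Fin n)) :
    ∑ v, ((if v ∈ A then (1 : ℤ) else 0) * (1 - if v ∈ S then 1 else 0)) = (A \ S).card := by
  rw [← sum_indicator_eq_card]
  refine Finset.sum_congr rfl fun v _ => ?_
  simp only [Finset.mem_sdiff]
  split_ifs <;> simp_all

theorem card_lt_two_pow (hb : Fits edge weight T b) (A : Finset (Fin n)) :
    (A.card : ℤ) < 2 ^ b := by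
  have := Finset.card_le_univ A
  rw [Fintype.card_fin] at this
  have h := hb.card
  omega

/-- The weight of the boundary of the candidate, in register `22`. -/
def cutCmd : Cmd :=
  .seq (.set 22 (.lit 0)) (.loop 11 1
    (.seq (sumLoop 23 12 0 (.mul (incidenceEx 11 12) (.get 3 (.reg 12))))
      (.seq (sumLoop 24 12 0 (.mul (incidenceEx 11 12) (.sub (.lit 1) (.get 3 (.reg 12)))))
        (.set 22 (.add (.reg 22) (.mul (.get 0 (.reg 11)) (.mul (.pos (.reg 23))
          (.pos (.reg 24)))))))))

theorem ok_cutCmd (hb : Fits edge weight T b) {s : State} (hs : HasInput edge weight s)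
    {S : Finset (Fin n)} (hS : HasCandidate S s) {Q : State → Prop}
    (fin : ∀ s', (∀ r, r ∉ [11, 12, 22, 23, 24] → s'.reg r = s.reg r) → s'.mem = s.mem →
      s'.reg 22 = icut edge weight S → Q s') : Ok b cutCmd s Q := by
  set G : ℕ → ℤ := fun j => if h : j < m then
    (if (edge ⟨j, h⟩ ∩ S).Nonempty ∧ (edge ⟨j, h⟩ \ S).Nonempty then (weight ⟨j, h⟩ : ℤ) else 0)
    else 0 with hG
  have hG0 : ∀ j, 0 ≤ G j := by
    intro j
    simp only [hG]
    split_ifs <;> positivity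
  have hGsum : ∑ j ∈ Finset.range m, G j = icut edge weight S := by
    rw [Finset.sum_range]
    exact Finset.sum_congr rfl fun j _ => by simp [hG]
  refine .seq (.set (by simp [Ex.val, bitLength_zero]) ?_)
  refine .loop (fun j s' => s'.reg 22 = ∑ j' ∈ Finset.Ico j m, G j' ∧ s'.mem = s.mem) (N := m)
    (by simpa using hs.reg_one) (by simp [Ex.val]) ?_ ?_
  · rintro j hj s₁ hf ⟨h1, h2⟩
    have hin : HasInput edge weight (s₁.setReg 11 j) := by
      refine hs.congr ?_ ?_ (by simp [h2]) (by simp [h2])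
      · have := hf.1 0 (by decide)
        simpa using this
      · have := hf.1 1 (by decide)
        simpa using this
    have hcand : HasCandidate S (s₁.setReg 11 j) := hS.congr (by simp [h2])
    refine .seq (.sumLoopFin hin.reg_zero (by decide) (by decide)
      (fun v => (if v ∈ edge ⟨j, hj⟩ then (1 : ℤ) else 0) * if v ∈ S then 1 else 0)
      (fun v => by split_ifs <;> norm_num)
      (by rw [sum_incidence_mul]; exact card_lt_two_pow hb _) ?_ ?_)
    · intro v s₂ hr hm hi
      have hin₂ : HasInput edge weight s₂ := hin.congr (hr 0 (by decide) (by decide))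
        (hr 1 (by decide) (by decide)) (by rw [hm]) (by rw [hm])
      have h11 : s₂.reg 11 = ((⟨j, hj⟩ : Fin m).1 : ℤ) := by
        rw [hr 11 (by decide) (by decide)]
        simp
      simp only [Ex.val, hin₂.val_incidence h11 hi]
      simp only [hi, Int.toNat_natCast, hm, hcand v]
    intro s₂ hr₂ hm₂ h23
    have hin₂ : HasInput edge weight s₂ := hin.congr (hr₂ 0 (by decide) (by decide))
      (hr₂ 1 (by decide) (by decide)) (by rw [hm₂]) (by rw [hm₂])
    have hcand₂ : HasCandidate S s₂ := hcand.congr (by rw [hm₂])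
    have h11₂ : s₂.reg 11 = ((⟨j, hj⟩ : Fin m).1 : ℤ) := by
      rw [hr₂ 11 (by decide) (by decide)]
      simp
    refine .seq (.sumLoopFin hin₂.reg_zero (by decide) (by decide)
      (fun v => (if v ∈ edge ⟨j, hj⟩ then (1 : ℤ) else 0) * (1 - if v ∈ S then 1 else 0))
      (fun v => by split_ifs <;> norm_num)
      (by rw [sum_incidence_mul_not]; exact card_lt_two_pow hb _) ?_ ?_)
    · intro v s₃ hr hm hi
      have hin₃ : HasInput edge weight s₃ := hin₂.congr (hr 0 (by decide) (by decide))
        (hr 1 (by decide) (by decide)) (by rw [hm]) (by rw [hm])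
      have h11 : s₃.reg 11 = ((⟨j, hj⟩ : Fin m).1 : ℤ) := by
        rw [hr 11 (by decide) (by decide), h11₂]
      simp only [Ex.val, hin₃.val_incidence h11 hi]
      simp only [hi, Int.toNat_natCast, hm, hcand₂ v]
    intro s₃ hr₃ hm₃ h24
    have hval : Ex.val (.add (.reg 22) (.mul (.get 0 (.reg 11)) (.mul (.pos (.reg 23))
          (.pos (.reg 24))))) s₃ = ∑ j' ∈ Finset.Ico j m, G j' := by
      rw [Finset.sum_eq_sum_Ico_succ_bot hj, add_comm (G j)]
      have e22 : s₃.reg 22 = ∑ j' ∈ Finset.Ico (j + 1) m, G j' := by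
        rw [hr₃ 22 (by decide) (by decide), hr₂ 22 (by decide) (by decide), ← h1]
        simp
      have e11 : s₃.reg 11 = (j : ℤ) := by
        rw [hr₃ 11 (by decide) (by decide), h11₂]
      have e23 : s₃.reg 23 = (edge ⟨j, hj⟩ ∩ S).card := by
        rw [hr₃ 23 (by decide) (by decide), h23, sum_incidence_mul]
      have e24 : s₃.reg 24 = (edge ⟨j, hj⟩ \ S).card := by
        rw [h24, sum_incidence_mul_not]
      have e0 : s₃.mem 0 j = weight ⟨j, hj⟩ := by
        rw [hm₃]
        exact hin₂.weights ⟨j, hj⟩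
      simp only [Ex.val, e22, e11, e23, e24, Int.toNat_natCast, e0, hG, hj, dif_pos,
        Nat.cast_pos, Finset.card_pos]
      congr 1
      split_ifs <;> simp_all
    refine .set ?_ ⟨?_, ?_⟩
    · rw [hval]
      refine bitLength_le_of_nonneg (Finset.sum_nonneg fun j' _ => hG0 j') ?_
      refine lt_of_le_of_lt ?_ ((icut_le edge weight S).trans_lt hb.weights)
      rw [← hGsum]
      apply Finset.sum_le_sum_of_subset_of_nonneg
      · intro x hx
        exact Finset.mem_range.2 (Finset.mem_Ico.1 hx).2
      · exact fun x _ _ => hG0 x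
    · rw [State.setReg_reg, if_pos rfl, hval]
    · simp only [State.setReg_mem, hm₃, hm₂, h2]
  · rintro s' hf ⟨h1, h2⟩
    refine fin _ (fun r hr => ?_) h2 ?_
    · simp only [List.mem_cons, List.not_mem_nil, or_false, not_or] at hr
      have := hf.1 r (by simp [regs, sumLoop, hr])
      rw [State.setReg_reg, if_neg hr.1, this]
      simp [hr]
    · rw [State.setReg_reg, if_neg (by decide), h1, ← Finset.range_eq_Ico, hGsum]

/-- The indicator that the candidate is admissible and better than the best set so far. -/
def betterEx : Ex :=
  .mul (.pos (.reg 21)) (.mul (.pos (.add (.sub (.reg 3) (.mul (.lit 2) (.reg 21))) (.lit 1)))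
    (.pos (.sub (.mul (.reg 5) (.reg 21)) (.mul (.reg 22) (.reg 6)))))

/-- The expression `x + f (y - x)` for the indicator `f` in register `25`. -/
def chooseEx (x y : Ex) : Ex := .add x (.mul (.reg 25) (.sub y x))

/-- Replace the best set by the candidate if the latter is better. -/
def evalCmd : Cmd :=
  .seq (sumLoop 21 11 0 (.mul (.get 4 (.reg 11)) (.get 3 (.reg 11))))
    (.seq cutCmd
      (.seq (.set 25 betterEx)
        (.seq (.set 5 (chooseEx (.reg 5) (.reg 22)))
          (.seq (.set 6 (chooseEx (.reg 6) (.reg 21)))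
            (mapLoop 2 11 0 (chooseEx (.get 2 (.reg 11)) (.get 3 (.reg 11))))))))

/-- The initial pair `(1, 0)` acts as the fraction `1/0`, worse than everything: in the
cross-multiplied comparison any set of positive volume beats it. -/
theorem HasBest.insert_of_not {𝒮 : Set (Finset (Fin n))} {S : Finset (Fin n)} {s s' : State}
    (h : HasBest edge weight 𝒮 s) (h5 : s'.reg 5 = s.reg 5) (h6 : s'.reg 6 = s.reg 6)
    (m2 : ∀ v : Fin n, s'.mem 2 v = s.mem 2 v)
    (hnot : ¬ (IsIntAdmissible edge weight S ∧
      icut edge weight S * s.reg 6 < s.reg 5 * ivol edge weight S)) :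
    HasBest edge weight (insert S 𝒮) s' := by
  obtain ⟨O, hO, hcase⟩ := h
  refine ⟨O, fun v => (m2 v).trans (hO v), ?_⟩
  rw [h5, h6]
  rcases hcase with ⟨c5, c6, hall⟩ | ⟨c5, c6, hadm, hall⟩
  · refine Or.inl ⟨c5, c6, ?_⟩
    rintro S' (rfl | hS') hadm
    · apply hnot
      refine ⟨hadm, ?_⟩
      rw [c5, c6]
      have := hadm.1
      linarith
    · exact hall S' hS' hadm
  · refine Or.inr ⟨c5, c6, hadm, ?_⟩
    rintro S' (rfl | hS') hadm'
    · rw [c5, c6] at hnot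
      by_contra! hlt
      exact hnot ⟨hadm', hlt⟩
    · exact hall S' hS' hadm'

/-- Transitivity of the comparison of fractions, after multiplication by the positive volume of the
previous best set. -/
theorem HasBest.insert_of_better {𝒮 : Set (Finset (Fin n))} {S : Finset (Fin n)} {s s' : State}
    (h : HasBest edge weight 𝒮 s) (h5 : s'.reg 5 = icut edge weight S)
    (h6 : s'.reg 6 = ivol edge weight S)
    (m2 : ∀ v : Fin n, s'.mem 2 v = if v ∈ S then 1 else 0)
    (hadm : IsIntAdmissible edge weight S)
    (hlt : icut edge weight S * s.reg 6 < s.reg 5 * ivol edge weight S) :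
    HasBest edge weight (insert S 𝒮) s' := by
  obtain ⟨O, hO, hcase⟩ := h
  refine ⟨S, m2, Or.inr ⟨h5, h6, hadm, ?_⟩⟩
  rintro S' (rfl | hS') hadm'
  · exact le_rfl
  · rcases hcase with ⟨c5, c6, hall⟩ | ⟨c5, c6, hadmO, hall⟩
    · exact absurd hadm' (hall S' hS')
    · rw [c5, c6] at hlt
      have h1 := hall S' hS' hadm'
      have hO0 := hadmO.1
      refine le_of_mul_le_mul_right ?_ hO0
      have h2 := mul_le_mul_of_nonneg_right hlt.le hadm'.1.le
      have h3 := mul_le_mul_of_nonneg_right h1 hadm.1.le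
      nlinarith

theorem ok_evalCmd (hb : Fits edge weight T b) {s : State} (hs : HasDegrees edge weight T s)
    {S : Finset (Fin n)} (hS : HasCandidate S s) {𝒮 : Set (Finset (Fin n))}
    (hbest : HasBest edge weight 𝒮 s) :
    Ok b evalCmd s (HasBest edge weight (insert S 𝒮)) := by
  classical
  refine .seq (.sumLoopFin hs.reg_zero (by decide) (by decide)
    (fun v => ideg edge weight v * if v ∈ S then 1 else 0) (fun v => ?_) ?_ ?_ ?_)
  · exact mul_nonneg (ideg_nonneg edge weight v) (by split_ifs <;> norm_num)
  · refine lt_of_le_of_lt ?_ ((ivol_le_itotal edge weight S).trans_lt hb.total)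
    simp [ivol]
  · intro v s₁ hr hm hi
    simp only [Ex.val, hi, Int.toNat_natCast, hm, hs.degrees v, hS v]
  intro s₁ hr₁ hm₁ h21
  have h21' : s₁.reg 21 = ivol edge weight S := by
    rw [h21, ivol]
    exact Finset.sum_congr rfl fun v _ => by split_ifs <;> simp
  have hin₁ : HasInput edge weight s₁ := hs.toHasInput.congr (hr₁ 0 (by decide) (by decide))
    (hr₁ 1 (by decide) (by decide)) (by rw [hm₁]) (by rw [hm₁])
  refine .seq (ok_cutCmd hb hin₁ (hS.congr (by rw [hm₁])) ?_)
  intro s₂ hr₂ hm₂ h22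
  have hm : s₂.mem = s.mem := hm₂.trans hm₁
  have e21 : s₂.reg 21 = ivol edge weight S := by rw [hr₂ 21 (by decide), h21']
  have e3 : s₂.reg 3 = itotal edge weight := by
    rw [hr₂ 3 (by decide), hr₁ 3 (by decide) (by decide), hs.reg_three]
  have e5 : s₂.reg 5 = s.reg 5 := by rw [hr₂ 5 (by decide), hr₁ 5 (by decide) (by decide)]
  have e6 : s₂.reg 6 = s.reg 6 := by rw [hr₂ 6 (by decide), hr₁ 6 (by decide) (by decide)]
  have e0 : s₂.reg 0 = n := by
    rw [hr₂ 0 (by decide), hr₁ 0 (by decide) (by decide), hs.reg_zero]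
  -- Only strict positivity can be tested, so `2 vol ≤ total` is written as `0 < total - 2 vol + 1`,
  -- which is equivalent for integers.
  have hflag : betterEx.val s₂ = if IsIntAdmissible edge weight S ∧
      icut edge weight S * s.reg 6 < s.reg 5 * ivol edge weight S then 1 else 0 := by
    simp only [betterEx, Ex.val, e21, e3, e5, e6, h22, sub_pos]
    by_cases c1 : 0 < ivol edge weight S
    · by_cases c2 : 2 * ivol edge weight S ≤ itotal edge weight
      · have c2' : 0 < itotal edge weight - 2 * ivol edge weight S + 1 := by linarith
        simp [c1, c2, c2', IsIntAdmissible]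
      · have c2' : ¬ 0 < itotal edge weight - 2 * ivol edge weight S + 1 := by linarith
        simp [c1, c2, c2', IsIntAdmissible]
    · simp [c1, IsIntAdmissible]
  obtain ⟨O, hO, hcase⟩ := id hbest
  have hbit1 : bitLength 1 ≤ b := by rw [bitLength_one]; exact hb.one_le
  have hb5 : bitLength (s.reg 5) ≤ b := by
    rcases hcase with ⟨c5, -⟩ | ⟨c5, -⟩
    · rw [c5]
      exact hbit1
    · rw [c5]
      exact bitLength_le_of_nonneg (icut_nonneg _ _ _) ((icut_le _ _ _).trans_lt hb.weights)
  have hb6 : bitLength (s.reg 6) ≤ b := by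
    rcases hcase with ⟨-, c6, -⟩ | ⟨-, c6, -⟩
    · rw [c6, bitLength_zero]
      exact Nat.zero_le b
    · rw [c6]
      exact bitLength_le_of_nonneg (ivol_nonneg _ _ _) ((ivol_le_itotal _ _ _).trans_lt hb.total)
  have hbcut : bitLength (icut edge weight S) ≤ b :=
    bitLength_le_of_nonneg (icut_nonneg _ _ _) ((icut_le _ _ _).trans_lt hb.weights)
  have hbvol : bitLength (ivol edge weight S) ≤ b :=
    bitLength_le_of_nonneg (ivol_nonneg _ _ _) ((ivol_le_itotal _ _ _).trans_lt hb.total)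
  have hb01 : ∀ p : Prop, [Decidable p] → bitLength (if p then 1 else 0) ≤ b := by
    intro p _
    split_ifs
    · exact hbit1
    · rw [bitLength_zero]
      exact Nat.zero_le b
  -- Commands have no conditional: the same assignments run in both cases, and the flag selects the
  -- new value or rewrites the old one.
  by_cases hp : IsIntAdmissible edge weight S ∧
      icut edge weight S * s.reg 6 < s.reg 5 * ivol edge weight S
  · rw [if_pos hp] at hflag
    refine .seq (.set (by rw [hflag]; exact hbit1) (.seq (.set ?_ (.seq (.set ?_ ?_)))))
    · simpa [chooseEx, Ex.val, hflag, h22] using hbcut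
    · simpa [chooseEx, Ex.val, hflag, e21] using hbvol
    · refine .mapLoopFin (N := n) (by simpa using e0) (fun v => if v ∈ S then 1 else 0)
        (fun v => hb01 _) ?_ ?_
      · intro v s₃ hr hm' hm2 hi
        have e25 : s₃.reg 25 = 1 := by
          rw [hr 25 (by decide)]
          simp [hflag]
        simp only [chooseEx, Ex.val, hi, Int.toNat_natCast, e25]
        rw [hm' 3 (by decide)]
        simp only [State.setReg_mem, hm, hS v]
        ring
      · intro s₃ hr hm' hm2
        refine hbest.insert_of_better ?_ ?_ hm2 hp.1 hp.2
        · rw [hr 5 (by decide)]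
          simp [chooseEx, Ex.val, hflag, h22]
        · rw [hr 6 (by decide)]
          simp [chooseEx, Ex.val, hflag, e21]
  · rw [if_neg hp] at hflag
    refine .seq (.set (by rw [hflag, bitLength_zero]; exact Nat.zero_le b)
      (.seq (.set ?_ (.seq (.set ?_ ?_)))))
    · simpa [chooseEx, Ex.val, hflag, e5] using hb5
    · simpa [chooseEx, Ex.val, hflag, e6] using hb6
    · refine .mapLoopFin (N := n) (by simpa using e0) (fun v => if v ∈ O then 1 else 0)
        (fun v => hb01 _) ?_ ?_
      · intro v s₃ hr hm' hm2 hi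
        have e25 : s₃.reg 25 = 0 := by
          rw [hr 25 (by decide)]
          simp [hflag]
        simp only [chooseEx, Ex.val, hi, Int.toNat_natCast, e25, hm2]
        simp only [State.setReg_mem, hm, hO v]
        ring
      · intro s₃ hr hm' hm2
        refine hbest.insert_of_not ?_ ?_ (fun v => (hm2 v).trans (hO v).symm) hp
        · rw [hr 5 (by decide)]
          simp [chooseEx, Ex.val, hflag, e5]
        · rw [hr 6 (by decide)]
          simp [chooseEx, Ex.val, hflag, e6]

end Program

/-! ### Computing and evaluating the components -/

section Components

variable {n m : ℕ} {edge : Fin m → Finset (Fin n)} {weight : Fin m → ℕ} {T b : ℕ}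

theorem HasInput.setReg {s : State} (h : HasInput edge weight s) {r : ℕ} (hr : 1 < r) (v : ℤ) :
    HasInput edge weight (s.setReg r v) :=
  h.congr (by rw [State.setReg_reg, if_neg (by omega)])
    (by rw [State.setReg_reg, if_neg (by omega)]) rfl rfl

theorem HasInput.frame {c : Cmd} {s s' : State} (h : HasInput edge weight s)
    (hf : c.Frame s s') (hr : 0 ∉ c.regs ∧ 1 ∉ c.regs) (hA : 0 ∉ c.arrays ∧ 1 ∉ c.arrays) :
    HasInput edge weight s' :=
  h.congr (hf.1 0 hr.1) (hf.1 1 hr.2) (hf.2 0 hA.1) (hf.2 1 hA.2)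

theorem HasDegrees.frame {c : Cmd} {s s' : State} (h : HasDegrees edge weight T s)
    (hf : c.Frame s s') (hr : ∀ r ≤ 4, r ∉ c.regs)
    (hA : 0 ∉ c.arrays ∧ 1 ∉ c.arrays ∧ 4 ∉ c.arrays) : HasDegrees edge weight T s' :=
  h.congr (fun r h => hf.1 r (hr r h)) (hf.2 0 hA.1) (hf.2 1 hA.2.1) (hf.2 4 hA.2.2)

theorem HasDegrees.setReg {s : State} (h : HasDegrees edge weight T s) {r : ℕ} (hr : 4 < r)
    (v : ℤ) : HasDegrees edge weight T (s.setReg r v) :=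
  h.congr (fun r' hr' => by rw [State.setReg_reg, if_neg (by omega)]) rfl rfl rfl

theorem HasBest.frame {𝒮 : Set (Finset (Fin n))} {c : Cmd} {s s' : State}
    (h : HasBest edge weight 𝒮 s) (hf : c.Frame s s') (hr : 5 ∉ c.regs ∧ 6 ∉ c.regs)
    (hA : 2 ∉ c.arrays) : HasBest edge weight 𝒮 s' :=
  h.congr (hf.1 5 hr.1) (hf.1 6 hr.2) (hf.2 2 hA)

/-- The state holds the input, the degrees and the best set of a family. -/
structure Ready {n m : ℕ} (edge : Fin m → Finset (Fin n)) (weight : Fin m → ℕ) (T : ℕ)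
    (𝒮 : Set (Finset (Fin n))) (s : State) : Prop extends HasDegrees edge weight T s where
  best : HasBest edge weight 𝒮 s

theorem Ready.setReg {𝒮 : Set (Finset (Fin n))} {s : State} (h : Ready edge weight T 𝒮 s) {r : ℕ}
    (hr : 6 < r) (v : ℤ) : Ready edge weight T 𝒮 (s.setReg r v) :=
  ⟨h.toHasDegrees.setReg (by omega) v, h.best.congr (by rw [State.setReg_reg, if_neg (by omega)])
    (by rw [State.setReg_reg, if_neg (by omega)]) rfl⟩

theorem Ready.frame {𝒮 : Set (Finset (Fin n))} {c : Cmd} {s s' : State}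
    (h : Ready edge weight T 𝒮 s) (hf : c.Frame s s') (hr : ∀ r ≤ 6, r ∉ c.regs)
    (hA : ∀ A ∈ [0, 1, 2, 4], A ∉ c.arrays) : Ready edge weight T 𝒮 s' :=
  ⟨h.toHasDegrees.frame hf (fun r hr' => hr r (by omega))
    ⟨hA 0 (by decide), hA 1 (by decide), hA 4 (by decide)⟩,
    h.best.frame hf ⟨hr 5 (by decide), hr 6 (by decide)⟩ (hA 2 (by decide))⟩

theorem ok_evalCmd_ready (hb : Fits edge weight T b) {s : State} {𝒮 : Set (Finset (Fin n))}
    (hs : Ready edge weight T 𝒮 s) {S : Finset (Fin n)} (hS : HasCandidate S s) :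
    Ok b evalCmd s (Ready edge weight T (insert S 𝒮)) :=
  (ok_evalCmd hb hs.toHasDegrees hS hs.best).mono fun _ hf h =>
    ⟨hs.toHasDegrees.frame hf (by decide) (by decide), h⟩

/-- A loop in which every pass enlarges the family. -/
theorem ok_familyLoop {i a N : ℕ} {c : Cmd} {s : State} {𝒮 : Set (Finset (Fin n))}
    (P : Fin N → Set (Finset (Fin n)) → Prop)
    (hP : ∀ j 𝒮₁ 𝒮₂, 𝒮₁ ⊆ 𝒮₂ → P j 𝒮₁ → P j 𝒮₂) (hN : s.reg a = N) (hi : 6 < i)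
    (hs : Ready edge weight T 𝒮 s)
    (step : ∀ (j : Fin N) s' 𝒮', (Cmd.loop i a c).Frame s s' →
      Ready edge weight T 𝒮' (s'.setReg i j.1) →
      Ok b c (s'.setReg i j.1) fun s'' => ∃ 𝒮'', 𝒮' ⊆ 𝒮'' ∧ Ready edge weight T 𝒮'' s'' ∧
        P j 𝒮'') :
    Ok b (.loop i a c) s fun s'' => ∃ 𝒮'', 𝒮 ⊆ 𝒮'' ∧ Ready edge weight T 𝒮'' s'' ∧
      ∀ j, P j 𝒮'' := by
  refine .loop (fun j s' => ∃ 𝒮', 𝒮 ⊆ 𝒮' ∧ Ready edge weight T 𝒮' s' ∧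
    ∀ j' : Fin N, j ≤ j'.1 → P j' 𝒮') hN ⟨𝒮, subset_rfl, hs, fun j' h => by omega⟩ ?_ ?_
  · rintro j hj s' hf ⟨𝒮', h1, h2, h3⟩
    refine (step ⟨j, hj⟩ s' 𝒮' hf (h2.setReg hi _)).mono ?_
    rintro s'' - ⟨𝒮'', h4, h5, h6⟩
    refine ⟨𝒮'', h1.trans h4, h5, fun j' hj' => ?_⟩
    rcases hj'.eq_or_lt with h | h
    · have : j' = ⟨j, hj⟩ := Fin.ext h.symm
      rw [this]
      exact h6
    · exact hP _ _ _ h4 (h3 j' h)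
  · rintro s' - ⟨𝒮', h1, h2, h3⟩
    exact ⟨𝒮', h1, h2.setReg hi _, fun j => h3 j (Nat.zero_le _)⟩

variable (edge weight) in
/-- The set `S`, enlarged by the hyperedge `e` if that meets `S` and is heavier than `j`. -/
def igrow (j e : Fin m) (S : Finset (Fin n)) : Finset (Fin n) :=
  if weight j < weight e ∧ (edge e ∩ S).Nonempty then S ∪ edge e else S

theorem subset_igrow (j e : Fin m) (S : Finset (Fin n)) : S ⊆ igrow edge weight j e S := by
  unfold igrow
  split_ifs
  · exact Finset.subset_union_left
  · exact subset_rfl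

theorem igrow_subset {j e : Fin m} {S S' : Finset (Fin n)} (h : S ⊆ S')
    (hS' : IsIntClosed edge weight j S') : igrow edge weight j e S ⊆ S' := by
  unfold igrow
  split_ifs with hc
  · exact Finset.union_subset h (hS' e hc.1 (hc.2.mono (Finset.inter_subset_inter_left h)))
  · exact h

/-- Enlarge the candidate by the hyperedge in register `16`. -/
def growCmd : Cmd :=
  .seq (sumLoop 23 12 0 (.mul (incidenceEx 16 12) (.get 3 (.reg 12))))
    (mapLoop 3 12 0 (.pos (.add (.get 3 (.reg 12))
      (.mul (.pos (.sub (.get 0 (.reg 16)) (.get 0 (.reg 13))))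
        (.mul (.pos (.reg 23)) (incidenceEx 16 12))))))

theorem bitLength_indicator_le (hb : Fits edge weight T b) (p : Prop) [Decidable p] :
    bitLength (if p then 1 else 0) ≤ b := by
  split_ifs
  · rw [bitLength_one]
    exact hb.one_le
  · rw [bitLength_zero]
    exact Nat.zero_le b

theorem ok_growCmd (hb : Fits edge weight T b) {s : State} (hs : HasInput edge weight s)
    {S : Finset (Fin n)} (hS : HasCandidate S s) {j e : Fin m} (hj : s.reg 13 = (j.1 : ℤ))
    (he : s.reg 16 = (e.1 : ℤ)) : Ok b growCmd s (HasCandidate (igrow edge weight j e S)) := by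
  refine .seq (.sumLoopFin hs.reg_zero (by decide) (by decide)
    (fun v => (if v ∈ edge e then (1 : ℤ) else 0) * if v ∈ S then 1 else 0)
    (fun v => by split_ifs <;> norm_num)
    (by rw [sum_incidence_mul]; exact card_lt_two_pow hb _) ?_ ?_)
  · intro v s₁ hr hm hi
    have hin : HasInput edge weight s₁ := hs.congr (hr 0 (by decide) (by decide))
      (hr 1 (by decide) (by decide)) (by rw [hm]) (by rw [hm])
    have h16 : s₁.reg 16 = (e.1 : ℤ) := by rw [hr 16 (by decide) (by decide), he]
    simp only [Ex.val, hin.val_incidence h16 hi]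
    simp only [hi, Int.toNat_natCast, hm, hS v]
  intro s₁ hr₁ hm₁ h23
  rw [sum_incidence_mul] at h23
  have h0 : s₁.reg 0 = n := by rw [hr₁ 0 (by decide) (by decide), hs.reg_zero]
  refine .mapLoopFin h0 (fun v => if v ∈ igrow edge weight j e S then 1 else 0)
    (fun v => bitLength_indicator_le hb _) ?_ ?_
  · intro v s₂ hr hm hm3 hi
    have hin : HasInput edge weight s₂ := hs.congr
      ((hr 0 (by decide)).trans (hr₁ 0 (by decide) (by decide)))
      ((hr 1 (by decide)).trans (hr₁ 1 (by decide) (by decide)))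
      (by rw [hm 0 (by decide), hm₁]) (by rw [hm 1 (by decide), hm₁])
    have h16 : s₂.reg 16 = (e.1 : ℤ) := by
      rw [hr 16 (by decide), hr₁ 16 (by decide) (by decide), he]
    have h13 : s₂.reg 13 = (j.1 : ℤ) := by
      rw [hr 13 (by decide), hr₁ 13 (by decide) (by decide), hj]
    have h23' : s₂.reg 23 = (edge e ∩ S).card := by rw [hr 23 (by decide), h23]
    simp only [Ex.val, hin.val_incidence h16 hi]
    simp only [hi, h16, h13, h23', Int.toNat_natCast, hm3, hm₁, hS v, hin.weights, sub_pos,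
      Nat.cast_pos, Finset.card_pos, Nat.cast_lt, igrow]
    by_cases c1 : weight j < weight e <;> by_cases c2 : (edge e ∩ S).Nonempty <;>
      by_cases c3 : v ∈ S <;> by_cases c4 : v ∈ edge e <;> simp [c1, c2, c3, c4]
  · intro s₂ _ _ h3
    exact h3

/-- Compute the component of the vertex in register `14` at the level of the hyperedge in
register `13`. -/
def componentCmd : Cmd :=
  .seq (mapLoop 3 11 0 (.lit 0)) (.seq (.put 3 (.reg 14) (.lit 1))
    (.loop 15 0 (.loop 16 1 growCmd)))

/-- One pass over all hyperedges. If it leaves the set unchanged, no heavier hyperedge that meets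
the set sticks out, so the set was closed already. -/
theorem ok_growLoop (hb : Fits edge weight T b) {s : State} (hs : HasInput edge weight s)
    {S : Finset (Fin n)} (hS : HasCandidate S s) {j : Fin m} (hj : s.reg 13 = (j.1 : ℤ)) :
    Ok b (.loop 16 1 growCmd) s fun s' => ∃ S₁, HasCandidate S₁ s' ∧ S ⊆ S₁ ∧
      (∀ S', IsIntClosed edge weight j S' → S ⊆ S' → S₁ ⊆ S') ∧
      (S₁ = S → IsIntClosed edge weight j S) := by
  refine .loop (fun i s' => ∃ S₁, HasCandidate S₁ s' ∧ S ⊆ S₁ ∧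
      (∀ S', IsIntClosed edge weight j S' → S ⊆ S' → S₁ ⊆ S') ∧
      (S₁ = S → ∀ e : Fin m, i ≤ e.1 → weight j < weight e → (edge e ∩ S).Nonempty →
        edge e ⊆ S)) hs.reg_one
    ⟨S, hS, subset_rfl, fun _ _ h => h, fun _ e he => by omega⟩ ?_ ?_
  · rintro i hi s' hf ⟨S₁, h1, h2, h3, h4⟩
    have hin : HasInput edge weight (s'.setReg 16 i) :=
      (hs.frame hf (by decide) (by decide)).setReg (by decide) _
    have h13 : (s'.setReg 16 i).reg 13 = (j.1 : ℤ) := by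
      rw [State.setReg_reg, if_neg (by decide), hf.1 13 (by decide), hj]
    refine (ok_growCmd hb hin (h1.congr rfl) (e := ⟨i, hi⟩) h13 (by simp)).mono ?_
    intro s'' _ hc
    refine ⟨_, hc, h2.trans (subset_igrow _ _ _),
      fun S' hS' hSS' => igrow_subset (h3 S' hS' hSS') hS', ?_⟩
    intro heq e he hlt hne
    have h5 : S₁ = S := subset_antisymm ((subset_igrow j ⟨i, hi⟩ S₁).trans heq.subset) h2
    rcases he.eq_or_lt with h | h
    · have h6 : e = ⟨i, hi⟩ := Fin.ext h.symm
      rw [h5, ← h6, igrow, if_pos ⟨hlt, hne⟩] at heq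
      exact Finset.union_eq_left.1 heq
    · exact h4 h5 e h hlt hne
  · rintro s' - ⟨S₁, h1, h2, h3, h4⟩
    exact ⟨S₁, h1.congr rfl, h2, h3, fun h e => h4 h e (Nat.zero_le _)⟩

theorem ok_singleton (hb : Fits edge weight T b) {s : State} {A : ℕ}
    (h0 : s.reg 0 = n) {v : Fin n} (hv : s.reg 14 = (v.1 : ℤ)) {c : Cmd} {Q : State → Prop}
    (h : ∀ s', (∀ r, r ≠ 11 → s'.reg r = s.reg r) → (∀ A', A' ≠ A → s'.mem A' = s.mem A') →
      (∀ w : Fin n, s'.mem A w = if w = v then 1 else 0) → Ok b c s' Q) :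
    Ok b (.seq (mapLoop A 11 0 (.lit 0)) (.seq (.put A (.reg 14) (.lit 1)) c)) s Q := by
  refine .seq (.mapLoopFin h0 (fun _ => 0) (fun _ => by simp [bitLength_zero])
    (fun _ _ _ _ _ _ => rfl) ?_)
  intro s₁ hr hm hA
  refine .seq (.put (by simpa [Ex.val, bitLength_one] using hb.one_le) (h _ hr ?_ ?_))
  · intro A' hA'
    rw [State.setMem_mem_of_ne _ _ _ hA', hm A' hA']
  · intro w
    rw [State.setMem_mem]
    simp only [Ex.val, hr 14 (by decide), hv, Int.toNat_natCast, true_and, hA, Fin.val_inj]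

/-- As many passes as vertices suffice: until the set is closed, every pass adds a vertex, so `n + 1
≤ S.card + p` persists with `p` passes left, and at `p = 0` this is impossible. -/
theorem ok_componentCmd (hb : Fits edge weight T b) {s : State} (hs : HasInput edge weight s)
    {j : Fin m} {v : Fin n} (hj : s.reg 13 = (j.1 : ℤ)) (hv : s.reg 14 = (v.1 : ℤ)) :
    Ok b componentCmd s fun s' => ∃ S, IsIntComponent edge weight j v S ∧ HasCandidate S s' := by
  refine ok_singleton hb hs.reg_zero hv fun s₁ hr₁ hm₁ h3 => ?_
  have hin : HasInput edge weight s₁ := hs.congr (hr₁ 0 (by decide)) (hr₁ 1 (by decide))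
    (hm₁ 0 (by decide)) (hm₁ 1 (by decide))
  refine .loop (fun p s' => ∃ S, HasCandidate S s' ∧ v ∈ S ∧
    (∀ S', v ∈ S' → IsIntClosed edge weight j S' → S ⊆ S') ∧
    (IsIntClosed edge weight j S ∨ n + 1 ≤ S.card + p)) hin.reg_zero
    ⟨{v}, fun w => by simp [h3 w], Finset.mem_singleton_self v,
      fun S' hv _ => Finset.singleton_subset_iff.2 hv, Or.inr (by simp [add_comm])⟩ ?_ ?_
  · rintro p hp s' hf ⟨S, h4, h5, h6, h7⟩
    have hin' : HasInput edge weight (s'.setReg 15 p) :=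
      (hin.frame hf (by decide) (by decide)).setReg (by decide) _
    have h13 : (s'.setReg 15 p).reg 13 = (j.1 : ℤ) := by
      rw [State.setReg_reg, if_neg (by decide), hf.1 13 (by decide), hr₁ 13 (by decide), hj]
    refine (ok_growLoop hb hin' (h4.congr rfl) h13).mono ?_
    rintro s'' - ⟨S₁, h8, h9, h10, h11⟩
    refine ⟨S₁, h8, h9 h5, fun S' hv hS' => h10 S' hS' (h6 S' hv hS'), ?_⟩
    by_cases heq : S₁ = S
    · rw [heq]
      exact Or.inl (h11 heq)
    · right
      rcases h7 with h7 | h7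
      · exact absurd (subset_antisymm (h10 S h7 subset_rfl) h9) heq
      · have : S.card < S₁.card :=
          Finset.card_lt_card (h9.ssubset_of_ne fun h => heq h.symm)
        omega
  · rintro s' - ⟨S, h4, h5, h6, h7⟩
    refine ⟨S, ⟨h5, ?_, h6⟩, h4.congr rfl⟩
    rcases h7 with h7 | h7
    · exact h7
    · have := Finset.card_le_univ S
      rw [Fintype.card_fin] at this
      omega

/-- Evaluate all components. -/
def componentsCmd : Cmd := .loop 13 1 (.loop 14 0 (.seq componentCmd evalCmd))

theorem ok_componentsCmd (hb : Fits edge weight T b) {s : State} {𝒮 : Set (Finset (Fin n))}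
    (hs : Ready edge weight T 𝒮 s) :
    Ok b componentsCmd s fun s' => ∃ 𝒮', 𝒮 ⊆ 𝒮' ∧ Ready edge weight T 𝒮' s' ∧
      ∀ j v, ∃ S ∈ 𝒮', IsIntComponent edge weight j v S := by
  refine ok_familyLoop (fun j 𝒮' => ∀ v, ∃ S ∈ 𝒮', IsIntComponent edge weight j v S) ?_
    hs.reg_one (by decide) hs ?_
  · intro j 𝒮₁ 𝒮₂ h12 h v
    obtain ⟨S, hS, h'⟩ := h v
    exact ⟨S, h12 hS, h'⟩
  intro j s₁ 𝒮₁ hf₁ hs₁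
  refine ok_familyLoop (fun v 𝒮' => ∃ S ∈ 𝒮', IsIntComponent edge weight j v S) ?_
    hs₁.reg_zero (by decide) hs₁ ?_
  · rintro v 𝒮₁ 𝒮₂ h12 ⟨S, hS, h'⟩
    exact ⟨S, h12 hS, h'⟩
  intro v s₂ 𝒮₂ hf₂ hs₂
  have h13 : (s₂.setReg 14 v.1).reg 13 = (j.1 : ℤ) := by
    rw [State.setReg_reg, if_neg (by decide), hf₂.1 13 (by decide), State.setReg_reg, if_pos rfl]
  refine .seq ((ok_componentCmd hb hs₂.toHasInput h13 (v := v) (by simp)).mono ?_)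
  rintro s₃ hf₃ ⟨S, hS, hc⟩
  refine (ok_evalCmd_ready hb (hs₂.frame hf₃ (by decide) (by decide)) hc).mono ?_
  intro s₄ _ h
  exact ⟨insert S 𝒮₂, Set.subset_insert _ _, h, S, Set.mem_insert _ _, hS⟩

end Components

/-! ### Power iteration in integers, sweep cuts and the main program -/

section Walks

variable {n m : ℕ} {edge : Fin m → Finset (Fin n)} {weight : Fin m → ℕ} {T b : ℕ}

/-- Array `A` holds the vector `x`. -/
def HasVector {N : ℕ} (A : ℕ) (x : Fin N → ℤ) (s : State) : Prop := ∀ v : Fin N, s.mem A v = x v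

theorem HasVector.congr {N A : ℕ} {x : Fin N → ℤ} {s s' : State} (h : HasVector A x s)
    (hA : s'.mem A = s.mem A) : HasVector A x s' := fun v => by rw [hA, h v]

/-- The sums over the hyperedges of the vector in array `5`, in array `6`. -/
def pushCmd : Cmd :=
  .loop 11 1 (.seq (sumLoop 23 12 0 (.mul (incidenceEx 11 12) (.get 5 (.reg 12))))
    (.put 6 (.reg 11) (.reg 23)))

theorem ok_pushCmd {s : State} (hs : HasInput edge weight s) {x : Fin n → ℤ} (hx : ∀ v, 0 ≤ x v)
    (hxs : HasVector 5 x s) (hb : ∀ j, ∑ w, (if w ∈ edge j then x w else 0) < 2 ^ b) :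
    Ok b pushCmd s (HasVector 6 fun j => ∑ w, if w ∈ edge j then x w else 0) := by
  have hnonneg : ∀ j w, 0 ≤ if w ∈ edge j then x w else 0 := by
    intro j w
    split_ifs
    · exact hx w
    · exact le_rfl
  refine .loop (fun i s' => ∀ j : Fin m, i ≤ j.1 → s'.mem 6 j.1 =
    ∑ w, if w ∈ edge j then x w else 0) hs.reg_one (fun j h => by omega) ?_
    (fun s' _ h j => h j (Nat.zero_le _))
  intro i hi s₁ hf h
  have hin : HasInput edge weight (s₁.setReg 11 i) :=
    (hs.frame hf (by decide) (by decide)).setReg (by decide) _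
  refine .seq (.sumLoopFin hin.reg_zero (by decide) (by decide)
    (fun w => if w ∈ edge ⟨i, hi⟩ then x w else 0) (hnonneg _) (hb _) ?_ ?_)
  · intro w s₂ hr hm hw
    have hin₂ : HasInput edge weight s₂ := hin.congr (hr 0 (by decide) (by decide))
      (hr 1 (by decide) (by decide)) (by rw [hm]) (by rw [hm])
    have h11 : s₂.reg 11 = ((⟨i, hi⟩ : Fin m).1 : ℤ) := by
      rw [hr 11 (by decide) (by decide), State.setReg_reg, if_pos rfl]
    simp only [Ex.val, hin₂.val_incidence h11 hw]
    simp only [hw, Int.toNat_natCast, hm, State.setReg_mem, hf.2 5 (by decide), hxs w, ite_mul,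
      one_mul, zero_mul]
  intro s₂ hr hm h23
  refine .put ?_ ?_
  · rw [Ex.val, h23]
    exact bitLength_le_of_nonneg (Finset.sum_nonneg fun w _ => hnonneg _ w) (hb _)
  · intro j hj
    rw [State.setMem_mem]
    simp only [Ex.val, hr 11 (by decide) (by decide), State.setReg_reg, if_true,
      Int.toNat_natCast, true_and]
    split_ifs with hji
    · have : j = ⟨i, hi⟩ := Fin.ext hji
      rw [h23, this]
    · rw [hm, State.setReg_mem]
      exact h j (by omega)

/-- Replace the vector in array `5` by the next one, given the sums over the hyperedges. -/
def updateCmd : Cmd :=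
  .loop 11 0 (.seq (sumLoop 23 12 1 (.mul (incidenceEx 12 11)
      (.mul (.get 0 (.reg 12)) (.get 6 (.reg 12)))))
    (.put 5 (.reg 11) (.mul (.reg 23) (.div (.reg 4) (.get 4 (.reg 11))))))

variable (edge weight) in
theorem ipush_nonneg {x : Fin n → ℤ} (hx : ∀ v, 0 ≤ x v) (u : Fin n) :
    0 ≤ ipush edge weight x u := by
  refine Finset.sum_nonneg fun j _ => ?_
  split_ifs
  · refine mul_nonneg (Nat.cast_nonneg _) (Finset.sum_nonneg fun w _ => ?_)
    split_ifs
    · exact hx w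
    · exact le_rfl
  · exact le_rfl

variable (edge weight) in
theorem istep_nonneg {x : Fin n → ℤ} (hx : ∀ v, 0 ≤ x v) (u : Fin n) :
    0 ≤ istep edge weight x u :=
  mul_nonneg (ipush_nonneg edge weight hx u) (Int.ediv_nonneg
    (zero_le_one.trans (one_le_idegProd edge weight)) (ideg_nonneg edge weight u))

/-- The new entries depend on the old vector only through the hyperedge sums in array `6`, so array
`5` may be overwritten while the loop runs. -/
theorem ok_updateCmd {s : State} (hs : HasDegrees edge weight T s) {x : Fin n → ℤ}
    (hx : ∀ v, 0 ≤ x v)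
    (hxs : HasVector 6 (fun j => ∑ w, if w ∈ edge j then x w else 0) s)
    (hb : ∀ u, ipush edge weight x u < 2 ^ b) (hb' : ∀ u, istep edge weight x u < 2 ^ b) :
    Ok b updateCmd s (HasVector 5 (istep edge weight x)) := by
  refine .loop (fun i s' => ∀ u : Fin n, i ≤ u.1 → s'.mem 5 u.1 = istep edge weight x u)
    hs.reg_zero (fun j h => by omega) ?_ (fun s' _ h j => h j (Nat.zero_le _))
  intro i hi s₁ hf h
  have hdeg : HasDegrees edge weight T (s₁.setReg 11 i) :=
    (hs.frame hf (by decide) (by decide)).setReg (by decide) _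
  refine .seq (.sumLoopFin hdeg.reg_one (by decide) (by decide)
    (fun j => if (⟨i, hi⟩ : Fin n) ∈ edge j then (weight j : ℤ) *
      ∑ w, (if w ∈ edge j then x w else 0) else 0) (fun j => ?_) (hb ⟨i, hi⟩) ?_ ?_)
  · split_ifs
    · refine mul_nonneg (Nat.cast_nonneg _) (Finset.sum_nonneg fun w _ => ?_)
      split_ifs
      · exact hx w
      · exact le_rfl
    · exact le_rfl
  · intro j s₂ hr hm hj
    have hin₂ : HasInput edge weight s₂ := hdeg.toHasInput.congr (hr 0 (by decide) (by decide))
      (hr 1 (by decide) (by decide)) (by rw [hm]) (by rw [hm])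
    have h11 : s₂.reg 11 = ((⟨i, hi⟩ : Fin n).1 : ℤ) := by
      rw [hr 11 (by decide) (by decide), State.setReg_reg, if_pos rfl]
    simp only [Ex.val, hin₂.val_incidence hj h11]
    simp only [hj, Int.toNat_natCast, hin₂.weights, ite_mul, one_mul, zero_mul]
    rw [hm, State.setReg_mem, hf.2 6 (by decide), hxs j]
  intro s₂ hr hm h23
  have hval : Ex.val (.mul (.reg 23) (.div (.reg 4) (.get 4 (.reg 11)))) s₂ =
      istep edge weight x ⟨i, hi⟩ := by
    have h11 : s₂.reg 11 = (i : ℤ) := by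
      rw [hr 11 (by decide) (by decide), State.setReg_reg, if_pos rfl]
    have h4 : s₂.reg 4 = idegProd edge weight := by
      rw [hr 4 (by decide) (by decide), hdeg.reg_four]
    have hd : s₂.mem 4 i = ideg edge weight ⟨i, hi⟩ := by
      rw [hm]
      exact hdeg.degrees ⟨i, hi⟩
    simp only [Ex.val, h23, h4, h11, Int.toNat_natCast, hd]
    rfl
  refine .put ?_ ?_
  · rw [hval]
    exact bitLength_le_of_nonneg (istep_nonneg edge weight hx _) (hb' _)
  · intro u hu
    rw [State.setMem_mem, hval]
    simp only [Ex.val, hr 11 (by decide) (by decide), State.setReg_reg, if_true,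
      Int.toNat_natCast, true_and]
    split_ifs with hui
    · have : u = ⟨i, hi⟩ := Fin.ext hui
      rw [this]
    · rw [hm, State.setReg_mem]
      exact h u (by omega)

variable (edge weight) in
theorem iterate_istep_nonneg (v : Fin n) (t : ℕ) (u : Fin n) :
    0 ≤ (istep edge weight)^[t] (Pi.single v 1) u := by
  induction t generalizing u with
  | zero =>
    rw [Function.iterate_zero, id, Pi.single_apply]
    split_ifs <;> norm_num
  | succ t ih =>
    rw [Function.iterate_succ_apply']
    exact istep_nonneg edge weight ih u

/-- The power iteration from the vertex in register `14`. -/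
def powerCmd : Cmd :=
  .seq (mapLoop 5 11 0 (.lit 0)) (.seq (.put 5 (.reg 14) (.lit 1))
    (.loop 15 2 (.seq pushCmd updateCmd)))

theorem ok_powerCmd (hb : Fits edge weight T b) {s : State} (hs : HasDegrees edge weight T s)
    {v : Fin n} (hv : s.reg 14 = (v.1 : ℤ)) :
    Ok b powerCmd s (HasVector 5 ((istep edge weight)^[T] (Pi.single v 1))) := by
  refine ok_singleton hb hs.reg_zero hv fun s₁ hr₁ hm₁ h5 => ?_
  have hdeg : HasDegrees edge weight T s₁ := hs.congr (fun r hr => hr₁ r (by omega))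
    (hm₁ 0 (by decide)) (hm₁ 1 (by decide)) (hm₁ 4 (by decide))
  -- The counter runs downwards: with `i` passes left, `T - i` steps have been made.
  refine .loop (fun i s' => HasVector 5 ((istep edge weight)^[T - i] (Pi.single v 1)) s')
    hdeg.reg_two ?_ ?_ (fun s' _ h => h.congr rfl)
  · intro w
    rw [h5 w, Nat.sub_self, Function.iterate_zero, id, Pi.single_apply]
  · intro i hi s₂ hf h
    have hdeg₂ : HasDegrees edge weight T (s₂.setReg 15 i) :=
      (hdeg.frame hf (by decide) (by decide)).setReg (by decide) _
    have hx := iterate_istep_nonneg edge weight v (T - (i + 1))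
    have hlt : T - (i + 1) < T := by omega
    have hsucc : T - i = T - (i + 1) + 1 := by omega
    refine .seq ((ok_pushCmd hdeg₂.toHasInput hx (h.congr rfl)
      (hb.edgeSum v _ hlt)).mono ?_)
    intro s₃ hf₃ h6
    have hdeg₃ := hdeg₂.frame hf₃ (by decide) (by decide)
    rw [hsucc, Function.iterate_succ_apply']
    refine ok_updateCmd hdeg₃ hx h6 (hb.push v _ hlt) fun u => ?_
    have := hb.step v _ hlt u
    rwa [Function.iterate_succ_apply'] at this

/-- Evaluate the sets of the vertices with at least and at most the value of the vertex in
register `16`. -/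
def sweepCmd : Cmd :=
  .loop 16 0 (.seq
    (mapLoop 3 11 0 (.pos (.add (.sub (.get 5 (.reg 11)) (.get 5 (.reg 16))) (.lit 1))))
    (.seq evalCmd (.seq
      (mapLoop 3 11 0 (.pos (.add (.sub (.get 5 (.reg 16)) (.get 5 (.reg 11))) (.lit 1))))
      evalCmd)))

theorem ok_sweepCmd (hb : Fits edge weight T b) {s : State} {𝒮 : Set (Finset (Fin n))}
    (hs : Ready edge weight T 𝒮 s) {x : Fin n → ℤ} (hx : HasVector 5 x s) :
    Ok b sweepCmd s fun s' => ∃ 𝒮', 𝒮 ⊆ 𝒮' ∧ Ready edge weight T 𝒮' s' ∧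
      ∀ w, (Finset.univ.filter fun u => x w ≤ x u) ∈ 𝒮' ∧
        (Finset.univ.filter fun u => x u ≤ x w) ∈ 𝒮' := by
  refine ok_familyLoop (fun w 𝒮' => (Finset.univ.filter fun u => x w ≤ x u) ∈ 𝒮' ∧
    (Finset.univ.filter fun u => x u ≤ x w) ∈ 𝒮') ?_ hs.reg_zero (by decide) hs ?_
  · exact fun w 𝒮₁ 𝒮₂ h12 h => ⟨h12 h.1, h12 h.2⟩
  intro w s₁ 𝒮₁ hf₁ hs₁
  have hx₁ : HasVector 5 x (s₁.setReg 16 w) := hx.congr (hf₁.2 5 (by decide))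
  have h16 : (s₁.setReg 16 w).reg 16 = (w.1 : ℤ) := by simp
  refine .seq ((Ok.mapLoopFin (Q := HasCandidate (Finset.univ.filter fun u => x w ≤ x u))
    hs₁.reg_zero (fun u => if x w ≤ x u then 1 else 0)
    (fun u => bitLength_indicator_le hb _) ?_ ?_).mono ?_)
  · intro u s₂ hr hm h3 hu
    simp only [Ex.val, hu, hr 16 (by decide), h16, Int.toNat_natCast, hm 5 (by decide), hx₁ u,
      hx₁ w]
    exact if_congr (by omega) rfl rfl
  · intro s₂ _ _ h u
    simp [h u]
  intro s₂ hf₂ hc₂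
  have hs₂ := hs₁.frame hf₂ (by decide) (by decide)
  refine .seq ((ok_evalCmd_ready hb hs₂ hc₂).mono fun s₃ hf₃ hs₃ => ?_)
  have hx₃ : HasVector 5 x s₃ :=
    hx₁.congr ((hf₃.2 5 (by decide)).trans (hf₂.2 5 (by decide)))
  have h16₃ : s₃.reg 16 = (w.1 : ℤ) := by
    rw [hf₃.1 16 (by decide), hf₂.1 16 (by decide), h16]
  refine .seq ((Ok.mapLoopFin (Q := HasCandidate (Finset.univ.filter fun u => x u ≤ x w))
    hs₃.reg_zero (fun u => if x u ≤ x w then 1 else 0)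
    (fun u => bitLength_indicator_le hb _) ?_ ?_).mono ?_)
  · intro u s₄ hr hm h3 hu
    simp only [Ex.val, hu, hr 16 (by decide), h16₃, Int.toNat_natCast, hm 5 (by decide), hx₃ u,
      hx₃ w]
    exact if_congr (by omega) rfl rfl
  · intro s₄ _ _ h u
    simp [h u]
  intro s₄ hf₄ hc₄
  have hs₄ := hs₃.frame hf₄ (by decide) (by decide)
  refine (ok_evalCmd_ready hb hs₄ hc₄).mono fun s₅ _ hs₅ => ⟨_, ?_, hs₅, ?_, ?_⟩
  · exact (Set.subset_insert _ _).trans (Set.subset_insert _ _)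
  · exact Set.mem_insert_of_mem _ (Set.mem_insert _ _)
  · exact Set.mem_insert _ _

/-- Evaluate the level sets of the power iterations from all vertices. -/
def walksCmd : Cmd := .loop 14 0 (.seq powerCmd sweepCmd)

theorem ok_walksCmd (hb : Fits edge weight T b) {s : State} {𝒮 : Set (Finset (Fin n))}
    (hs : Ready edge weight T 𝒮 s) :
    Ok b walksCmd s fun s' => ∃ 𝒮', 𝒮 ⊆ 𝒮' ∧ Ready edge weight T 𝒮' s' ∧ ∀ v w,
      (Finset.univ.filter fun u => (istep edge weight)^[T] (Pi.single v 1) w ≤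
        (istep edge weight)^[T] (Pi.single v 1) u) ∈ 𝒮' ∧
      (Finset.univ.filter fun u => (istep edge weight)^[T] (Pi.single v 1) u ≤
        (istep edge weight)^[T] (Pi.single v 1) w) ∈ 𝒮' := by
  refine ok_familyLoop (fun v 𝒮' => ∀ w,
      (Finset.univ.filter fun u => (istep edge weight)^[T] (Pi.single v 1) w ≤
        (istep edge weight)^[T] (Pi.single v 1) u) ∈ 𝒮' ∧
      (Finset.univ.filter fun u => (istep edge weight)^[T] (Pi.single v 1) u ≤
        (istep edge weight)^[T] (Pi.single v 1) w) ∈ 𝒮') ?_ hs.reg_zero (by decide) hs ?_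
  · exact fun v 𝒮₁ 𝒮₂ h12 h w => ⟨h12 (h w).1, h12 (h w).2⟩
  intro v s₁ 𝒮₁ hf₁ hs₁
  refine .seq ((ok_powerCmd hb hs₁.toHasDegrees (v := v) (by simp)).mono fun s₂ hf₂ hx => ?_)
  exact ok_sweepCmd hb (hs₁.frame hf₂ (by decide) (by decide)) hx

/-- Compute the degrees, the total volume and the product of the non-zero degrees. -/
def prepareCmd : Cmd :=
  .seq (.set 3 (.lit 0)) (.seq (.set 4 (.lit 1)) (.seq (.loop 10 0
    (.seq (sumLoop 20 11 1 (.mul (.get 0 (.reg 11)) (incidenceEx 11 10)))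
      (.seq (.put 4 (.reg 10) (.reg 20)) (.seq (.set 3 (.add (.reg 3) (.reg 20)))
        (.set 4 (.mul (.reg 4) (.add (.reg 20) (.sub (.lit 1) (.pos (.reg 20))))))))))
    (.seq (.set 5 (.lit 1)) (.set 6 (.lit 0)))))

theorem ok_prepareCmd (hb : Fits edge weight T b) {s : State} (hs : HasInput edge weight s)
    (h2 : s.reg 2 = T) (m2 : ∀ v, s.mem 2 v = 0) :
    Ok b prepareCmd s (Ready edge weight T ∅) := by
  set D : ℕ → ℤ := fun i => if h : i < n then ideg edge weight ⟨i, h⟩ else 0 with hD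
  set E : ℕ → ℤ := fun i => if 0 < D i then D i else 1 with hE
  have hD0 : ∀ i, 0 ≤ D i := by
    intro i
    simp only [hD]
    split_ifs
    · exact ideg_nonneg _ _ _
    · exact le_rfl
  have hE1 : ∀ i, 1 ≤ E i := by
    intro i
    simp only [hE]
    split_ifs with h
    · exact h
    · exact le_rfl
  have hDsum : ∑ i ∈ Finset.range n, D i = itotal edge weight := by
    rw [Finset.sum_range]
    exact Finset.sum_congr rfl fun i _ => by simp [hD]
  have hEprod : ∏ i ∈ Finset.range n, E i = idegProd edge weight := by
    rw [Finset.prod_range]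
    exact Finset.prod_congr rfl fun i _ => by simp [hE, hD]
  have hDlt : ∀ i, ∑ i' ∈ Finset.Ico i n, D i' < 2 ^ b := by
    intro i
    refine lt_of_le_of_lt ?_ hb.total
    rw [← hDsum, Finset.range_eq_Ico]
    exact Finset.sum_le_sum_of_subset_of_nonneg (Finset.Ico_subset_Ico_left (Nat.zero_le i))
      fun _ _ _ => hD0 _
  have hElt : ∀ i, ∏ i' ∈ Finset.Ico i n, E i' < 2 ^ b := by
    intro i
    refine lt_of_le_of_lt ?_ hb.degProd
    rw [← hEprod, Finset.range_eq_Ico]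
    exact Finset.prod_le_prod_of_subset_of_one_le
      (Finset.Ico_subset_Ico_left (Nat.zero_le i)) (fun _ _ => zero_le_one.trans (hE1 _))
      fun _ _ _ => hE1 _
  have hbit1 : bitLength 1 ≤ b := by rw [bitLength_one]; exact hb.one_le
  refine .seq (.set (by simp [Ex.val, bitLength_zero]) (.seq (.set hbit1 (.seq ?_))))
  refine .loop (fun i s' => s'.mem 2 = s.mem 2 ∧ s'.reg 3 = ∑ i' ∈ Finset.Ico i n, D i' ∧
    s'.reg 4 = ∏ i' ∈ Finset.Ico i n, E i' ∧
    ∀ v : Fin n, i ≤ v.1 → s'.mem 4 v = ideg edge weight v) (N := n) ?_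
    ⟨rfl, by simp [Ex.val], by simp [Ex.val], fun v h => by omega⟩ ?_ ?_
  · simpa using hs.reg_zero
  · rintro i hi s₁ hf ⟨h3, h4, h5, h6⟩
    have hin : HasInput edge weight (s₁.setReg 10 i) :=
      (((hs.setReg (by decide) _).setReg (by decide) _).frame hf (by decide)
        (by decide)).setReg (by decide) _
    refine .seq (.sumLoopFin hin.reg_one (by decide) (by decide)
      (fun j => if (⟨i, hi⟩ : Fin n) ∈ edge j then (weight j : ℤ) else 0)
      (fun j => by split_ifs <;> positivity) ?_ ?_ ?_)
    · refine lt_of_le_of_lt (Finset.sum_le_sum fun j _ => ?_) hb.weights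
      split_ifs
      · exact le_rfl
      · positivity
    · intro j s₂ hr hm hj
      have hin₂ : HasInput edge weight s₂ := hin.congr (hr 0 (by decide) (by decide))
        (hr 1 (by decide) (by decide)) (by rw [hm]) (by rw [hm])
      have h10 : s₂.reg 10 = ((⟨i, hi⟩ : Fin n).1 : ℤ) := by
        rw [hr 10 (by decide) (by decide), State.setReg_reg, if_pos rfl]
      simp only [Ex.val, hin₂.val_incidence hj h10]
      simp only [hj, Int.toNat_natCast, hin₂.weights, mul_ite, mul_one, mul_zero]
    intro s₂ hr hm h20
    have h20' : s₂.reg 20 = D i := by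
      rw [h20]
      simp only [hD, hi, dif_pos]
      rfl
    have h10 : s₂.reg 10 = (i : ℤ) := by
      rw [hr 10 (by decide) (by decide), State.setReg_reg, if_pos rfl]
    have e3 : s₂.reg 3 = ∑ i' ∈ Finset.Ico (i + 1) n, D i' := by
      rw [hr 3 (by decide) (by decide), State.setReg_reg, if_neg (by decide), h4]
    have e4 : s₂.reg 4 = ∏ i' ∈ Finset.Ico (i + 1) n, E i' := by
      rw [hr 4 (by decide) (by decide), State.setReg_reg, if_neg (by decide), h5]
    have hDi : D i < 2 ^ b := by
      refine lt_of_le_of_lt ?_ (hDlt i)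
      exact Finset.single_le_sum (fun _ _ => hD0 _) (Finset.mem_Ico.2 ⟨le_rfl, hi⟩)
    have v3 : D i + ∑ i' ∈ Finset.Ico (i + 1) n, D i' = ∑ i' ∈ Finset.Ico i n, D i' :=
      (Finset.sum_eq_sum_Ico_succ_bot hi D).symm
    have v4 : (∏ i' ∈ Finset.Ico (i + 1) n, E i') * E i = ∏ i' ∈ Finset.Ico i n, E i' := by
      rw [Finset.prod_eq_prod_Ico_succ_bot hi, mul_comm]
    -- Adding `1` minus the indicator of positivity turns a zero degree into the factor 1 and leaves
    -- the others alone.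
    have vE : D i + (1 - if 0 < D i then 1 else 0) = E i := by
      simp only [hE]
      have := hD0 i
      split_ifs <;> omega
    refine .seq (.put ?_ (.seq (.set ?_ (.set ?_ ⟨?_, ?_, ?_, ?_⟩))))
    · rw [Ex.val, h20']
      exact bitLength_le_of_nonneg (hD0 i) hDi
    · simp only [Ex.val, State.setMem_reg, h20', e3]
      rw [add_comm, v3]
      exact bitLength_le_of_nonneg (Finset.sum_nonneg fun _ _ => hD0 _) (hDlt i)
    · simp only [Ex.val, State.setMem_reg, State.setReg_reg, h20', e4]
      norm_num
      rw [vE, v4]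
      exact bitLength_le_of_nonneg (Finset.prod_nonneg fun _ _ => zero_le_one.trans (hE1 _))
        (hElt i)
    · simp only [State.setReg_mem]
      rw [State.setMem_mem_of_ne _ _ _ (by decide), hm]
      exact h3
    · simp only [Ex.val, State.setMem_reg, State.setReg_reg, h20', e3]
      norm_num
      rw [add_comm, v3]
    · simp only [Ex.val, State.setMem_reg, State.setReg_reg, h20', e4]
      norm_num
      rw [vE, v4]
    · intro v hv
      simp only [State.setReg_mem]
      rw [State.setMem_mem]
      simp only [Ex.val, h10, h20', Int.toNat_natCast, true_and]
      split_ifs with hvi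
      · simp only [hD, ← hvi, v.2, dif_pos]
      · rw [hm]
        exact h6 v (by omega)
  · rintro s₁ hf ⟨h3, h4, h5, h6⟩
    have hin : HasInput edge weight s₁ :=
      ((hs.setReg (by decide) _).setReg (by decide) _).frame hf (by decide) (by decide)
    refine .seq (.set hbit1 (.set (by simp [Ex.val, bitLength_zero]) ⟨⟨?_, ?_, ?_, ?_, ?_⟩, ?_⟩))
    · exact ((hin.setReg (by decide) _).setReg (by decide) _).setReg (by decide) _
    · have := hf.1 2 (by decide)
      simpa [h2] using this
    · simpa [hDsum] using h4
    · simpa [hEprod] using h5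
    · exact fun v => h6 v (Nat.zero_le _)
    · refine ⟨∅, fun v => ?_, Or.inl ⟨rfl, rfl, by simp⟩⟩
      simp [h3, m2]

/-- The number of steps of the power iterations, in register `2`. -/
def stepsCmd : Cmd :=
  .set 2 (.mul (.mul (.mul (.mul (.mul (.mul (.reg 0) (.reg 0)) (.reg 0)) (.reg 0)) (.reg 0))
    (.reg 1)) (.reg 1))

theorem ok_stepsCmd {s : State} (hs : HasInput edge weight s)
    (hb : Fits edge weight (n ^ 5 * m ^ 2) b) :
    Ok b stepsCmd s fun s' => HasInput edge weight s' ∧ s'.reg 2 = (n ^ 5 * m ^ 2 : ℕ) ∧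
      s'.mem = s.mem := by
  have hval : Ex.val (.mul (.mul (.mul (.mul (.mul (.mul (.reg 0) (.reg 0)) (.reg 0)) (.reg 0))
      (.reg 0)) (.reg 1)) (.reg 1)) s = (n ^ 5 * m ^ 2 : ℕ) := by
    simp only [Ex.val, hs.reg_zero, hs.reg_one]
    push_cast
    ring
  refine .set ?_ ⟨hs.setReg (by decide) _, ?_, rfl⟩
  · rw [hval]
    exact bitLength_le_of_nonneg (Int.natCast_nonneg _) hb.steps
  · rw [State.setReg_reg, if_pos rfl, hval]

/-- The main part of the algorithm. -/
def mainCmd : Cmd := .seq prepareCmd (.seq componentsCmd walksCmd)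

theorem ok_mainCmd (hb : Fits edge weight T b) {s : State} (hs : HasInput edge weight s)
    (h2 : s.reg 2 = T) (m2 : ∀ v, s.mem 2 v = 0) :
    Ok b mainCmd s fun s' => ∃ 𝒮, HasBest edge weight 𝒮 s' ∧
      (∀ j v, ∃ S ∈ 𝒮, IsIntComponent edge weight j v S) ∧ ∀ v w,
      (Finset.univ.filter fun u => (istep edge weight)^[T] (Pi.single v 1) w ≤
        (istep edge weight)^[T] (Pi.single v 1) u) ∈ 𝒮 ∧
      (Finset.univ.filter fun u => (istep edge weight)^[T] (Pi.single v 1) u ≤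
        (istep edge weight)^[T] (Pi.single v 1) w) ∈ 𝒮 := by
  refine .seq ((ok_prepareCmd hb hs h2 m2).mono fun s₁ _ hs₁ => ?_)
  refine .seq ((ok_componentsCmd hb hs₁).mono ?_)
  rintro s₂ - ⟨𝒮₂, -, hs₂, hcomp⟩
  refine (ok_walksCmd hb hs₂).mono ?_
  rintro s₃ - ⟨𝒮₃, h23, hs₃, hsweep⟩
  refine ⟨𝒮₃, hs₃.best, fun j v => ?_, hsweep⟩
  obtain ⟨S, hS, h⟩ := hcomp j v
  exact ⟨S, h23 hS, h⟩

end Walks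

/-! ### Comparing the integer data with the hypergraph -/

section Representation

variable {n m k : ℕ} {H : WeightedHypergraph (Fin n) k} {edge : Fin m → Finset (Fin n)}
  {weight : Fin m → ℕ}

/-- The integer data describe the hypergraph. -/
structure Represents (H : WeightedHypergraph (Fin n) k) (edge : Fin m → Finset (Fin n))
    (weight : Fin m → ℕ) : Prop where
  injective : Function.Injective edge
  edges : H.edges = Finset.univ.image edge
  prob : ∀ j, H.prob (edge j) = (weight j : ℝ) / ∑ i, (weight i : ℝ)

namespace Represents

theorem sum_edges (R : Represents H edge weight) (g : Finset (Fin n) → ℝ) :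
    ∑ e ∈ H.edges, g e = ∑ j, g (edge j) := by
  rw [R.edges, Finset.sum_image fun _ _ _ _ h => R.injective h]

theorem card_edges (R : Represents H edge weight) : H.edges.card = m := by
  rw [R.edges, Finset.card_image_of_injective _ R.injective, Finset.card_univ, Fintype.card_fin]

theorem weight_pos (R : Represents H edge weight) : 0 < ∑ i, (weight i : ℝ) := by
  refine (Finset.sum_nonneg fun i _ => Nat.cast_nonneg _).lt_of_ne fun h => ?_
  have h1 := H.sum_prob
  rw [R.sum_edges] at h1
  simp [R.prob, ← h] at h1

theorem deg_eq (R : Represents H edge weight) (v : Fin n) :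
    H.deg v = ideg edge weight v / ∑ i, (weight i : ℝ) := by
  rw [WeightedHypergraph.deg, Finset.sum_filter, R.sum_edges, ideg]
  push_cast
  rw [Finset.sum_div]
  refine Finset.sum_congr rfl fun j _ => ?_
  rw [R.prob]
  split_ifs <;> simp

theorem vol_eq (R : Represents H edge weight) (S : Finset (Fin n)) :
    H.vol S = ivol edge weight S / ∑ i, (weight i : ℝ) := by
  have : ∑ v ∈ S, H.deg v = ∑ v, if v ∈ S then H.deg v else 0 := by simp
  rw [WeightedHypergraph.vol, ivol, this]
  push_cast
  rw [Finset.sum_div]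
  refine Finset.sum_congr rfl fun v _ => ?_
  rw [R.deg_eq]
  split_ifs <;> simp

theorem vol_univ_eq (R : Represents H edge weight) :
    H.vol Finset.univ = itotal edge weight / ∑ i, (weight i : ℝ) := by
  rw [R.vol_eq]
  simp [ivol, itotal]

theorem boundary_eq (R : Represents H edge weight) (S : Finset (Fin n)) :
    ∑ e ∈ H.boundary S, H.prob e = icut edge weight S / ∑ i, (weight i : ℝ) := by
  rw [WeightedHypergraph.boundary, Finset.sum_filter, R.sum_edges, icut]
  push_cast
  rw [Finset.sum_div]
  refine Finset.sum_congr rfl fun j _ => ?_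
  rw [R.prob]
  split_ifs <;> simp

theorem expansion_eq (R : Represents H edge weight) (S : Finset (Fin n)) :
    H.expansion S = icut edge weight S / ivol edge weight S := by
  rw [WeightedHypergraph.expansion, R.boundary_eq, R.vol_eq,
    div_div_div_cancel_right₀ R.weight_pos.ne']

theorem isAdmissible_iff (R : Represents H edge weight) (S : Finset (Fin n)) :
    H.IsAdmissible S ↔ IsIntAdmissible edge weight S := by
  have hW := R.weight_pos
  rw [WeightedHypergraph.IsAdmissible, R.vol_univ_eq, R.vol_eq, IsIntAdmissible,
    div_right_comm, div_le_div_iff_of_pos_right hW, le_div_iff₀ two_pos, mul_comm]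
  refine and_congr ?_ (by exact_mod_cast Iff.rfl)
  rw [div_pos_iff_of_pos_right hW, Int.cast_pos]

theorem expansion_le_of_mul_le (R : Represents H edge weight) {A S : Finset (Fin n)}
    (hA : IsIntAdmissible edge weight A) (hS : IsIntAdmissible edge weight S)
    (h : icut edge weight A * ivol edge weight S ≤ icut edge weight S * ivol edge weight A) :
    H.expansion A ≤ H.expansion S := by
  rw [R.expansion_eq, R.expansion_eq,
    div_le_div_iff₀ (by exact_mod_cast hA.1) (by exact_mod_cast hS.1)]
  exact_mod_cast h

theorem isClosedAbove_iff (R : Represents H edge weight) (j : Fin m) (S : Finset (Fin n)) :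
    H.IsClosedAbove (edge j) S ↔ IsIntClosed edge weight j S := by
  have hlt : ∀ e, H.prob (edge j) < H.prob (edge e) ↔ weight j < weight e := fun e => by
    rw [R.prob, R.prob, div_lt_div_iff_of_pos_right R.weight_pos, Nat.cast_lt]
  rw [WeightedHypergraph.IsClosedAbove, R.edges, Finset.forall_mem_image]
  simp only [Finset.mem_univ, true_imp_iff, hlt]
  rfl

theorem isComponent_iff (R : Represents H edge weight) (j : Fin m) (v : Fin n)
    (S : Finset (Fin n)) :
    H.IsComponent (edge j) v S ↔ IsIntComponent edge weight j v S := by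
  simp only [WeightedHypergraph.IsComponent, IsIntComponent, R.isClosedAbove_iff]

/-- A non-zero degree divides the product of all of them, so the integer quotient is exact, and the
total weight cancels. At degree zero both sides vanish because division by zero gives zero. -/
theorem istep_eq (R : Represents H edge weight) (hk : 0 < k) (x : Fin n → ℤ) (u : Fin n) :
    (istep edge weight x u : ℝ) =
      k * idegProd edge weight * H.walk (fun w => (x w : ℝ)) u := by
  have hW := R.weight_pos
  rw [istep, WeightedHypergraph.walk, R.deg_eq]
  rcases eq_or_ne (ideg edge weight u) 0 with h0 | h0
  · simp [h0]
  · have hpos : 0 < ideg edge weight u := (ideg_nonneg edge weight u).lt_of_ne' h0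
    have hdvd : ideg edge weight u ∣ idegProd edge weight := by
      obtain ⟨c, hc⟩ := Finset.dvd_prod_of_mem
        (fun v => if 0 < ideg edge weight v then ideg edge weight v else 1) (Finset.mem_univ u)
      rw [if_pos hpos] at hc
      exact ⟨c, hc⟩
    have hpush : ∑ e ∈ H.edges with u ∈ e, H.prob e * ∑ w ∈ e, (x w : ℝ) =
        ipush edge weight x u / ∑ i, (weight i : ℝ) := by
      rw [Finset.sum_filter, R.sum_edges, ipush]
      push_cast
      rw [Finset.sum_div]
      refine Finset.sum_congr rfl fun j _ => ?_
      rw [R.prob]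
      split_ifs
      · rw [Finset.sum_ite_mem, Finset.univ_inter]
        ring
      · simp
    have h0' : (ideg edge weight u : ℝ) ≠ 0 := by exact_mod_cast h0
    have hk' : (k : ℝ) ≠ 0 := by exact_mod_cast hk.ne'
    rw [hpush, Int.cast_mul, Int.cast_div hdvd h0']
    have := hW.ne'
    field_simp

theorem iterate_istep_eq (R : Represents H edge weight) (hk : 0 < k) (v : Fin n) (t : ℕ)
    (u : Fin n) : (((istep edge weight)^[t] (Pi.single v 1) u : ℤ) : ℝ) =
      (k * idegProd edge weight) ^ t * H.walk^[t] (Pi.single v 1) u := by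
  induction t generalizing u with
  | zero => simp [Pi.single_apply]
  | succ t ih =>
    rw [Function.iterate_succ_apply', Function.iterate_succ_apply', R.istep_eq hk]
    simp only [ih]
    simp only [WeightedHypergraph.walk, ← Finset.mul_sum, mul_left_comm]
    ring

/-- The integer iterate is a positive multiple of the real one, with a factor independent of the
vertex, so both have the same sweep cuts. -/
theorem iterate_istep_le_iff (R : Represents H edge weight) (hk : 0 < k) (v : Fin n) (t : ℕ)
    (u w : Fin n) : (istep edge weight)^[t] (Pi.single v 1) u ≤
      (istep edge weight)^[t] (Pi.single v 1) w ↔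
        H.walk^[t] (Pi.single v 1) u ≤ H.walk^[t] (Pi.single v 1) w := by
  rw [← Int.cast_le (R := ℝ), R.iterate_istep_eq hk, R.iterate_istep_eq hk]
  refine mul_le_mul_iff_right₀ (pow_pos (mul_pos (Nat.cast_pos.2 hk) ?_) t)
  exact_mod_cast one_le_idegProd edge weight

theorem output_good (R : Represents H edge weight) {l : ℕ} {ε : ℝ} (hl : 2 ≤ l) (hlk : l ≤ k)
    (hε : 0 < ε) (h : secondEigenvalue (H.upDownWalk 1 (l - 1)) = 1 - ε ∨
      secondEigenvalue (H.bipartiteWalk 1 (l - 1)) = 1 - ε) {s : State}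
    {𝒮 : Set (Finset (Fin n))} (hbest : HasBest edge weight 𝒮 s)
    (hcomp : ∀ j v, ∃ S ∈ 𝒮, IsIntComponent edge weight j v S)
    (hsweep : ∀ v w,
      (Finset.univ.filter fun u => (istep edge weight)^[n ^ 5 * m ^ 2] (Pi.single v 1) w ≤
        (istep edge weight)^[n ^ 5 * m ^ 2] (Pi.single v 1) u) ∈ 𝒮 ∧
      (Finset.univ.filter fun u => (istep edge weight)^[n ^ 5 * m ^ 2] (Pi.single v 1) u ≤
        (istep edge weight)^[n ^ 5 * m ^ 2] (Pi.single v 1) w) ∈ 𝒮) :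
    H.IsAdmissible (outputSet n s) ∧ H.expansion (outputSet n s) ≤ 4 * √ε := by
  have hk : 0 < k := by omega
  obtain ⟨O, hO, hcase⟩ := hbest
  have hout : outputSet n s = O := by
    ext v
    simp [outputSet, hO v]
  rw [hout]
  have key : ∀ S ∈ 𝒮, H.IsAdmissible S → H.IsAdmissible O ∧ H.expansion O ≤ H.expansion S := by
    intro S hS hadm
    rw [R.isAdmissible_iff] at hadm
    rcases hcase with ⟨-, -, hnone⟩ | ⟨-, -, hadmO, hall⟩
    · exact absurd hadm (hnone S hS)
    · exact ⟨(R.isAdmissible_iff O).2 hadmO, R.expansion_le_of_mul_le hadmO hadm (hall S hS hadm)⟩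
  refine H.expansion_le_of_candidates l ε hl hlk hε h (n ^ 5 * m ^ 2)
    (by rw [Fintype.card_fin, R.card_edges]) O ?_ ?_ ?_
  · rw [R.edges, Finset.forall_mem_image]
    intro j _ v
    obtain ⟨S, hS, hS'⟩ := hcomp j v
    exact ⟨S, (R.isComponent_iff j v S).2 hS', key S hS⟩
  · intro v w
    simp only [← R.iterate_istep_le_iff hk]
    exact fun hadm => (key _ (hsweep v w).1 hadm).2
  · intro v w
    simp only [← R.iterate_istep_le_iff hk]
    exact fun hadm => (key _ (hsweep v w).2 hadm).2

end Represents

end Representation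

/-! ### Polynomial bounds for the bit lengths, and the input state -/

section Size

variable {n m : ℕ} (edge : Fin m → Finset (Fin n)) (weight : Fin m → ℕ)

theorem ideg_le_sum (v : Fin n) : ideg edge weight v ≤ ∑ j, (weight j : ℤ) :=
  Finset.sum_le_sum fun j _ => by
    split_ifs
    · exact le_rfl
    · positivity

/-- Each weight is below `2^(x+1)` by its logarithm, and there are at most `2^x` of them. -/
theorem sum_weight_le {x : ℕ} (hx : m + ∑ j, Nat.log 2 (weight j) ≤ x) :
    ∑ j, (weight j : ℤ) ≤ 2 ^ (2 * x + 1) := by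
  have h1 : ∀ j, (weight j : ℤ) ≤ 2 ^ (x + 1) := fun j => by
    have h2 : weight j < 2 ^ (Nat.log 2 (weight j) + 1) := Nat.lt_pow_succ_log_self (by norm_num) _
    have h3 : Nat.log 2 (weight j) ≤ ∑ j, Nat.log 2 (weight j) :=
      Finset.single_le_sum (f := fun j => Nat.log 2 (weight j)) (fun _ _ => Nat.zero_le _)
        (Finset.mem_univ j)
    have h4 : 2 ^ (Nat.log 2 (weight j) + 1) ≤ 2 ^ (x + 1) :=
      Nat.pow_le_pow_right (by norm_num) (by omega)
    exact_mod_cast h2.le.trans h4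
  calc ∑ j, (weight j : ℤ) ≤ ∑ _j : Fin m, 2 ^ (x + 1) := Finset.sum_le_sum fun j _ => h1 j
    _ = m * 2 ^ (x + 1) := by simp
    _ ≤ 2 ^ x * 2 ^ (x + 1) := by
      gcongr
      have : m < 2 ^ m := Nat.lt_two_pow_self
      have h2 : 2 ^ m ≤ 2 ^ x := Nat.pow_le_pow_right (by norm_num) (by omega)
      exact_mod_cast this.le.trans h2
    _ = 2 ^ (2 * x + 1) := by ring

theorem idegProd_le {M : ℤ} (hM : 1 ≤ M) (h : ∑ j, (weight j : ℤ) ≤ M) :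
    idegProd edge weight ≤ M ^ n := by
  calc idegProd edge weight ≤ ∏ _v : Fin n, M := by
        refine Finset.prod_le_prod (fun v _ => ?_) fun v _ => ?_
        · split_ifs with hv
          · exact hv.le
          · exact zero_le_one
        · split_ifs
          · exact (ideg_le_sum edge weight v).trans h
          · exact hM
    _ = M ^ n := by simp

theorem sum_edge_le {M X : ℤ} (hn : n ≤ M) {x : Fin n → ℤ} (hX : ∀ v, x v ≤ X) (h0 : 0 ≤ X)
    (j : Fin m) : ∑ w, (if w ∈ edge j then x w else 0) ≤ M * X := by
  calc ∑ w, (if w ∈ edge j then x w else 0) ≤ ∑ _w : Fin n, X :=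
        Finset.sum_le_sum fun w _ => by
          split_ifs
          · exact hX w
          · exact h0
    _ = n * X := by simp
    _ ≤ M * X := by gcongr

theorem ipush_le {M X : ℤ} (hn : n ≤ M) (h : ∑ j, (weight j : ℤ) ≤ M) {x : Fin n → ℤ}
    (hX : ∀ v, x v ≤ X) (h0 : 0 ≤ X) (u : Fin n) : ipush edge weight x u ≤ M ^ 2 * X := by
  have hM : 0 ≤ M := (Int.natCast_nonneg n).trans hn
  calc ipush edge weight x u ≤ ∑ j, (weight j : ℤ) * (M * X) :=
        Finset.sum_le_sum fun j _ => by
          split_ifs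
          · gcongr
            exact sum_edge_le edge hn hX h0 j
          · positivity
    _ = (∑ j, (weight j : ℤ)) * (M * X) := by rw [Finset.sum_mul]
    _ ≤ M * (M * X) := by gcongr
    _ = M ^ 2 * X := by ring

theorem istep_le {M X : ℤ} (hM : 1 ≤ M) (hn : n ≤ M) (h : ∑ j, (weight j : ℤ) ≤ M)
    {x : Fin n → ℤ} (hX : ∀ v, x v ≤ X) (h0 : 0 ≤ X) (u : Fin n) :
    istep edge weight x u ≤ M ^ (n + 2) * X := by
  have hQ : 0 ≤ idegProd edge weight := zero_le_one.trans (one_le_idegProd edge weight)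
  calc istep edge weight x u ≤ (M ^ 2 * X) * (idegProd edge weight / ideg edge weight u) := by
        unfold istep
        gcongr
        · exact Int.ediv_nonneg hQ (ideg_nonneg edge weight u)
        · exact ipush_le edge weight hn h hX h0 u
    _ ≤ (M ^ 2 * X) * M ^ n := by
        gcongr
        exact (Int.ediv_le_self _ hQ).trans (idegProd_le edge weight hM h)
    _ = M ^ (n + 2) * X := by ring

/-- One step multiplies the bound by `M^(n+2)`: a factor `M` for the sum over a hyperedge, one for
the weights, and `M^n` for the product of the degrees. -/
theorem iterate_istep_le {M : ℤ} (hM : 1 ≤ M) (hn : n ≤ M) (h : ∑ j, (weight j : ℤ) ≤ M)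
    (v : Fin n) (t : ℕ) (u : Fin n) :
    (istep edge weight)^[t] (Pi.single v 1) u ≤ M ^ ((n + 2) * t) := by
  induction t generalizing u with
  | zero =>
    rw [Function.iterate_zero, id, Pi.single_apply]
    split_ifs <;> simp
  | succ t ih =>
    rw [Function.iterate_succ_apply']
    refine (istep_le edge weight hM hn h ih (by positivity) u).trans (le_of_eq ?_)
    rw [← pow_add]
    congr 1
    ring

/-- A bound for the bit length of the integers in the computation. -/
noncomputable def sizePolynomial : Polynomial ℕ :=
  (2 * .X + 1) * ((.X + 2) * (.X ^ 7 + 1) + 7) + 1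

theorem eval_sizePolynomial (x : ℕ) :
    sizePolynomial.eval x = (2 * x + 1) * ((x + 2) * (x ^ 7 + 1) + 7) + 1 := by
  simp [sizePolynomial]

theorem steps_le {x : ℕ} (hn : n ≤ x) (hm : m ≤ x) : n ^ 5 * m ^ 2 ≤ x ^ 7 := by
  calc n ^ 5 * m ^ 2 ≤ x ^ 5 * x ^ 2 := by gcongr
    _ = x ^ 7 := by ring

theorem fits_sizePolynomial {x : ℕ} (hx : n + m + ∑ j, Nat.log 2 (weight j) ≤ x) :
    Fits edge weight (n ^ 5 * m ^ 2) (sizePolynomial.eval x) := by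
  have hnx : n ≤ x := by omega
  have hmx : m ≤ x := by omega
  have hT := steps_le hnx hmx
  set T := n ^ 5 * m ^ 2 with hTdef
  set M : ℤ := 2 ^ (2 * x + 1) with hM
  set E : ℕ := (x + 2) * (x ^ 7 + 1) + 7 with hE
  have hM1 : 1 ≤ M := one_le_pow₀ (by norm_num)
  have hxM : (x : ℤ) ≤ M := by
    have h1 : x < 2 ^ x := Nat.lt_two_pow_self
    have h2 : 2 ^ x ≤ 2 ^ (2 * x + 1) := Nat.pow_le_pow_right (by norm_num) (by omega)
    rw [hM]
    exact_mod_cast h1.le.trans h2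
  have hn : (n : ℤ) ≤ M := le_trans (by exact_mod_cast hnx) hxM
  have hm : (m : ℤ) ≤ M := le_trans (by exact_mod_cast hmx) hxM
  have hW : ∑ j, (weight j : ℤ) ≤ M := sum_weight_le weight (by omega)
  -- Each quantity is at most `M^i` with `i ≤ E`, and `M^E = 2^((2x+1)E)`. The exponent `E` has room
  -- for `(n+2)(t+1)` with `t < T ≤ x⁷`, and for the 7 needed by `T` itself.
  have key : ∀ {z : ℤ} (i : ℕ), z ≤ M ^ i → i ≤ E → z < 2 ^ sizePolynomial.eval x := by
    intro z i hz hi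
    have h1 : M ^ i ≤ M ^ E := pow_le_pow_right₀ hM1 hi
    have h2 : M ^ E = 2 ^ ((2 * x + 1) * E) := by rw [hM, ← pow_mul]
    have h4 : sizePolynomial.eval x = (2 * x + 1) * E + 1 := eval_sizePolynomial x
    rw [h4, pow_succ]
    have h3 : (0 : ℤ) < 2 ^ ((2 * x + 1) * E) := by positivity
    omega
  have hE7 : 7 ≤ E := by omega
  have hEt : ∀ t < T, (n + 2) * (t + 1) ≤ E := by
    intro t ht
    have : (n + 2) * (t + 1) ≤ (x + 2) * (x ^ 7 + 1) := Nat.mul_le_mul (by omega) (by omega)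
    omega
  have hstep : ∀ t, M ^ ((n + 2) * t) * M ^ (n + 2) = M ^ ((n + 2) * (t + 1)) := by
    intro t
    rw [← pow_add]
    congr 1
  have hpow : ∀ t i, i ≤ n + 2 → M ^ i * M ^ ((n + 2) * t) ≤ M ^ ((n + 2) * (t + 1)) := by
    intro t i hi
    rw [← hstep, mul_comm]
    gcongr
  refine ⟨?_, key 1 (by simpa using hn) (by omega), key 1 (by simpa using hm) (by omega),
    key 7 ?_ hE7, key 1 (by simpa using hW) (by omega), key 2 ?_ (by omega), key n
      (idegProd_le edge weight hM1 hW) ?_, ?_, ?_, ?_⟩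
  · rw [eval_sizePolynomial]
    omega
  · calc (T : ℤ) ≤ (x : ℤ) ^ 7 := by exact_mod_cast hT
      _ ≤ M ^ 7 := by gcongr
  · calc itotal edge weight ≤ ∑ _v : Fin n, M :=
          Finset.sum_le_sum fun v _ => (ideg_le_sum edge weight v).trans hW
      _ = n * M := by simp
      _ ≤ M * M := by gcongr
      _ = M ^ 2 := by ring
  · have : x + 2 ≤ (x + 2) * (x ^ 7 + 1) := Nat.le_mul_of_pos_right _ (by positivity)
    omega
  · intro v t ht j
    refine key _ ((sum_edge_le edge hn (iterate_istep_le edge weight hM1 hn hW v t)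
      (by positivity) j).trans ?_) (hEt t ht)
    simpa using hpow t 1 (by omega)
  · intro v t ht u
    exact key _ ((ipush_le edge weight hn hW (iterate_istep_le edge weight hM1 hn hW v t)
      (by positivity) u).trans (hpow t 2 (by omega))) (hEt t ht)
  · intro v t ht u
    exact key _ (iterate_istep_le edge weight hM1 hn hW v (t + 1) u) (hEt t ht)

theorem hasInput_inputState : HasInput edge weight (inputState edge weight) := by
  refine ⟨rfl, rfl, fun j => by simp [inputState], fun j v => ?_⟩
  have : (∃ (j' : Fin m) (v' : Fin n), (j : ℕ) * n + v = j'.1 * n + v'.1 ∧ v' ∈ edge j') ↔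
      v ∈ edge j := by
    constructor
    · rintro ⟨j', v', h1, h2⟩
      have hn : 0 < n := v.pos
      have hj : j.1 = j'.1 := by
        have := congrArg (· / n) h1
        simpa [Nat.add_div_of_dvd_right, Nat.mul_add_div, mul_comm _ n, Nat.add_div, hn,
          Nat.mul_div_cancel_left, Nat.div_eq_of_lt v.2, Nat.div_eq_of_lt v'.2] using this
      have hv : v = v' := Fin.ext (by rw [hj] at h1; omega)
      rw [Fin.ext hj, hv]
      exact h2
    · exact fun h => ⟨j, v, rfl, h⟩
  simp only [inputState, one_ne_zero, if_false, if_true, this]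

theorem bounded_inputState {T b : ℕ} (hb : Fits edge weight T b) (d : ℕ) :
    Bounded d b (inputState edge weight) := by
  have h0 : bitLength 0 ≤ b := by
    rw [bitLength_zero]
    exact Nat.zero_le b
  have h1 : bitLength 1 ≤ b := by
    rw [bitLength_one]
    exact hb.one_le
  constructor
  · intro r _
    simp only [inputState]
    split_ifs
    · exact bitLength_le_of_nonneg (Int.natCast_nonneg n) hb.card
    · exact bitLength_le_of_nonneg (Int.natCast_nonneg m) hb.card_edges
    · exact h0
  · intro A i
    simp only [inputState]
    split_ifs
    · refine bitLength_le_of_nonneg (Int.natCast_nonneg _) (lt_of_le_of_lt ?_ hb.weights)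
      exact Finset.single_le_sum (f := fun j => (weight j : ℤ))
        (fun _ _ => Int.natCast_nonneg _) (Finset.mem_univ _)
    · exact h0
    · exact h1
    · exact h0
    · exact h0

end Size

/-! ### The algorithm and its running time -/

/-- The algorithm. -/
def expansionProg : Prog := .seq (stepsCmd.code 64) (mainCmd.code 64)

theorem stepsCmd_wf : stepsCmd.WF 64 := by
  simp [stepsCmd, WF, Ex.Below]

theorem mainCmd_wf : mainCmd.WF 64 := by
  simp [mainCmd, prepareCmd, componentsCmd, componentCmd, growCmd, walksCmd, powerCmd, pushCmd,
    updateCmd, sweepCmd, evalCmd, cutCmd, betterEx, chooseEx, sumLoop, mapLoop, incidenceEx, WF,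
    regs, Ex.Below]

/-- `Cmd.exec_code` requires that registers bounding loops are never assigned to. The number of
steps in register `2` is such a bound, which is why a separate command computes it beforehand. -/
theorem mainCmd_bounds : ∀ a ∈ mainCmd.bounds, a ≤ 2 ∧ a ∉ mainCmd.regs := by
  decide

theorem exec_expansionProg {n m : ℕ} (edge : Fin m → Finset (Fin n)) (weight : Fin m → ℕ) {b : ℕ}
    (hb : Fits edge weight (n ^ 5 * m ^ 2) b) {N : ℕ → ℕ} (hN : ∀ a, n + m + n ^ 5 * m ^ 2 ≤ N a) :
    ∃ s t 𝒮, Exec expansionProg (inputState edge weight) s t ∧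
      t ≤ (stepsCmd.time N + mainCmd.time N) * (b + 1) ^ 2 ∧ HasBest edge weight 𝒮 s ∧
      (∀ j v, ∃ S ∈ 𝒮, IsIntComponent edge weight j v S) ∧ ∀ v w,
      (Finset.univ.filter fun u => (istep edge weight)^[n ^ 5 * m ^ 2] (Pi.single v 1) w ≤
        (istep edge weight)^[n ^ 5 * m ^ 2] (Pi.single v 1) u) ∈ 𝒮 ∧
      (Finset.univ.filter fun u => (istep edge weight)^[n ^ 5 * m ^ 2] (Pi.single v 1) u ≤
        (istep edge weight)^[n ^ 5 * m ^ 2] (Pi.single v 1) w) ∈ 𝒮 := by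
  obtain ⟨hsafe₁, hin₁, h2, hm⟩ := ok_stepsCmd (hasInput_inputState edge weight) hb
  obtain ⟨s₁, t₁, e₁, a₁, b₁, c₁⟩ := stepsCmd.exec_code (N := N) stepsCmd_wf _
    (by simp [stepsCmd, bounds]) (bounded_inputState edge weight hb 64) hsafe₁ _ ⟨fun _ _ => rfl, rfl⟩
  obtain ⟨hsafe₂, 𝒮, hbest, hcomp, hsweep⟩ := ok_mainCmd hb hin₁ h2
    (fun v => by rw [hm]; simp [inputState])
  obtain ⟨s₂, t₂, e₂, a₂, -, c₂⟩ := mainCmd.exec_code (N := N) mainCmd_wf _ (fun a ha => by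
    obtain ⟨h3, h4⟩ := mainCmd_bounds a ha
    refine ⟨h4, le_trans ?_ (hN a)⟩
    interval_cases a
    · rw [hin₁.reg_zero, Int.toNat_natCast]
      omega
    · rw [hin₁.reg_one, Int.toNat_natCast]
      omega
    · rw [h2, Int.toNat_natCast]
      omega) b₁ hsafe₂ _ a₁
  refine ⟨s₂, _, 𝒮, .seq e₁ e₂, ?_, ?_, hcomp, hsweep⟩
  · rw [add_mul]
    exact add_le_add c₁ c₂
  · exact hbest.congr (a₂.1 5 (by norm_num)) (a₂.1 6 (by norm_num)) (by rw [a₂.2])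

theorem exists_algorithm : ∃ (P : Prog) (p : Polynomial ℕ),
    ∀ (n m k l : ℕ) (H : WeightedHypergraph (Fin n) k) (ε : ℝ)
      (edge : Fin m → Finset (Fin n)) (weight : Fin m → ℕ),
      2 ≤ l → l ≤ k → 0 < ε →
      (secondEigenvalue (H.upDownWalk 1 (l - 1)) = 1 - ε ∨
        secondEigenvalue (H.bipartiteWalk 1 (l - 1)) = 1 - ε) →
      Represents H edge weight →
      ∃ (s : State) (t : ℕ),
        Exec P (inputState edge weight) s t ∧
        t ≤ p.eval (n + m + ∑ j, Nat.log 2 (weight j)) ∧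
        H.IsAdmissible (outputSet n s) ∧
        H.expansion (outputSet n s) ≤ 4 * √ε := by
  obtain ⟨q₁, hq₁⟩ := stepsCmd.exists_polynomial_time (.X + .X ^ 7)
  obtain ⟨q₂, hq₂⟩ := mainCmd.exists_polynomial_time (.X + .X ^ 7)
  refine ⟨expansionProg, (q₁ + q₂) * (sizePolynomial + 1) ^ 2, ?_⟩
  intro n m k l H ε edge weight hl hlk hε h R
  set x := n + m + ∑ j, Nat.log 2 (weight j) with hx
  obtain ⟨s, t, 𝒮, hexec, ht, hbest, hcomp, hsweep⟩ := exec_expansionProg edge weight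
    (fits_sizePolynomial edge weight hx.ge) (N := fun _ => n + m + n ^ 5 * m ^ 2)
    fun _ => le_rfl
  refine ⟨s, t, hexec, ht.trans ?_, R.output_good hl hlk hε h hbest hcomp hsweep⟩
  have hN : ∀ _a : ℕ, n + m + n ^ 5 * m ^ 2 ≤ (Polynomial.X + Polynomial.X ^ 7).eval x := by
    intro _
    have := steps_le (n := n) (m := m) (x := x) (by omega) (by omega)
    simp only [Polynomial.eval_add, Polynomial.eval_X, Polynomial.eval_pow]
    omega
  simp only [Polynomial.eval_mul, Polynomial.eval_add, Polynomial.eval_pow, Polynomial.eval_one]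
  gcongr
  · exact hq₁ x _ hN
  · exact hq₂ x _ hN

end HypergraphWalk

open HypergraphWalk in
theorem theorem2p1 :
    (∀ {V : Type*} [Fintype V] [DecidableEq V] (k l : ℕ) (H : WeightedHypergraph V k) (ε : ℝ),
      2 ≤ l → l ≤ k → 0 < ε →
      (secondEigenvalue (H.upDownWalk 1 (l - 1)) = 1 - ε ∨
        secondEigenvalue (H.bipartiteWalk 1 (l - 1)) = 1 - ε) →
      ε / k ≤ H.conductance ∧ H.conductance ≤ 4 * √ε) ∧
    ∃ (P : Prog) (p : Polynomial ℕ),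
      ∀ (n m k l : ℕ) (H : WeightedHypergraph (Fin n) k) (ε : ℝ)
        (edge : Fin m → Finset (Fin n)) (weight : Fin m → ℕ),
        2 ≤ l → l ≤ k → 0 < ε →
        (secondEigenvalue (H.upDownWalk 1 (l - 1)) = 1 - ε ∨
          secondEigenvalue (H.bipartiteWalk 1 (l - 1)) = 1 - ε) →
        Function.Injective edge → H.edges = Finset.univ.image edge →
        (∀ j, 0 < weight j) →
        (∀ j, H.prob (edge j) = (weight j : ℝ) / ∑ i, (weight i : ℝ)) →
        ∃ (s : State) (t : ℕ),
          Exec P (inputState edge weight) s t ∧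
          t ≤ p.eval (n + m + ∑ j, Nat.log 2 (weight j)) ∧
          H.IsAdmissible (outputSet n s) ∧
          H.expansion (outputSet n s) ≤ 4 * √ε := by
  refine ⟨fun k l H ε hl hlk hε h => H.expansion_bounds l ε hl hlk hε h, ?_⟩
  obtain ⟨P, p, hP⟩ := exists_algorithm
  exact ⟨P, p, fun n m k l H ε edge weight hl hlk hε h hinj hedges _ hprob =>
    hP n m k l H ε edge weight hl hlk hε h ⟨hinj, hedges, hprob⟩⟩
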